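/- Let $G$ be a connected complex semisimple affine algebraic group (in particular, the connected and simply connected one with a given semisimple Lie algebra), with coordinate ring $\mathbb{C}[G]$ and Lie algebra $\mathfrak{g}$. For $x\in\mathfrak g$ let $x^L$, $x^R$ be the left, respectively right, invariant vector field on $G$ with value $x$ at the identity, and for a Lie algebra $\mathfrak a$ and $x \in \mathfrak a$ let $(x)_j\in\mathfrak a^m$ be the image of $x$ in the $j$-th component. Fix a Cartan subalgebra $\mathfrak t\subset\mathfrak g$, a system $\triangle_+$ of positive roots, root vectors $e_{\pm\alpha}\in\mathfrak g_{\pm\alpha}$ ($\alpha\in\triangle_+$) with $\langle e_\alpha,e_{-\alpha}\rangle=1$ for the Killing form, and a basis $(h_i)$ of $\mathfrak t$ that is orthonormal for the Killing form. Let $r_0=\frac12\sum_i h_i\otimes h_i$ and $r_{st}=r_0+\sum_{\alpha\in\triangle_+}e_{-\alpha}\otimes e_\alpha$, with antisymmetric part $\Lambda_{st}$, and let $\delta_{r_{st}}(x)=[x,r_{st}]$. Let $N\subset G$ be the connected subgroup with Lie algebra $\mathfrak n=\sum_{\alpha\in\triangle_+}\mathfrak g_\alpha$ (the unipotent radical of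 the Borel subgroup with Lie algebra $\mathfrak t+\mathfrak n$), and $\mathbb C[N\backslash G]=\{f\in\mathbb C[G]: f(ng)=f(g),\ n\in N,\ g\in G\}$. For $r=\sum_i x_i\otimes y_i\in\mathfrak a\otimes\mathfrak a$ and $m\ge1$ put $$\mathrm{Mix}^m(r)=\sum_{1\le k<l\le m}\sum_i (y_i)_k\wedge(x_i)_l,\qquad r^{(m)}=(r,\dots,r)-\mathrm{Mix}^m(r),$$ where $x\wedge y=x\otimes y-y\otimes x$. Let $\Lambda_{st}^{(m)}$ be the antisymmetric part of $r_{st}^{(m)}$, let $\pi_{st}^{(m)}=(\Lambda_{st}^{(m)})^L-(\Lambda_{st}^{(m)})^R$ on $G^m$ (the polyuble structure), and let $\{\,,\}^{(m)}_{r_{st}}$ be its bracket on $\mathbb C[G^m]=\mathbb C[G]^{\otimes m}$; write $\pi_{st}=\pi_{st}^{(1)}$. Let $\tilde{\mathfrak g}=\mathfrak g\oplus\mathfrak t$, $\tilde r_{st}=(r_{st},0)-(0,r_0)$, and $\rho(y,x)=y^L-x^R$ for $y\in\mathfrak g$, $x\in\mathfrak t$. **Theorem.** The algebra $\mathbb C[N\backslash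 G]$ is stable under $\{\,,\}^{(1)}_{r_{st}}$ and under $\rho(\tilde{\mathfrak g})$; write $\pi^{(1)}$ for the Poisson structure on $N\backslash G$ given by the restricted bracket, and let $\pi^{(m)}=(\pi^{(1)})^m-\rho^{(m)}(\mathrm{Mix}^m(\tilde r_{st}))$ on $(N\backslash G)^m$, where $\rho^{(m)}(z_1,\dots,z_m)=(\rho(z_1),\dots,\rho(z_m))$, with bracket $\{\,,\}^{(m)}$ on $\mathbb C[N\backslash G]^{\otimes m}$. For every $m\ge1$: 1. $(G,\pi_{st})$ is a Poisson Lie group, $\{\,,\}^{(m)}$ is a Poisson bracket, and the diagonal right action $(N.g_1,\dots,N.g_m)\cdot g=(N.g_1g,\dots,N.g_mg)$ is a Poisson action of $(G,\pi_{st})$ on $((N\backslash G)^m,\pi^{(m)})$, i.e. the action map $(N\backslash G)^m\times G\to(N\backslash G)^m$ is Poisson. Likewise infinitesimally: $r_{st}$ is a quasitriangular $r$-matrix and $\phi(y)=(y^L,\dots,y^L)$ is a Poisson action of the Lie bialgebra $(\mathfrak g,\delta_{r_{st}})$ on $(\mathbb C[N\backslash G]^{\otimes m},\{\,,\}^{(m)})$,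 i.e. $\phi$ is a Lie algebra morphism to derivations and $$\phi(\delta_{r_{st}}(y))(f\wedge g)=\phi(y)\{f,g\}^{(m)}-\{\phi(y)f,g\}^{(m)}-\{f,\phi(y)g\}^{(m)}.$$ 2. $\{\,,\}^{(m)}_{r_{st}}$ is a Poisson bracket on $\mathbb C[G^m]$; the natural map $\mathbb C[N\backslash G]^{\otimes m}\to\mathbb C[G^m]$ is injective, with image the algebra $\mathbb C[(N\backslash G)^m]$ of functions invariant under left translation by $N^m$; this image is a Poisson subalgebra, and $\{f,g\}^{(m)}_{r_{st}}=\{f,g\}^{(m)}$ for all $f,g\in\mathbb C[N\backslash G]^{\otimes m}$. That is, $\pi_{st}^{(m)}$ projects to $\pi^{(m)}$. -/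

import Mathlib

open scoped TensorProduct

noncomputable section

namespace PolyPoisson

/-! ### Poisson algebras, two-tensors acting as biderivations, `r`-matrices -/

section Generic

variable {B : Type*} [CommRing B] [Algebra ℂ B]
variable {V : Type*} [AddCommGroup V] [Module ℂ V]
variable {L : Type*} [LieRing L] [LieAlgebra ℂ L]

/-- `{ , }` is a Poisson bracket on the commutative algebra `B`: a Lie bracket which is a
derivation in each factor. -/
structure IsPoissonBracket (br : B →ₗ[ℂ] B →ₗ[ℂ] B) : Prop where
  self_eq_zero : ∀ f, br f f = 0
  jacobi : ∀ f g h, br f (br g h) + br g (br h f) + br h (br f g) = 0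
  leibniz_left : ∀ f g h, br (f * g) h = f * br g h + g * br f h
  leibniz_right : ∀ f g h, br f (g * h) = g * br f h + h * br f g

/-- For a linear map `ρ : V → Der B`, the bilinear operation `ρ(t)` on `B` attached to a
two-tensor `t ∈ V ⊗ V`: `ρ(x ⊗ y)(f, g) = ρ(x)(f) ρ(y)(g)`. With `x ∧ y = x ⊗ y - y ⊗ x`, the
value of the bivector field `ρ(x ∧ y)` on `f ∧ g` is `ρ(x)(f) ρ(y)(g) - ρ(y)(f) ρ(x)(g)`. -/
def act₂ (ρ : V →ₗ[ℂ] Derivation ℂ B B) : V ⊗[ℂ] V →ₗ[ℂ] B →ₗ[ℂ] B →ₗ[ℂ] B :=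
  TensorProduct.lift <| LinearMap.mk₂ ℂ
    (fun x y => (LinearMap.mul ℂ B).compl₁₂ (ρ x : B →ₗ[ℂ] B) (ρ y : B →ₗ[ℂ] B))
    (fun x x' y => by ext f g; simp)
    (fun c x y => by ext f g; simp)
    (fun x y y' => by ext f g; simp [mul_add])
    (fun c x y => by ext f g; simp)

/-- The flip `r ↦ r₂₁`. -/
def flip₂ (r : V ⊗[ℂ] V) : V ⊗[ℂ] V := TensorProduct.comm ℂ V V r

/-- The symmetric part `(r + r₂₁) / 2`. -/
def symmPart (r : V ⊗[ℂ] V) : V ⊗[ℂ] V := (1 / 2 : ℂ) • (r + flip₂ r)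

/-- The antisymmetric part `(r - r₂₁) / 2`. -/
def skewPart (r : V ⊗[ℂ] V) : V ⊗[ℂ] V := (1 / 2 : ℂ) • (r - flip₂ r)

section CYBE

attribute [local instance] LieRing.ofAssociativeRing

/-- The three embeddings `L → U(L) → U(L) ⊗ U(L) ⊗ U(L)`. -/
def leg : Fin 3 → L →ₗ[ℂ] (UniversalEnvelopingAlgebra ℂ L ⊗[ℂ]
    (UniversalEnvelopingAlgebra ℂ L ⊗[ℂ] UniversalEnvelopingAlgebra ℂ L))
  | 0 => (TensorProduct.mk ℂ _ _).flip 1 ∘ₗ (UniversalEnvelopingAlgebra.ι ℂ (L := L)).toLinearMap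
  | 1 => TensorProduct.mk ℂ _ _ 1 ∘ₗ (TensorProduct.mk ℂ _ _).flip 1 ∘ₗ
      (UniversalEnvelopingAlgebra.ι ℂ (L := L)).toLinearMap
  | 2 => TensorProduct.mk ℂ _ _ 1 ∘ₗ TensorProduct.mk ℂ _ _ 1 ∘ₗ
      (UniversalEnvelopingAlgebra.ι ℂ (L := L)).toLinearMap

end CYBE

/-- `r_{ab} ∈ U(L)^{⊗ 3}`. -/
def place (a b : Fin 3) (r : L ⊗[ℂ] L) : UniversalEnvelopingAlgebra ℂ L ⊗[ℂ]
    (UniversalEnvelopingAlgebra ℂ L ⊗[ℂ] UniversalEnvelopingAlgebra ℂ L) :=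
  TensorProduct.lift ((LinearMap.mul ℂ _).compl₁₂ (leg a) (leg b)) r

/-- `r` is a quasitriangular `r`-matrix: its symmetric part is invariant and it solves the
classical Yang-Baxter equation in `U(L)^{⊗ 3}`. -/
structure IsQuasitriangular (r : L ⊗[ℂ] L) : Prop where
  invariant : ∀ x : L, ⁅x, symmPart r⁆ = 0
  cybe : (place 0 1 r * place 0 2 r - place 0 2 r * place 0 1 r)
    + (place 0 1 r * place 1 2 r - place 1 2 r * place 0 1 r)
    + (place 0 2 r * place 1 2 r - place 1 2 r * place 0 2 r) = 0

/-- `ρ` is a (right) Poisson action of the quasitriangular Lie bialgebra `(L, δ_r)`,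
`δ_r(x) = [x, r]`, on the Poisson algebra `(B, { , })`. -/
structure IsPoissonAction (r : L ⊗[ℂ] L) (ρ : L →ₗ[ℂ] Derivation ℂ B B)
    (br : B →ₗ[ℂ] B →ₗ[ℂ] B) : Prop where
  quasitriangular : IsQuasitriangular r
  poisson : IsPoissonBracket br
  map_lie : ∀ x y, ρ ⁅x, y⁆ = ⁅ρ x, ρ y⁆
  compat : ∀ x f g, act₂ ρ ⁅x, r⁆ f g = ρ x (br f g) - (br (ρ x f) g + br f (ρ x g))

/-- Restriction of a bilinear operation to a subalgebra. -/
def restrictBracket (S : Subalgebra ℂ B) (br : B →ₗ[ℂ] B →ₗ[ℂ] B)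
    (hbr : ∀ f ∈ S, ∀ g ∈ S, br f g ∈ S) : S →ₗ[ℂ] S →ₗ[ℂ] S :=
  LinearMap.mk₂ ℂ (fun f g => ⟨br f g, hbr f f.2 g g.2⟩)
    (fun f f' g => by ext; simp) (fun c f g => by ext; simp)
    (fun f g g' => by ext; simp) (fun c f g => by ext; simp)

/-- Restriction of a family of derivations to a subalgebra. -/
def restrictAction (S : Subalgebra ℂ B) (ρ : V →ₗ[ℂ] Derivation ℂ B B)
    (hρ : ∀ x, ∀ f ∈ S, ρ x f ∈ S) : V →ₗ[ℂ] Derivation ℂ S S where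
  toFun x := Derivation.mk'
    { toFun := fun f => ⟨ρ x f, hρ x f f.2⟩
      map_add' := fun f g => by ext; simp
      map_smul' := fun c f => by ext; simp }
    (fun f g => by ext; simp)
  map_add' x y := by ext f; simp
  map_smul' c x := by ext f; simp

end Generic

/-! ### `m`-fold products -/

section Power

variable {B : Type*} [CommRing B] [Algebra ℂ B]
variable {V : Type*} [AddCommGroup V] [Module ℂ V]
variable (m : ℕ)

/-- The tensor power `B^{⊗ m}`. -/
abbrev Pow (B : Type*) [CommRing B] [Algebra ℂ B] (m : ℕ) : Type _ := ⨂[ℂ] _ : Fin m, B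

/-- The linear map `id ⊗ ⋯ ⊗ D ⊗ ⋯ ⊗ id` with `D` at the `j`-th place. -/
def slotMap (j : Fin m) (D : B →ₗ[ℂ] B) : Pow B m →ₗ[ℂ] Pow B m :=
  PiTensorProduct.map (Function.update (fun _ => LinearMap.id) j D)

lemma slotMap_tprod (j : Fin m) (D : B →ₗ[ℂ] B) (f : Fin m → B) :
    slotMap m j D (PiTensorProduct.tprod ℂ f)
      = PiTensorProduct.tprod ℂ (Function.update f j (D (f j))) := by
  rw [slotMap, PiTensorProduct.map_tprod]
  congr 1
  ext i
  by_cases h : i = j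
  · subst h; simp
  · simp [h]

/-- The derivation of `B^{⊗ m}` which acts as `D` on the `j`-th factor. -/
def slot (j : Fin m) (D : Derivation ℂ B B) : Derivation ℂ (Pow B m) (Pow B m) :=
  Derivation.mk' (slotMap m j (D : B →ₗ[ℂ] B))
    (by
      intro a b
      induction a using PiTensorProduct.induction_on with
      | smul_tprod c f =>
        induction b using PiTensorProduct.induction_on with
        | smul_tprod d g =>
          have key : slotMap m j (D : B →ₗ[ℂ] B)
                (PiTensorProduct.tprod ℂ f * PiTensorProduct.tprod ℂ g)
              = PiTensorProduct.tprod ℂ f * slotMap m j (D : B →ₗ[ℂ] B)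
                  (PiTensorProduct.tprod ℂ g)
                + PiTensorProduct.tprod ℂ g * slotMap m j (D : B →ₗ[ℂ] B)
                  (PiTensorProduct.tprod ℂ f) := by
            simp only [slotMap_tprod, PiTensorProduct.tprod_mul_tprod]
            have h1 : f * Function.update g j ((D : B →ₗ[ℂ] B) (g j))
                = Function.update (f * g) j (f j * D (g j)) := by
              ext i
              by_cases h : i = j
              · subst h; simp
              · simp [h]
            have h2 : g * Function.update f j ((D : B →ₗ[ℂ] B) (f j))
                = Function.update (f * g) j (g j * D (f j)) := by
              ext i
              by_cases h : i = j
              · subst h; simp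
              · simp [h, mul_comm]
            rw [h1, h2, ← MultilinearMap.map_update_add]
            simp
          simp only [smul_mul_smul_comm, map_smul, key, smul_eq_mul, smul_add]
          rw [mul_comm d c]
        | add b b' hb hb' =>
          simp only [mul_add, map_add, hb, hb', smul_eq_mul, add_mul]
          abel
      | add a a' ha ha' =>
        simp only [add_mul, map_add, ha, ha', smul_eq_mul, mul_add]
        abel)

lemma slot_tprod (j : Fin m) (D : Derivation ℂ B B) (f : Fin m → B) :
    slot m j D (PiTensorProduct.tprod ℂ f)
      = PiTensorProduct.tprod ℂ (Function.update f j (D (f j))) :=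
  slotMap_tprod m j _ f

lemma slotMap_add (j : Fin m) (D D' : B →ₗ[ℂ] B) :
    slotMap m j (D + D') = slotMap m j D + slotMap m j D' := by
  ext f
  simp [slotMap_tprod]

lemma slotMap_smul (j : Fin m) (c : ℂ) (D : B →ₗ[ℂ] B) :
    slotMap m j (c • D) = c • slotMap m j D := by
  ext f
  simp [slotMap_tprod]

/-- `ρ^{(m)}(x_1, …, x_m)` acts on `B^{⊗ m}` by `∑_j (ρ(x_j))_j`. -/
def powAction (ρ : V →ₗ[ℂ] Derivation ℂ B B) :
    (Fin m → V) →ₗ[ℂ] Derivation ℂ (Pow B m) (Pow B m) where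
  toFun x := ∑ j, slot m j (ρ (x j))
  map_add' x y := by
    rw [← Finset.sum_add_distrib]
    refine Finset.sum_congr rfl fun j _ => ?_
    ext f
    exact LinearMap.congr_fun (slotMap_add m j (ρ (x j) : B →ₗ[ℂ] B) (ρ (y j))) f ▸ by
      simp [slot]
  map_smul' c x := by
    rw [Finset.smul_sum]
    refine Finset.sum_congr rfl fun j _ => ?_
    ext f
    have := LinearMap.congr_fun (slotMap_smul m j c (ρ (x j) : B →ₗ[ℂ] B)) f
    simpa [slot] using this

/-- The direct product bracket on `B^{⊗ m}`:
`{⊗ f_i, ⊗ g_i} = ∑_j f_1 g_1 ⊗ ⋯ ⊗ {f_j, g_j} ⊗ ⋯ ⊗ f_m g_m`. -/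
def powBracket (br : B →ₗ[ℂ] B →ₗ[ℂ] B) : Pow B m →ₗ[ℂ] Pow B m →ₗ[ℂ] Pow B m :=
  ∑ j, PiTensorProduct.map₂ (Function.update (fun _ => LinearMap.mul ℂ B) j br)

/-- The linear map `B^{⊗ m} → C`, `⊗ f_i ↦ ∏ φ_i(f_i)`. -/
def prodEval {C : Type*} [CommRing C] [Algebra ℂ C] {m : ℕ} (φ : Fin m → B →ₗ[ℂ] C) :
    Pow B m →ₗ[ℂ] C :=
  PiTensorProduct.lift ((MultilinearMap.mkPiAlgebra ℂ (Fin m) C).compLinearMap φ)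

/-- `S^{⊗ m} → B^{⊗ m}` for a subalgebra `S ⊆ B`. -/
def powIncl (S : Subalgebra ℂ B) : Pow S m →ₐ[ℂ] Pow B m :=
  AlgHom.ofLinearMap (PiTensorProduct.map (fun _ => S.val.toLinearMap))
    (by
      rw [PiTensorProduct.one_def, PiTensorProduct.one_def, PiTensorProduct.map_tprod]
      congr 1)
    (by
      intro a b
      induction a using PiTensorProduct.induction_on with
      | smul_tprod c f =>
        induction b using PiTensorProduct.induction_on with
        | smul_tprod d g =>
          simp only [smul_mul_smul_comm, map_smul, PiTensorProduct.tprod_mul_tprod,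
            PiTensorProduct.map_tprod]
          congr 2
        | add b b' hb hb' => simp only [mul_add, map_add, hb, hb']
      | add a a' ha ha' => simp only [add_mul, map_add, ha, ha'])

/-- `x ⊗ y ↦ (x)_k ⊗ (y)_l`. -/
def comps (k l : Fin m) : V ⊗[ℂ] V →ₗ[ℂ] (Fin m → V) ⊗[ℂ] (Fin m → V) :=
  TensorProduct.map (LinearMap.single ℂ (fun _ => V) k) (LinearMap.single ℂ (fun _ => V) l)

/-- `Mix^m(r) = ∑_{k < l} ∑_i (y_i)_k ∧ (x_i)_l` for `r = ∑_i x_i ⊗ y_i`. -/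
def mix (r : V ⊗[ℂ] V) : (Fin m → V) ⊗[ℂ] (Fin m → V) :=
  ∑ k, ∑ l, if k < l then comps m k l (flip₂ r) - comps m l k r else 0

/-- `r^{(m)} = (r, …, r) - Mix^m(r)`. -/
def polyuble (r : V ⊗[ℂ] V) : (Fin m → V) ⊗[ℂ] (Fin m → V) :=
  ∑ j, comps m j j r - mix m r

/-- The diagonal embedding `V → V^m`. -/
def diagonal : V →ₗ[ℂ] (Fin m → V) := LinearMap.pi (fun _ => LinearMap.id)

end Power

/-! ### The standard `r`-matrix of a complex semisimple Lie algebra -/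

section Standard

variable (L : Type*) [LieRing L] [LieAlgebra ℂ L] [FiniteDimensional ℂ L]
  [LieAlgebra.IsSemisimple ℂ L]

/-- The choices entering the standard `r`-matrix of a semisimple Lie algebra: a Cartan subalgebra
`𝔱`, a system of positive roots (given by a base of the root system), root vectors
`ep α = e_α ∈ 𝔤_α` and `em α = e_{-α} ∈ 𝔤_{-α}` for every positive root `α`, with
`⟨e_α, e_{-α}⟩ = 1` for the Killing form, and an orthonormal basis `h` of `𝔱`. (The values of
`ep` and `em` at negative roots play no role.) -/
structure StandardData where
  cartan : LieSubalgebra ℂ L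
  isCartan : cartan.IsCartanSubalgebra
  base : (LieAlgebra.IsKilling.rootSystem cartan).Base
  ep : cartan.root → L
  em : cartan.root → L
  ep_mem : ∀ α, base.IsPos α → ep α ∈ LieAlgebra.rootSpace cartan (α.1 : cartan → ℂ)
  em_mem : ∀ α, base.IsPos α → em α ∈ LieAlgebra.rootSpace cartan (-(α.1 : cartan → ℂ))
  killing_ep_em : ∀ α, base.IsPos α → killingForm ℂ L (ep α) (em α) = 1
  rank : ℕ
  h : Module.Basis (Fin rank) ℂ cartan
  killing_h : ∀ i j, killingForm ℂ L (h i) (h j) = if i = j then 1 else 0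

attribute [instance] StandardData.isCartan

variable {L}

namespace StandardData

variable (D : StandardData L)

/-- `r_0 = (1/2) ∑ h_i ⊗ h_i ∈ 𝔱 ⊗ 𝔱`. -/
def r₀ : D.cartan ⊗[ℂ] D.cartan := (1 / 2 : ℂ) • ∑ i, D.h i ⊗ₜ[ℂ] D.h i

open Classical in
/-- `r_st = r_0 + ∑_{α > 0} e_{-α} ⊗ e_α ∈ 𝔤 ⊗ 𝔤`. -/
def rSt : L ⊗[ℂ] L :=
  TensorProduct.map D.cartan.subtype D.cartan.subtype D.r₀
    + ∑ α with D.base.IsPos α, D.em α ⊗ₜ[ℂ] D.ep α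

/-- `𝔫 = ∑_{α > 0} 𝔤_α`. -/
def nilradical : Submodule ℂ L :=
  ⨆ α, ⨆ _ : D.base.IsPos α,
    (LieAlgebra.rootSpace D.cartan (α.1 : D.cartan → ℂ)).toSubmodule

/-- `r̃_st = (r_st, 0) - (0, r_0)` in the tensor square of `𝔤̃ = 𝔤 ⊕ 𝔱`. -/
def rTilde : (L × D.cartan) ⊗[ℂ] (L × D.cartan) :=
  TensorProduct.map (LinearMap.inl ℂ L D.cartan) (LinearMap.inl ℂ L D.cartan) D.rSt
    - TensorProduct.map (LinearMap.inr ℂ L D.cartan) (LinearMap.inr ℂ L D.cartan) D.r₀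

end StandardData

end Standard

/-! ### Affine algebraic groups through their coordinate Hopf algebras -/

section Group

variable (A : Type*) [CommRing A] [HopfAlgebra ℂ A]

/-- The group `G` of complex points of the affine algebraic group with coordinate ring
`A = ℂ[G]`, with the multiplication induced by the comultiplication of `A`. The value of
`f ∈ A` at `g ∈ G` is `g f`. -/
abbrev Pt : Type _ := WithConv (A →ₐ[ℂ] ℂ)

/-- The Lie algebra `𝔤` of `G`: the left invariant derivations `x^L` of `ℂ[G]`. -/
def lieAlg : LieSubalgebra ℂ (Derivation ℂ A A) where
  carrier := {D | Coalgebra.comul ∘ₗ (D : A →ₗ[ℂ] A)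
    = (D : A →ₗ[ℂ] A).lTensor A ∘ₗ Coalgebra.comul}
  add_mem' := by
    intro D D' h h'
    simp only [Set.mem_ofPred_eq] at h h' ⊢
    rw [Derivation.coe_add_linearMap, LinearMap.comp_add, h, h', LinearMap.lTensor_add,
      LinearMap.add_comp]
  zero_mem' := by
    simp
  smul_mem' := by
    intro c D h
    simp only [Set.mem_ofPred_eq] at h ⊢
    rw [Derivation.coe_smul_linearMap, LinearMap.comp_smul, h, LinearMap.lTensor_smul,
      LinearMap.smul_comp]
  lie_mem' := by
    intro D D' h h'
    simp only [Set.mem_ofPred_eq] at h h' ⊢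
    have e : ((⁅D, D'⁆ : Derivation ℂ A A) : A →ₗ[ℂ] A)
        = (D : A →ₗ[ℂ] A) ∘ₗ (D' : A →ₗ[ℂ] A) - (D' : A →ₗ[ℂ] A) ∘ₗ (D : A →ₗ[ℂ] A) := by
      ext f; exact Derivation.commutator_apply f
    rw [e, LinearMap.comp_sub, ← LinearMap.comp_assoc, ← LinearMap.comp_assoc, h, h',
      LinearMap.comp_assoc, LinearMap.comp_assoc, h, h', LinearMap.lTensor_sub,
      LinearMap.lTensor_comp, LinearMap.lTensor_comp, LinearMap.sub_comp]
    rfl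

variable {A}

/-- The tangent vector at the identity: `f ↦ (x^L f)(e)`. -/
def tangent (x : lieAlg A) : A →ₗ[ℂ] ℂ := Coalgebra.counit ∘ₗ (x.1 : A →ₗ[ℂ] A)

lemma tangent_apply (x : lieAlg A) (f : A) : tangent x f = Coalgebra.counit (x.1 f) := rfl

lemma tangent_mul (x : lieAlg A) (f g : A) :
    tangent x (f * g) = Coalgebra.counit f * tangent x g + Coalgebra.counit g * tangent x f := by
  simp [tangent]

lemma eq_of_tangent (x : lieAlg A) (f : A) :
    x.1 f = TensorProduct.rid ℂ A ((tangent x).lTensor A (Coalgebra.comul f)) := by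
  have h := LinearMap.congr_fun x.2 f
  have h' := congrArg (fun t => TensorProduct.rid ℂ A
    ((Coalgebra.counit (R := ℂ) (A := A)).lTensor A t)) h
  simp only [LinearMap.comp_apply, Coalgebra.lTensor_counit_comul] at h'
  rw [tangent, LinearMap.lTensor_comp, LinearMap.comp_apply]
  simpa using h'

instance [Algebra.FiniteType ℂ A] : FiniteDimensional ℂ (lieAlg A) := by
  obtain ⟨s, hs⟩ := (inferInstance : Algebra.FiniteType ℂ A).out
  let θ : lieAlg A →ₗ[ℂ] (s → ℂ) :=
    { toFun := fun x a => tangent x a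
      map_add' := fun x y => by ext a; simp [tangent]
      map_smul' := fun c x => by ext a; simp [tangent] }
  refine FiniteDimensional.of_injective θ ((injective_iff_map_eq_zero θ).2 fun x hx => ?_)
  have h0 : ∀ f : A, tangent x f = 0 := by
    intro f
    have hf : f ∈ Algebra.adjoin ℂ (s : Set A) := hs ▸ Algebra.mem_top
    induction hf using Algebra.adjoin_induction with
    | mem a ha => exact congrFun hx ⟨a, ha⟩
    | algebraMap r => simp [tangent]
    | add a b _ _ ha hb => rw [map_add, ha, hb, add_zero]
    | mul a b _ _ ha hb => rw [tangent_mul, ha, hb, mul_zero, mul_zero, add_zero]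
  have h1 : tangent x = 0 := LinearMap.ext h0
  ext f
  rw [eq_of_tangent, h1]
  simp

variable (A)

/-- `x ↦ x^L`. -/
def leftField : lieAlg A →ₗ[ℂ] Derivation ℂ A A := (lieAlg A).toSubmodule.subtype

variable {A}

/-- `(x_e ⊗ id) ∘ Δ`, i.e. `f ↦ (g ↦ x_e (h ↦ f(h g)))`. -/
def rightMap (x : lieAlg A) : A →ₗ[ℂ] A :=
  TensorProduct.lid ℂ A ∘ₗ (tangent x).rTensor A ∘ₗ Coalgebra.comul

lemma rightMap_mul (x : lieAlg A) (f g : A) :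
    rightMap x (f * g) = f * rightMap x g + g * rightMap x f := by
  have key : ∀ u v : A ⊗[ℂ] A,
      TensorProduct.lid ℂ A ((tangent x).rTensor A (u * v))
        = TensorProduct.lid ℂ A ((Coalgebra.counit (R := ℂ) (A := A)).rTensor A u)
            * TensorProduct.lid ℂ A ((tangent x).rTensor A v)
          + TensorProduct.lid ℂ A ((Coalgebra.counit (R := ℂ) (A := A)).rTensor A v)
            * TensorProduct.lid ℂ A ((tangent x).rTensor A u) := by
    intro u v
    induction u with
    | zero => simp
    | add u u' hu hu' => simp only [add_mul, mul_add, map_add, hu, hu']; abel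
    | tmul a b =>
      induction v with
      | zero => simp
      | add v v' hv hv' => simp only [add_mul, mul_add, map_add, hv, hv']; abel
      | tmul c d =>
        simp only [Algebra.TensorProduct.tmul_mul_tmul, LinearMap.rTensor_tmul,
          TensorProduct.lid_tmul, tangent_mul, add_smul, smul_mul_smul_comm]
        rw [mul_comm d b]
  simp only [rightMap, LinearMap.comp_apply, Bialgebra.comul_mul, LinearEquiv.coe_coe]
  rw [key]
  simp

variable (A)

/-- `x ↦ x^R`, the right invariant vector field with value `x` at the identity. -/
def rightField : lieAlg A →ₗ[ℂ] Derivation ℂ A A where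
  toFun x := Derivation.mk' (rightMap x) (fun f g => by simp [rightMap_mul])
  map_add' x y := by
    ext f
    simp [rightMap, tangent, LinearMap.rTensor_add, LinearMap.comp_add]
  map_smul' c x := by
    ext f
    simp [rightMap, tangent, LinearMap.rTensor_smul, LinearMap.comp_smul]

variable {A}

/-- `f ↦ f(p ·)`. -/
def leftTrans (p : Pt A) : A →ₐ[ℂ] A :=
  (Algebra.TensorProduct.lid ℂ A).toAlgHom.comp
    ((Algebra.TensorProduct.map p.ofConv (AlgHom.id ℂ A)).comp (Bialgebra.comulAlgHom ℂ A))

/-- `f ↦ f(· g)`. -/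
def rightTrans (g : Pt A) : A →ₐ[ℂ] A :=
  (Algebra.TensorProduct.rid ℂ ℂ A).toAlgHom.comp
    ((Algebra.TensorProduct.map (AlgHom.id ℂ A) g.ofConv).comp (Bialgebra.comulAlgHom ℂ A))

lemma pt_mul_apply (p g : Pt A) (f : A) :
    (p * g).ofConv f = Algebra.TensorProduct.lift p.ofConv g.ofConv (fun _ _ => .all ..)
      (Coalgebra.comul f) :=
  AlgHom.convMul_apply p g f

lemma apply_leftTrans (p g : Pt A) (f : A) : g.ofConv (leftTrans p f) = (p * g).ofConv f := by
  rw [pt_mul_apply]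
  simp only [leftTrans, AlgHom.comp_apply, Bialgebra.comulAlgHom_apply]
  generalize (Coalgebra.comul f : A ⊗[ℂ] A) = u
  induction u with
  | zero => simp
  | add u v hu hv => simp only [map_add, hu, hv]
  | tmul a b => simp

lemma apply_rightTrans (p g : Pt A) (f : A) : p.ofConv (rightTrans g f) = (p * g).ofConv f := by
  rw [pt_mul_apply]
  simp only [rightTrans, AlgHom.comp_apply, Bialgebra.comulAlgHom_apply]
  generalize (Coalgebra.comul f : A ⊗[ℂ] A) = u
  induction u with
  | zero => simp
  | add u v hu hv => simp only [map_add, hu, hv]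
  | tmul a b => simp [mul_comm]

/-- `g = exp x`: `f(g) = ∑_k ((x^L)^k f)(e) / k!` for all `f ∈ ℂ[G]`. -/
def IsExp (x : lieAlg A) (g : Pt A) : Prop :=
  ∀ f : A, HasSum
    (fun k : ℕ => ((k.factorial : ℂ))⁻¹ * Coalgebra.counit (((x.1 : A →ₗ[ℂ] A) ^ k) f))
    (g.ofConv f)

/-- The connected subgroup of `G` with Lie algebra `𝔫 ⊆ 𝔤`, generated by `exp 𝔫`. -/
def integralSubgroup (𝔫 : Submodule ℂ (lieAlg A)) : Subgroup (Pt A) :=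
  Subgroup.closure {g | ∃ x ∈ 𝔫, IsExp x g}

/-- `ℂ[N\G] = {f ∈ ℂ[G] : f(n g) = f(g), n ∈ N, g ∈ G}`. -/
def quotientRing (N : Subgroup (Pt A)) : Subalgebra ℂ A where
  carrier := {f | ∀ n ∈ N, ∀ g : Pt A, (n * g).ofConv f = g.ofConv f}
  mul_mem' := by
    intro a b ha hb n hn g
    rw [map_mul, map_mul, ha n hn g, hb n hn g]
  add_mem' := by
    intro a b ha hb n hn g
    rw [map_add, map_add, ha n hn g, hb n hn g]
  algebraMap_mem' := by
    intro c n _ g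
    rw [AlgHom.commutes, AlgHom.commutes]

/-- Right translation `f ↦ f(· g)` on `ℂ[N\G]`. -/
def quotientRightTrans (N : Subgroup (Pt A)) (g : Pt A) :
    quotientRing N →ₐ[ℂ] quotientRing N :=
  ((rightTrans g).comp (quotientRing N).val).codRestrict (quotientRing N) (by
    intro f n hn h
    simp only [AlgHom.comp_apply, apply_rightTrans, mul_assoc]
    exact f.2 n hn (h * g))

/-- The value of `F ∈ ℂ[N\G]^{⊗ m}` at the point `(N.p_1, …, N.p_m)` of `(N\G)^m`. -/
def quotientEval (N : Subgroup (Pt A)) {m : ℕ} (p : Fin m → Pt A) :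
    Pow (quotientRing N) m →ₗ[ℂ] ℂ :=
  prodEval fun i => (p i).ofConv.toLinearMap ∘ₗ (quotientRing N).val.toLinearMap

/-- For `F ∈ ℂ[N\G]^{⊗ m}`, the function `F(· g)` on `(N\G)^m`, where `g ∈ G` acts diagonally. -/
def quotientDiagTrans (N : Subgroup (Pt A)) (m : ℕ) (g : Pt A) :
    Pow (quotientRing N) m →ₗ[ℂ] Pow (quotientRing N) m :=
  PiTensorProduct.map fun _ => (quotientRightTrans N g).toLinearMap

/-- For `F ∈ ℂ[N\G]^{⊗ m}` and `p = (N.p_1, …, N.p_m)`, the function `g ↦ F(p · g)` on `G`. -/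
def quotientOrbit (N : Subgroup (Pt A)) {m : ℕ} (p : Fin m → Pt A) :
    Pow (quotientRing N) m →ₗ[ℂ] A :=
  prodEval fun i => (leftTrans (p i)).toLinearMap ∘ₗ (quotientRing N).val.toLinearMap

/-- The Poisson bracket of `(r^{(m)})^L - (r^{(m)})^R = (Λ^{(m)})^L - (Λ^{(m)})^R` on
`ℂ[G^m] = ℂ[G]^{⊗ m}`, where `Λ^{(m)}` is the antisymmetric part of `r^{(m)}`. -/
def polyubleBracket (m : ℕ) (r : lieAlg A ⊗[ℂ] lieAlg A) : Pow A m →ₗ[ℂ] Pow A m →ₗ[ℂ] Pow A m :=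
  act₂ (powAction m (leftField A)) (skewPart (polyuble m r))
    - act₂ (powAction m (rightField A)) (skewPart (polyuble m r))

/-- The Poisson bracket of `Λ^L - Λ^R` on `ℂ[G]`, where `Λ` is the antisymmetric part of `r`. -/
def groupBracket (r : lieAlg A ⊗[ℂ] lieAlg A) : A →ₗ[ℂ] A →ₗ[ℂ] A :=
  act₂ (leftField A) (skewPart r) - act₂ (rightField A) (skewPart r)

/-- `{ , }` is a Poisson bracket on `ℂ[G]` for which the multiplication `G × G → G` is a Poisson
map, i.e. `G` is a Poisson Lie group. -/
structure IsPoissonLieGroup (br : A →ₗ[ℂ] A →ₗ[ℂ] A) : Prop where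
  poisson : IsPoissonBracket br
  multiplicative : ∀ (p g : Pt A) (f h : A),
    (p * g).ofConv (br f h)
      = p.ofConv (br (rightTrans g f) (rightTrans g h))
        + g.ofConv (br (leftTrans p f) (leftTrans p h))

/-- The diagonal right action of the Poisson Lie group `(G, brG)` on `(N\G)^m`, with Poisson
bracket `br` on `ℂ[N\G]^{⊗ m}`, is a Poisson action: the action map `(N\G)^m × G → (N\G)^m` is
Poisson for the product Poisson structure on the source. -/
structure IsDiagonalPoissonAction (N : Subgroup (Pt A)) (m : ℕ) (brG : A →ₗ[ℂ] A →ₗ[ℂ] A)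
    (br : Pow (quotientRing N) m →ₗ[ℂ] Pow (quotientRing N) m →ₗ[ℂ] Pow (quotientRing N) m) :
    Prop where
  group : IsPoissonLieGroup brG
  poisson : IsPoissonBracket br
  action : ∀ (p : Fin m → Pt A) (g : Pt A) (F H : Pow (quotientRing N) m),
    quotientEval N (fun i => p i * g) (br F H)
      = quotientEval N p (br (quotientDiagTrans N m g F) (quotientDiagTrans N m g H))
        + g.ofConv (brG (quotientOrbit N p F) (quotientOrbit N p H))

variable [Algebra.FiniteType ℂ A] [LieAlgebra.IsSemisimple ℂ (lieAlg A)]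

namespace StandardData

/-- The subgroup `N` with Lie algebra `𝔫`: the unipotent radical of the Borel subgroup `B` with
Lie algebra `𝔱 + 𝔫`. -/
def N (D : StandardData (lieAlg A)) : Subgroup (Pt A) := integralSubgroup D.nilradical

/-- `ρ(y, x) = y^L - x^R` for `y ∈ 𝔤` and `x ∈ 𝔱`, as a derivation of `ℂ[G]`. -/
def rho (D : StandardData (lieAlg A)) : (lieAlg A × D.cartan) →ₗ[ℂ] Derivation ℂ A A :=
  leftField A ∘ₗ LinearMap.fst ℂ _ _
    - rightField A ∘ₗ (D.cartan.toSubmodule.subtype : D.cartan →ₗ[ℂ] lieAlg A)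
      ∘ₗ LinearMap.snd ℂ _ _

/-- The bracket of `(π^{(1)})^m - ρ^{(m)}(Mix^m(r̃_st))` on `ℂ[N\G]^{⊗ m}`. The hypotheses say
that the bracket of `π_st^{(1)}` and the vector fields `ρ(z)` descend to `N\G`. -/
def mixedBracket (D : StandardData (lieAlg A)) (m : ℕ)
    (hbr : ∀ f ∈ quotientRing D.N, ∀ g ∈ quotientRing D.N,
      groupBracket D.rSt f g ∈ quotientRing D.N)
    (hρ : ∀ z, ∀ f ∈ quotientRing D.N, D.rho z f ∈ quotientRing D.N) :
    Pow (quotientRing D.N) m →ₗ[ℂ] Pow (quotientRing D.N) m →ₗ[ℂ] Pow (quotientRing D.N) m :=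
  powBracket m (restrictBracket (quotientRing D.N) (groupBracket D.rSt) hbr)
    - act₂ (powAction m (restrictAction (quotientRing D.N) D.rho hρ)) (mix m D.rTilde)

/-- `φ(y) = (y^L, …, y^L)`, as a derivation of `ℂ[N\G]^{⊗ m}`. -/
def diagonalField (D : StandardData (lieAlg A)) (m : ℕ)
    (hρ : ∀ z, ∀ f ∈ quotientRing D.N, D.rho z f ∈ quotientRing D.N) :
    lieAlg A →ₗ[ℂ] Derivation ℂ (Pow (quotientRing D.N) m) (Pow (quotientRing D.N) m) :=
  powAction m (restrictAction (quotientRing D.N) D.rho hρ) ∘ₗ diagonal m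
    ∘ₗ LinearMap.inl ℂ (lieAlg A) D.cartan

end StandardData

end Group

end PolyPoisson

end

open scoped TensorProduct

noncomputable section

namespace PolyPoisson

set_option linter.unusedSectionVars false

/-! ### The classical Yang-Baxter tensor -/

section YangBaxter

variable {L : Type*} [LieRing L] [LieAlgebra ℂ L]

/-! The proof works with `r = r_st` itself rather than with its antisymmetric part. Put Ω = r + r₂₁.
Through the Killing form, r₂₁ becomes the operator R equal to 0 on 𝔫, 1/2 on 𝔱 and 1 on 𝔫₋, and r
becomes 1 - R. Hence Ω corresponds to the identity: it is the Casimir element, fixed by every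
automorphism of 𝔤. The classical Yang-Baxter equation (CYBE) for r becomes [Ry, Rz] = R([Ry, z] +
[y, Rz] - [y, z]), which is checked on the eigenspaces of R (`modified_of_triangular`,
`cybTensor_rSt`).

The (k, l) component of r^{(m)} is r for k ≥ l and -r₂₁ = r - Ω for k < l. Invariance of Ω therefore
carries the CYBE from r to r^{(m)}, one triple of factors at a time (`cybTensor_polyuble`). The
symmetric part of r^{(m)} is half of (Ω, …, Ω), and Ω^L = Ω^R by Ad-invariance, so the polyuble
bracket is also that of (r^{(m)})^L - (r^{(m)})^R. Skew-symmetry is visible in the first form; the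
Jacobi identity follows from the CYBE in the second (`isPoissonBracket_of_cybTensor`).

Every x in 𝔤 has an exponential in G, because ℂ[G] is locally finite under x^L. Hence invariance
under N means x^R f = 0 for all x in 𝔫 (`mem_quotientRing_integralSubgroup`), and likewise in each
variable on G^m (`mem_range_powIncl_iff`). On such functions every right invariant term containing
some e_α, α > 0, vanishes. Within one factor this kills Λ^R, so the bracket preserves ℂ[N\G].
Between different factors it leaves exactly the right invariant part of Mix(r₀), which ρ and the
summand -(0, r₀) of r̃_st record. So the polyuble bracket restricts to the mixed one
(`polyubleBracket_powIncl`), which is Poisson because the inclusion is injective.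

For the action, r^{(m)} differs from the diagonal image Δ(r) only by components of Ω. Acting along
the diagonal by ad or Ad therefore changes r^{(m)} only through Δ(r). This gives both the
infinitesimal identity (`isPoissonAction_diagonalField`) and its global form
(`powEval_polyubleBracket`). -/

/-- The bracket as a linear map `L ⊗ L → L`. -/
def brTensor : L ⊗[ℂ] L →ₗ[ℂ] L := TensorProduct.lift (LieModule.toEnd ℂ L L : L →ₗ[ℂ] _)

/-- `[u₁₂, v₁₃]`, i.e. `(a ⊗ b, a' ⊗ b') ↦ [a, a'] ⊗ b ⊗ b'`. -/
def comm₁ : L ⊗[ℂ] L →ₗ[ℂ] L ⊗[ℂ] L →ₗ[ℂ] L ⊗[ℂ] (L ⊗[ℂ] L) :=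
  TensorProduct.curry (TensorProduct.map brTensor LinearMap.id
    ∘ₗ (TensorProduct.tensorTensorTensorComm ℂ L L L L).toLinearMap)

/-- `[u₁₂, v₂₃]`, i.e. `(a ⊗ b, a' ⊗ b') ↦ a ⊗ [b, a'] ⊗ b'`. -/
def comm₂ : L ⊗[ℂ] L →ₗ[ℂ] L ⊗[ℂ] L →ₗ[ℂ] L ⊗[ℂ] (L ⊗[ℂ] L) :=
  TensorProduct.curry (TensorProduct.map LinearMap.id (TensorProduct.map brTensor LinearMap.id
      ∘ₗ (TensorProduct.assoc ℂ L L L).symm.toLinearMap)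
    ∘ₗ (TensorProduct.assoc ℂ L L (L ⊗[ℂ] L)).toLinearMap)

/-- `[u₁₃, v₂₃]`, i.e. `(a ⊗ b, a' ⊗ b') ↦ a ⊗ a' ⊗ [b, b']`. -/
def comm₃ : L ⊗[ℂ] L →ₗ[ℂ] L ⊗[ℂ] L →ₗ[ℂ] L ⊗[ℂ] (L ⊗[ℂ] L) :=
  TensorProduct.curry ((TensorProduct.assoc ℂ L L L).toLinearMap
    ∘ₗ TensorProduct.map LinearMap.id brTensor
    ∘ₗ (TensorProduct.tensorTensorTensorComm ℂ L L L L).toLinearMap)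

@[simp] lemma comm₁_tmul (a b a' b' : L) :
    comm₁ (a ⊗ₜ[ℂ] b) (a' ⊗ₜ[ℂ] b') = ⁅a, a'⁆ ⊗ₜ (b ⊗ₜ b') := rfl

@[simp] lemma comm₂_tmul (a b a' b' : L) :
    comm₂ (a ⊗ₜ[ℂ] b) (a' ⊗ₜ[ℂ] b') = a ⊗ₜ (⁅b, a'⁆ ⊗ₜ b') := rfl

@[simp] lemma comm₃_tmul (a b a' b' : L) :
    comm₃ (a ⊗ₜ[ℂ] b) (a' ⊗ₜ[ℂ] b') = a ⊗ₜ (a' ⊗ₜ ⁅b, b'⁆) := rfl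

/-- `[u₁₂, v₁₃] + [u₁₂, w₂₃] + [v₁₃, w₂₃]`. -/
def cybTensor (u v w : L ⊗[ℂ] L) : L ⊗[ℂ] (L ⊗[ℂ] L) := comm₁ u v + comm₂ u w + comm₃ v w

@[simp] lemma flip₂_tmul {V : Type*} [AddCommGroup V] [Module ℂ V] (a b : V) :
    flip₂ (a ⊗ₜ[ℂ] b) = b ⊗ₜ a := rfl

@[simp] lemma flip₂_add {V : Type*} [AddCommGroup V] [Module ℂ V] (u v : V ⊗[ℂ] V) :
    flip₂ (u + v) = flip₂ u + flip₂ v := map_add _ _ _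

@[simp] lemma flip₂_zero {V : Type*} [AddCommGroup V] [Module ℂ V] :
    flip₂ (0 : V ⊗[ℂ] V) = 0 := map_zero _

@[simp] lemma flip₂_flip₂ {V : Type*} [AddCommGroup V] [Module ℂ V] (u : V ⊗[ℂ] V) :
    flip₂ (flip₂ u) = u := by
  induction u with
  | zero => simp
  | add u v hu hv => simp [hu, hv]
  | tmul a b => rfl

/-- For v = a ⊗ b the sum is -(a·Ω) ⊗ b, with a acting on both legs of Ω. In leg notation, Ω₁₂
commutes with v₁₃ + v₂₃. -/
lemma comm₁_add_comm₂_of_invariant {Ω : L ⊗[ℂ] L} (hΩ : ∀ x : L, ⁅x, Ω⁆ = 0) (v : L ⊗[ℂ] L) :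
    comm₁ Ω v + comm₂ Ω v = 0 := by
  induction v with
  | zero => simp
  | add u v hu hv =>
    rw [map_add, map_add, add_add_add_comm, hu, hv, add_zero]
  | tmul a b =>
    have key : ∀ w : L ⊗[ℂ] L, comm₁ w (a ⊗ₜ[ℂ] b) + comm₂ w (a ⊗ₜ[ℂ] b)
        = -(TensorProduct.assoc ℂ L L L (⁅a, w⁆ ⊗ₜ[ℂ] b)) := by
      intro w
      induction w with
      | zero => simp
      | add u v hu hv =>
        simp only [map_add, lie_add, TensorProduct.add_tmul, LinearMap.add_apply, neg_add]
        rw [← hu, ← hv]; abel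
      | tmul c d =>
        simp only [comm₁_tmul, comm₂_tmul, TensorProduct.LieModule.lie_tmul_right,
          TensorProduct.add_tmul, map_add, TensorProduct.assoc_tmul]
        rw [← lie_skew c a, ← lie_skew d a]
        simp only [TensorProduct.neg_tmul, TensorProduct.tmul_neg, neg_add]
    rw [key, hΩ]; simp

/-- For v = a ⊗ b the sum is a ⊗ (b·Ω): Ω₂₃ commutes with v₁₂ + v₁₃. -/
lemma comm₂_add_comm₃_of_invariant {Ω : L ⊗[ℂ] L} (hΩ : ∀ x : L, ⁅x, Ω⁆ = 0) (v : L ⊗[ℂ] L) :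
    comm₂ v Ω + comm₃ v Ω = 0 := by
  induction v with
  | zero => simp
  | add u v hu hv =>
    rw [map_add, map_add, LinearMap.add_apply, LinearMap.add_apply, add_add_add_comm, hu, hv,
      add_zero]
  | tmul a b =>
    have key : ∀ w : L ⊗[ℂ] L, comm₂ (a ⊗ₜ[ℂ] b) w + comm₃ (a ⊗ₜ[ℂ] b) w = a ⊗ₜ[ℂ] ⁅b, w⁆ := by
      intro w
      induction w with
      | zero => simp
      | add u v hu hv =>
        simp only [map_add, lie_add, TensorProduct.tmul_add]
        rw [← hu, ← hv]; abel
      | tmul c d =>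
        simp only [comm₂_tmul, comm₃_tmul, TensorProduct.LieModule.lie_tmul_right,
          TensorProduct.tmul_add]
    rw [key, hΩ]; simp

/-- For v = a ⊗ b the difference of the two sides is a·Ω with b inserted as the middle leg. In leg
notation, Ω₁₃ commutes with v₁₂ + v₃₂. -/
lemma comm₁_eq_comm₃_of_invariant {Ω : L ⊗[ℂ] L} (hΩ : ∀ x : L, ⁅x, Ω⁆ = 0) (v : L ⊗[ℂ] L) :
    comm₁ v Ω = comm₃ Ω (flip₂ v) := by
  induction v with
  | zero => simp
  | add u v hu hv => simp only [map_add, LinearMap.add_apply, hu, hv, flip₂_add]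
  | tmul a b =>
    have key : ∀ w : L ⊗[ℂ] L, comm₁ (a ⊗ₜ[ℂ] b) w - comm₃ w (flip₂ (a ⊗ₜ[ℂ] b))
        = TensorProduct.leftComm ℂ L L L (b ⊗ₜ[ℂ] ⁅a, w⁆) := by
      intro w
      induction w with
      | zero => simp
      | add u v hu hv =>
        simp only [map_add, lie_add, TensorProduct.tmul_add, LinearMap.add_apply]
        rw [← hu, ← hv]; abel
      | tmul c d =>
        simp only [comm₁_tmul, comm₃_tmul, flip₂_tmul, TensorProduct.LieModule.lie_tmul_right,
          TensorProduct.tmul_add, map_add, TensorProduct.leftComm_tmul]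
        rw [← lie_skew d a]
        simp only [TensorProduct.tmul_neg, sub_neg_eq_add]
    rw [← sub_eq_zero, key, hΩ]; simp

/-- The component of `r^{(m)}` in the factors `k` and `l`. -/
def polyComp {ι : Type*} [LinearOrder ι] (r : L ⊗[ℂ] L) (k l : ι) : L ⊗[ℂ] L :=
  if k < l then -flip₂ r else r

/-- Since -r₂₁ = r - Ω, each entry is r or r - Ω, and the terms in Ω cancel by the three commutation
rules above. -/
lemma cybTensor_polyComp {ι : Type*} [LinearOrder ι] {r : L ⊗[ℂ] L}
    (hr : cybTensor r r r = 0) (hΩ : ∀ x : L, ⁅x, r + flip₂ r⁆ = 0) (a b c : ι) :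
    cybTensor (polyComp r a b) (polyComp r a c) (polyComp r b c) = 0 := by
  have h1 := comm₁_add_comm₂_of_invariant hΩ r
  have h1' := comm₁_add_comm₂_of_invariant hΩ (flip₂ r)
  have h2 := comm₂_add_comm₃_of_invariant hΩ r
  have h2' := comm₂_add_comm₃_of_invariant hΩ (flip₂ r)
  have h3 := comm₁_eq_comm₃_of_invariant hΩ r
  have h3' := comm₁_eq_comm₃_of_invariant hΩ (flip₂ r)
  rw [flip₂_flip₂] at h3'
  simp only [map_add, LinearMap.add_apply] at h1 h1' h2 h2' h3 h3'
  unfold cybTensor at hr ⊢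
  unfold polyComp
  -- Six sign patterns survive; the other two contradict transitivity. Equal indices count as ≥ and
  -- give r.
  rcases lt_or_ge a b with hab | hab <;> rcases lt_or_ge b c with hbc | hbc <;>
    rcases lt_or_ge a c with hac | hac
  all_goals first
    | exact absurd (hab.trans hbc) hac.not_gt
    | exact absurd (hbc.trans hab) hac.not_ge
    | simp only [hab, hbc, hac, hab.not_gt, hbc.not_gt, hac.not_gt, if_true, if_false, map_neg,
        LinearMap.neg_apply, neg_neg]
  · linear_combination (norm := module) hr - h1 + h3' + h2'
  · linear_combination (norm := module) hr - h1 + h3'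
  · linear_combination (norm := module) hr - h1
  · linear_combination (norm := module) hr - h2 - h3
  · linear_combination (norm := module) hr - h2
  · exact hr

/-- The componentwise Lie bracket on `L^ι`. -/
instance piLieRing (ι : Type*) : LieRing (ι → L) where
  bracket x y i := ⁅x i, y i⁆
  add_lie x y z := funext fun i => add_lie (x i) (y i) (z i)
  lie_add x y z := funext fun i => lie_add (x i) (y i) (z i)
  lie_self x := funext fun i => lie_self (x i)
  leibniz_lie x y z := funext fun i => leibniz_lie (x i) (y i) (z i)

instance piLieAlgebra (ι : Type*) : LieAlgebra ℂ (ι → L) where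
  lie_smul c x y := funext fun i => lie_smul c (x i) (y i)

lemma pi_lie_apply {ι : Type*} (x y : ι → L) (i : ι) : ⁅x, y⁆ i = ⁅x i, y i⁆ := rfl

/-- `x ⊗ y ⊗ z ↦ (x)_a ⊗ (y)_b ⊗ (z)_c`. -/
def comps₃ {m : ℕ} (a b c : Fin m) : L ⊗[ℂ] (L ⊗[ℂ] L) →ₗ[ℂ]
    (Fin m → L) ⊗[ℂ] ((Fin m → L) ⊗[ℂ] (Fin m → L)) :=
  TensorProduct.map (LinearMap.single ℂ (fun _ => L) a)
    (TensorProduct.map (LinearMap.single ℂ (fun _ => L) b) (LinearMap.single ℂ (fun _ => L) c))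

lemma lie_single {m : ℕ} (a b : Fin m) (x y : L) :
    ⁅(Pi.single a x : Fin m → L), (Pi.single b y : Fin m → L)⁆
      = if a = b then (Pi.single a ⁅x, y⁆ : Fin m → L) else 0 := by
  ext i
  rw [pi_lie_apply]
  by_cases h : a = b
  · subst h
    by_cases hi : i = a
    · subst hi; simp
    · simp [hi]
  · by_cases hi : i = a
    · subst hi; simp [h]
    · simp [hi, h]

section

variable {m : ℕ} (a b c d : Fin m) (u v : L ⊗[ℂ] L)

/-- The two bracketed legs must lie in the same factor, since distinct factors of L^m commute. -/
lemma comm₁_comps : comm₁ (comps m a b u) (comps m c d v)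
    = if a = c then comps₃ a b d (comm₁ u v) else 0 := by
  induction u with
  | zero => simp
  | add u u' hu hu' => simp only [map_add, LinearMap.add_apply, hu, hu']; split_ifs <;> simp
  | tmul x y =>
    induction v with
    | zero => simp
    | add v v' hv hv' => simp only [map_add, hv, hv']; split_ifs <;> simp
    | tmul z w =>
      simp only [comps, comps₃, TensorProduct.map_tmul, comm₁_tmul, LinearMap.single_apply,
        lie_single]
      split_ifs <;> simp

lemma comm₂_comps : comm₂ (comps m a b u) (comps m c d v)
    = if b = c then comps₃ a b d (comm₂ u v) else 0 := by
  induction u with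
  | zero => simp
  | add u u' hu hu' => simp only [map_add, LinearMap.add_apply, hu, hu']; split_ifs <;> simp
  | tmul x y =>
    induction v with
    | zero => simp
    | add v v' hv hv' => simp only [map_add, hv, hv']; split_ifs <;> simp
    | tmul z w =>
      simp only [comps, comps₃, TensorProduct.map_tmul, comm₂_tmul, LinearMap.single_apply,
        lie_single]
      split_ifs <;> simp

lemma comm₃_comps : comm₃ (comps m a b u) (comps m c d v)
    = if b = d then comps₃ a c b (comm₃ u v) else 0 := by
  induction u with
  | zero => simp
  | add u u' hu hu' => simp only [map_add, LinearMap.add_apply, hu, hu']; split_ifs <;> simp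
  | tmul x y =>
    induction v with
    | zero => simp
    | add v v' hv hv' => simp only [map_add, hv, hv']; split_ifs <;> simp
    | tmul z w =>
      simp only [comps, comps₃, TensorProduct.map_tmul, comm₃_tmul, LinearMap.single_apply,
        lie_single]
      split_ifs <;> simp

end

/-- Each wedge in `mix` contributes at (k, l) and at (l, k). Swapping the summation indices in the
second half leaves one component per ordered pair. -/
lemma polyuble_eq_sum (m : ℕ) (r : L ⊗[ℂ] L) :
    polyuble m r = ∑ k, ∑ l, comps m k l (polyComp r k l) := by
  have h : ∀ k l : Fin m, comps m k l (polyComp r k l)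
      = (if k = l then comps m k l r else 0) - ((if k < l then comps m k l (flip₂ r) else 0)
        - if l < k then comps m k l r else 0) := by
    intro k l
    unfold polyComp
    rcases lt_trichotomy k l with h | h | h
    · simp [h, h.ne, h.not_gt]
    · simp [h]
    · simp [h, h.ne', h.not_gt]
  have h' : mix m r = ∑ k, ∑ l, ((if k < l then comps m k l (flip₂ r) else 0)
        - if l < k then comps m k l r else 0) := by
    simp only [mix, Finset.sum_sub_distrib]
    rw [Finset.sum_comm (f := fun k l : Fin m => if l < k then comps m k l r else 0)]
    simp only [← Finset.sum_sub_distrib]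
    refine Finset.sum_congr rfl fun k _ => Finset.sum_congr rfl fun l _ => ?_
    split_ifs <;> simp
  simp only [h, Finset.sum_sub_distrib]
  rw [polyuble, h']
  simp [Finset.sum_sub_distrib]

/-- A bracket forces its two factors to agree, so each quadruple sum collapses to triples, and the
equation in L^m can be tested one triple at a time. -/
lemma cybTensor_sum_comps {m : ℕ} (T : Fin m → Fin m → L ⊗[ℂ] L) :
    cybTensor (∑ k, ∑ l, comps m k l (T k l)) (∑ k, ∑ l, comps m k l (T k l))
        (∑ k, ∑ l, comps m k l (T k l))
      = ∑ a, ∑ b, ∑ c, comps₃ a b c (cybTensor (T a b) (T a c) (T b c)) := by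
  have h₁ : comm₁ (∑ k, ∑ l, comps m k l (T k l)) (∑ k, ∑ l, comps m k l (T k l))
      = ∑ a, ∑ b, ∑ c, comps₃ a b c (comm₁ (T a b) (T a c)) := by
    simp only [map_sum, LinearMap.sum_apply, comm₁_comps, Finset.sum_ite_irrel,
      Finset.sum_const_zero, Finset.sum_ite_eq', Finset.mem_univ, if_true]
    exact Finset.sum_congr rfl fun a _ => Finset.sum_comm
  have h₂ : comm₂ (∑ k, ∑ l, comps m k l (T k l)) (∑ k, ∑ l, comps m k l (T k l))
      = ∑ a, ∑ b, ∑ c, comps₃ a b c (comm₂ (T a b) (T b c)) := by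
    simp only [map_sum, LinearMap.sum_apply, comm₂_comps, Finset.sum_ite_eq', Finset.mem_univ,
      if_true]
    rw [Finset.sum_comm (s := Finset.univ (α := Fin m)) (t := Finset.univ (α := Fin m))
      (f := fun a b => ∑ c, comps₃ a b c (comm₂ (T a b) (T b c)))]
    exact Finset.sum_congr rfl fun a _ => Finset.sum_comm
  have h₃ : comm₃ (∑ k, ∑ l, comps m k l (T k l)) (∑ k, ∑ l, comps m k l (T k l))
      = ∑ a, ∑ b, ∑ c, comps₃ a b c (comm₃ (T a c) (T b c)) := by
    simp only [map_sum, LinearMap.sum_apply, comm₃_comps, Finset.sum_ite_eq', Finset.mem_univ,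
      if_true]
    rw [Finset.sum_comm (s := Finset.univ (α := Fin m)) (t := Finset.univ (α := Fin m))
      (f := fun a b => ∑ c, comps₃ a b c (comm₃ (T a c) (T b c)))]
    exact Finset.sum_congr rfl fun a _ => Finset.sum_comm
  rw [cybTensor, h₁, h₂, h₃]
  simp only [cybTensor, map_add, Finset.sum_add_distrib]

lemma cybTensor_polyuble {r : L ⊗[ℂ] L} (hr : cybTensor r r r = 0)
    (hΩ : ∀ x : L, ⁅x, r + flip₂ r⁆ = 0) (m : ℕ) :
    cybTensor (polyuble m r) (polyuble m r) (polyuble m r) = 0 := by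
  rw [polyuble_eq_sum, cybTensor_sum_comps]
  exact Finset.sum_eq_zero fun a _ => Finset.sum_eq_zero fun b _ => Finset.sum_eq_zero fun c _ => by
    rw [cybTensor_polyComp hr hΩ, map_zero]

end YangBaxter

/-! ### Passage to the tensor cube of the enveloping algebra. -/

section YangBaxter

variable {L : Type*} [LieRing L] [LieAlgebra ℂ L]

attribute [local instance] LieRing.ofAssociativeRing in
-- Because ι : L → U(L) turns brackets into commutators, each commutator in U(L)^{⊗ 3} is the image
-- under ι ⊗ ι ⊗ ι of one of the three terms of `cybTensor`. Only this direction is needed, so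
-- injectivity of ι plays no role.
lemma isQuasitriangular_of_cybTensor {r : L ⊗[ℂ] L} (hr : cybTensor r r r = 0)
    (hΩ : ∀ x : L, ⁅x, r + flip₂ r⁆ = 0) : IsQuasitriangular r := by
  refine ⟨fun x => by rw [symmPart, lie_smul, hΩ, smul_zero], ?_⟩
  let i : L →ₗ[ℂ] UniversalEnvelopingAlgebra ℂ L := (UniversalEnvelopingAlgebra.ι ℂ (L := L))
  have hi : ∀ x y : L, i ⁅x, y⁆ = i x * i y - i y * i x := fun x y => by
    simp [i, LieHom.map_lie, LieRing.of_associative_ring_bracket]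
  let T := TensorProduct.map i (TensorProduct.map i i)
  have hp01 : ∀ a b : L, place 0 1 (a ⊗ₜ[ℂ] b) = i a ⊗ₜ (i b ⊗ₜ 1) := fun a b => by
    simp [place, leg, i]
  have hp02 : ∀ a b : L, place 0 2 (a ⊗ₜ[ℂ] b) = i a ⊗ₜ (1 ⊗ₜ i b) := fun a b => by
    simp [place, leg, i, Algebra.TensorProduct.one_def]
  have hp12 : ∀ a b : L, place 1 2 (a ⊗ₜ[ℂ] b) = 1 ⊗ₜ (i a ⊗ₜ i b) := fun a b => by
    simp [place, leg, i]
  have hadd : ∀ (p q : Fin 3) (u v : L ⊗[ℂ] L), place p q (u + v) = place p q u + place p q v :=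
    fun p q u v => map_add _ _ _
  have hzero : ∀ (p q : Fin 3), place p q (0 : L ⊗[ℂ] L) = 0 := fun p q => map_zero _
  have h₁ : ∀ u v : L ⊗[ℂ] L, place 0 1 u * place 0 2 v - place 0 2 v * place 0 1 u
      = T (comm₁ u v) := by
    intro u v
    induction u with
    | zero => simp [hzero]
    | add u u' hu hu' => simp only [hadd, map_add, LinearMap.add_apply, ← hu, ← hu']; noncomm_ring
    | tmul x y =>
      induction v with
      | zero => simp [hzero]
      | add v v' hv hv' => simp only [hadd, map_add, ← hv, ← hv']; noncomm_ring
      | tmul z w => simp [hp01, hp02, T, hi, TensorProduct.sub_tmul]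
  have h₂ : ∀ u v : L ⊗[ℂ] L, place 0 1 u * place 1 2 v - place 1 2 v * place 0 1 u
      = T (comm₂ u v) := by
    intro u v
    induction u with
    | zero => simp [hzero]
    | add u u' hu hu' => simp only [hadd, map_add, LinearMap.add_apply, ← hu, ← hu']; noncomm_ring
    | tmul x y =>
      induction v with
      | zero => simp [hzero]
      | add v v' hv hv' => simp only [hadd, map_add, ← hv, ← hv']; noncomm_ring
      | tmul z w => simp [hp01, hp12, T, hi, TensorProduct.sub_tmul, TensorProduct.tmul_sub]
  have h₃ : ∀ u v : L ⊗[ℂ] L, place 0 2 u * place 1 2 v - place 1 2 v * place 0 2 u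
      = T (comm₃ u v) := by
    intro u v
    induction u with
    | zero => simp [hzero]
    | add u u' hu hu' => simp only [hadd, map_add, LinearMap.add_apply, ← hu, ← hu']; noncomm_ring
    | tmul x y =>
      induction v with
      | zero => simp [hzero]
      | add v v' hv hv' => simp only [hadd, map_add, ← hv, ← hv']; noncomm_ring
      | tmul z w => simp [hp02, hp12, T, hi, TensorProduct.tmul_sub]
  rw [h₁, h₂, h₃, ← map_add, ← map_add]
  exact (congrArg T hr).trans (map_zero T)

end YangBaxter

/-! ### Poisson brackets from solutions of the classical Yang-Baxter equation -/

section Jacobi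

variable {B : Type*} [CommRing B] [Algebra ℂ B]

/-- In the Jacobiator the second derivatives combine into commutators of the vector fields, and what
remains is an expression of Yang-Baxter shape. -/
lemma isPoissonBracket_of_sum {ι : Type*} [Fintype ι] (X Y : ι → Derivation ℂ B B)
    (br : B →ₗ[ℂ] B →ₗ[ℂ] B) (hbr : ∀ f g, br f g = ∑ i, X i f * Y i g)
    (hself : ∀ f, br f f = 0)
    (hJ : ∀ f g h, ∑ i, ∑ j, (⁅X i, X j⁆ f * (Y i g * Y j h) + X i f * (⁅Y i, X j⁆ g * Y j h)
      + X i f * (X j g * ⁅Y i, Y j⁆ h)) = 0) : IsPoissonBracket br := by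
  have hskew : ∀ f g, br f g = - br g f := by
    intro f g
    have := hself (f + g)
    simp only [map_add, LinearMap.add_apply, hself, zero_add, add_zero] at this
    exact eq_neg_of_add_eq_zero_right this
  have hl : ∀ f g h, br (f * g) h = f * br g h + g * br f h := by
    intro f g h
    simp only [hbr, Derivation.leibniz, smul_eq_mul, add_mul, Finset.sum_add_distrib,
      Finset.mul_sum, mul_assoc]
  have hr : ∀ f g h, br f (g * h) = g * br f h + h * br f g := by
    intro f g h
    rw [hskew, hl, hskew g f, hskew h f]; ring
  refine ⟨hself, fun f g h => ?_, hl, hr⟩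
  -- Skew-symmetry is used so that in all three expansions f is differentiated only by the X's and h
  -- only by the Y's, as in `hJ`.
  have e1 : br f (br g h) = ∑ j, ∑ i, (X i f * Y i (X j g) * Y j h + X j g * (X i f * Y i (Y j h))) := by
    rw [hbr g h, map_sum]
    refine Finset.sum_congr rfl fun j _ => ?_
    rw [hr, hbr, hbr, Finset.mul_sum, Finset.mul_sum, ← Finset.sum_add_distrib]
    exact Finset.sum_congr rfl fun i _ => by ring
  have e2 : br g (br h f) = ∑ j, ∑ i, (X i (X j f) * Y i g * Y j h - X j f * (X i g * Y i (Y j h))) := by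
    rw [hskew h f, map_neg, hbr f h, map_sum, ← Finset.sum_neg_distrib]
    refine Finset.sum_congr rfl fun j _ => ?_
    rw [hr, hskew g (X j f), hbr, hbr, mul_neg, Finset.mul_sum, Finset.mul_sum, neg_add, neg_neg,
      add_comm, ← sub_eq_add_neg, ← Finset.sum_sub_distrib]
    exact Finset.sum_congr rfl fun i _ => by ring
  have e3 : br h (br f g) = ∑ j, ∑ i, (- (X i (X j f) * Y i h * Y j g) - X j f * (X i (Y j g) * Y i h)) := by
    rw [hbr f g, map_sum]
    refine Finset.sum_congr rfl fun j _ => ?_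
    rw [hr, hskew h (X j f), hskew h (Y j g), hbr, hbr, mul_neg, mul_neg, Finset.mul_sum,
      Finset.mul_sum, ← neg_add, ← Finset.sum_add_distrib, ← Finset.sum_neg_distrib]
    exact Finset.sum_congr rfl fun i _ => by ring
  rw [e1, e2, e3]
  have hJ' := hJ f g h
  simp only [Derivation.commutator_apply] at hJ'
  simp only [sub_mul, mul_sub, Finset.sum_add_distrib, Finset.sum_sub_distrib] at hJ'
  simp only [Finset.sum_add_distrib, Finset.sum_sub_distrib, Finset.sum_neg_distrib]
  rw [Finset.sum_comm (f := fun i j => X i (X j f) * (Y i g * Y j h)),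
    Finset.sum_comm (f := fun i j => X i f * (Y i (X j g) * Y j h)),
    Finset.sum_comm (f := fun i j => X i f * (X j g * Y i (Y j h)))] at hJ'
  simp only [mul_comm, mul_left_comm] at hJ' ⊢
  linear_combination hJ'

variable {V : Type*} [AddCommGroup V] [Module ℂ V]

/-- `x ↦ ρ(x)(f)`. -/
def evalAt (ρ : V →ₗ[ℂ] Derivation ℂ B B) (f : B) : V →ₗ[ℂ] B where
  toFun x := ρ x f
  map_add' x y := by simp
  map_smul' c x := by simp

@[simp] lemma evalAt_apply (ρ : V →ₗ[ℂ] Derivation ℂ B B) (f : B) (x : V) :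
    evalAt ρ f x = ρ x f := rfl

/-- `x ⊗ y ↦ φ(x) ψ(y)`. -/
def mulMap (φ ψ : V →ₗ[ℂ] B) : V ⊗[ℂ] V →ₗ[ℂ] B :=
  LinearMap.mul' ℂ B ∘ₗ TensorProduct.map φ ψ

@[simp] lemma mulMap_tmul (φ ψ : V →ₗ[ℂ] B) (x y : V) :
    mulMap φ ψ (x ⊗ₜ[ℂ] y) = φ x * ψ y := rfl

/-- `x ⊗ y ⊗ z ↦ φ(x) ψ(y) χ(z)`. -/
def mulMap₃ (φ ψ χ : V →ₗ[ℂ] B) : V ⊗[ℂ] (V ⊗[ℂ] V) →ₗ[ℂ] B :=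
  LinearMap.mul' ℂ B ∘ₗ TensorProduct.map φ (mulMap ψ χ)

@[simp] lemma mulMap₃_tmul (φ ψ χ : V →ₗ[ℂ] B) (x y z : V) :
    mulMap₃ φ ψ χ (x ⊗ₜ[ℂ] (y ⊗ₜ[ℂ] z)) = φ x * (ψ y * χ z) := rfl

@[simp] lemma act₂_tmul (ρ : V →ₗ[ℂ] Derivation ℂ B B) (x y : V) (f g : B) :
    act₂ ρ (x ⊗ₜ[ℂ] y) f g = ρ x f * ρ y g := rfl

lemma act₂_eq_mulMap (ρ : V →ₗ[ℂ] Derivation ℂ B B) (t : V ⊗[ℂ] V) (f g : B) :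
    act₂ ρ t f g = mulMap (evalAt ρ f) (evalAt ρ g) t := by
  induction t with
  | zero => simp
  | add u v hu hv => simp only [map_add, LinearMap.add_apply, hu, hv]
  | tmul x y => simp

lemma act₂_flip₂ (ρ : V →ₗ[ℂ] Derivation ℂ B B) (t : V ⊗[ℂ] V) (f g : B) :
    act₂ ρ (flip₂ t) f g = act₂ ρ t g f := by
  induction t with
  | zero => simp
  | add u v hu hv => simp only [map_add, LinearMap.add_apply, hu, hv, flip₂_add]
  | tmul x y => simp [mul_comm]

lemma act₂_skewPart_self (ρ : V →ₗ[ℂ] Derivation ℂ B B) (t : V ⊗[ℂ] V) (f : B) :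
    act₂ ρ (skewPart t) f f = 0 := by
  rw [skewPart, map_smul, map_sub, LinearMap.smul_apply, LinearMap.smul_apply,
    LinearMap.sub_apply, LinearMap.sub_apply, act₂_flip₂, sub_self, smul_zero]

variable {L : Type*} [LieRing L] [LieAlgebra ℂ L]

/-- If `l` is a Lie morphism and `ρ` an anti-morphism to derivations, with commuting images, then
`t^l - t^ρ` is a Poisson bracket for every solution `t` of the classical Yang-Baxter equation for
which it is skew-symmetric. -/
lemma isPoissonBracket_of_cybTensor (l ρ : L →ₗ[ℂ] Derivation ℂ B B)
    (hl : ∀ x y, l ⁅x, y⁆ = ⁅l x, l y⁆) (hρ : ∀ x y, ρ ⁅x, y⁆ = -⁅ρ x, ρ y⁆)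
    (hlρ : ∀ x y, ⁅l x, ρ y⁆ = 0) {t : L ⊗[ℂ] L} (ht : cybTensor t t t = 0)
    (hself : ∀ f, (act₂ l t - act₂ ρ t) f f = 0) : IsPoissonBracket (act₂ l t - act₂ ρ t) := by
  obtain ⟨S, hS⟩ := TensorProduct.exists_finset t
  have hS' : t = ∑ i : S, i.1.1 ⊗ₜ[ℂ] i.1.2 := by
    rw [hS]; exact (Finset.sum_coe_sort S (fun i => i.1 ⊗ₜ[ℂ] i.2)).symm
  have hρl : ∀ x y, ⁅ρ x, l y⁆ = 0 := fun x y => by rw [← lie_skew, hlρ, neg_zero]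
  have hρ' : ∀ x y, ⁅ρ x, ρ y⁆ = -ρ ⁅x, y⁆ := fun x y => by rw [hρ, neg_neg]
  have hcyb : ∀ φ ψ χ : L →ₗ[ℂ] B, ∑ i : S, ∑ j : S,
      (φ ⁅i.1.1, j.1.1⁆ * (ψ i.1.2 * χ j.1.2) + φ i.1.1 * (ψ ⁅i.1.2, j.1.1⁆ * χ j.1.2)
        + φ i.1.1 * (ψ j.1.1 * χ ⁅i.1.2, j.1.2⁆)) = 0 := by
    intro φ ψ χ
    have h := congrArg (mulMap₃ φ ψ χ) ht
    rw [cybTensor, hS'] at h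
    simp only [map_sum, LinearMap.sum_apply, map_add, comm₁_tmul, comm₂_tmul, comm₃_tmul,
      mulMap₃_tmul, map_zero] at h
    rw [Finset.sum_comm]
    simpa only [Finset.sum_add_distrib] using h
  -- The vector fields are l(a_i), l(b_i) on one copy of the index set and -ρ(a_i), ρ(b_i) on the
  -- other. Mixed commutators vanish, so the Yang-Baxter expressions for l and ρ separate.
  refine isPoissonBracket_of_sum (ι := S ⊕ S)
    (Sum.elim (fun i => l i.1.1) (fun i => -ρ i.1.1))
    (Sum.elim (fun i => l i.1.2) (fun i => ρ i.1.2)) _ ?_ hself ?_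
  · intro f g
    simp only [LinearMap.sub_apply, Fintype.sum_sum_type, Sum.elim_inl, Sum.elim_inr]
    rw [hS']
    simp [sub_eq_add_neg]
  · intro f g h
    have h1 := hcyb (evalAt l f) (evalAt l g) (evalAt l h)
    have h2 := hcyb (evalAt ρ f) (evalAt ρ g) (evalAt ρ h)
    simp only [evalAt_apply] at h1 h2
    simp only [Fintype.sum_sum_type, Sum.elim_inl, Sum.elim_inr, neg_lie, lie_neg, hlρ, hρl, hρ',
      ← hl, neg_neg, neg_zero, Derivation.coe_zero, Pi.zero_apply, zero_mul, mul_zero, add_zero,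
      Finset.sum_const_zero, Derivation.coe_neg, Pi.neg_apply, zero_add, neg_mul, mul_neg]
    -- In the ρ block, the sign in -ρ(a_i) and the anti-morphism property together give all three
    -- terms the factor -1.
    rw [h1, zero_add, ← neg_eq_zero, ← h2]
    simp only [← Finset.sum_neg_distrib]
    exact Finset.sum_congr rfl fun i _ => Finset.sum_congr rfl fun j _ => by ring

end Jacobi

/-! ### Two-tensors as operators, through the Killing form -/

section Operators

variable {L : Type*} [LieRing L] [LieAlgebra ℂ L] [FiniteDimensional ℂ L]

/-- The operator `x ↦ ∑ ⟨a_i, x⟩ b_i` attached to `∑ a_i ⊗ b_i`. -/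
def tensorOp : L ⊗[ℂ] L →ₗ[ℂ] L →ₗ[ℂ] L :=
  dualTensorHom ℂ L L ∘ₗ TensorProduct.map (killingForm ℂ L) LinearMap.id

@[simp] lemma tensorOp_tmul (a b x : L) :
    tensorOp (a ⊗ₜ[ℂ] b) x = killingForm ℂ L a x • b := rfl

variable [LieAlgebra.IsKilling ℂ L]

lemma killingForm_injective : Function.Injective (killingForm ℂ L) :=
  LinearMap.ker_eq_bot.mp (LieAlgebra.IsKilling.ker_killingForm_eq_bot ℂ L)

lemma killingForm_surjective (φ : L →ₗ[ℂ] ℂ) : ∃ x, killingForm ℂ L x = φ :=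
  (LinearMap.injective_iff_surjective_of_finrank_eq_finrank
    (Subspace.dual_finrank_eq (K := ℂ) (V := L)).symm).1 killingForm_injective φ

/-- Nondegeneracy of the Killing form identifies L ⊗ L with End L, so identities between two-tensors
can be checked on operators. -/
lemma tensorOp_injective : Function.Injective (tensorOp (L := L)) := by
  have h1 : Function.Injective (dualTensorHom ℂ L L) := dualTensorHom_bijective.1
  have h2 : Function.Injective (TensorProduct.map (killingForm ℂ L) (LinearMap.id : L →ₗ[ℂ] L)) :=
    Module.Flat.rTensor_preserves_injective_linearMap (M := L) _ killingForm_injective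
  exact h1.comp h2

/-- Automorphisms are isometries of the Killing form, so acting on both legs conjugates the
operator. -/
lemma tensorOp_map (e : L ≃ₗ⁅ℂ⁆ L) (t : L ⊗[ℂ] L) (x : L) :
    tensorOp (TensorProduct.map (e : L →ₗ[ℂ] L) (e : L →ₗ[ℂ] L) t) x = e (tensorOp t (e.symm x)) := by
  induction t with
  | zero => simp
  | add u v hu hv => simp only [map_add, LinearMap.add_apply, hu, hv]
  | tmul a b =>
    have : killingForm ℂ L (e a) x = killingForm ℂ L a (e.symm x) := by
      conv_lhs => rw [← e.apply_symm_apply x]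
      exact LieAlgebra.killingForm_of_equiv_apply e a (e.symm x)
    simp [this]

lemma killingForm_lie_left (x y z : L) :
    killingForm ℂ L ⁅x, y⁆ z = killingForm ℂ L x ⁅y, z⁆ :=
  LieModule.traceForm_apply_lie_apply ℂ L L x y z

lemma killingForm_comm (x y : L) : killingForm ℂ L x y = killingForm ℂ L y x :=
  LieModule.traceForm_comm ℂ L L x y

lemma tensorOp_lie (y : L) (t : L ⊗[ℂ] L) (x : L) :
    tensorOp ⁅y, t⁆ x = ⁅y, tensorOp t x⁆ - tensorOp t ⁅y, x⁆ := by
  induction t with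
  | zero => simp
  | add u v hu hv => simp only [map_add, LinearMap.add_apply, lie_add, hu, hv]; abel
  | tmul a b =>
    have : killingForm ℂ L ⁅y, a⁆ x = - killingForm ℂ L a ⁅y, x⁆ := by
      rw [← killingForm_lie_left, ← lie_skew, map_neg, LinearMap.neg_apply]
    simp [TensorProduct.LieModule.lie_tmul_right, this]
    abel

/-- The Casimir element is invariant. -/
lemma map_eq_self_of_tensorOp_eq_id {t : L ⊗[ℂ] L} (ht : tensorOp t = LinearMap.id)
    (e : L ≃ₗ⁅ℂ⁆ L) : TensorProduct.map (e : L →ₗ[ℂ] L) (e : L →ₗ[ℂ] L) t = t :=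
  tensorOp_injective <| by ext x; simp [tensorOp_map, ht]

lemma lie_eq_zero_of_tensorOp_eq_id {t : L ⊗[ℂ] L} (ht : tensorOp t = LinearMap.id) (x : L) :
    ⁅x, t⁆ = 0 :=
  tensorOp_injective <| by ext y; simp [tensorOp_lie, ht]

/-- Every linear functional is a Killing pairing, so these contractions include all coordinates in a
tensor product basis. -/
lemma eq_zero_of_mulMap₃_eq_zero (T : L ⊗[ℂ] (L ⊗[ℂ] L))
    (h : ∀ x y z : L, mulMap₃ (killingForm ℂ L x) (killingForm ℂ L y) (killingForm ℂ L z) T = 0) :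
    T = 0 := by
  let b := Module.finBasis ℂ L
  refine (b.tensorProduct (b.tensorProduct b)).ext_elem fun i => ?_
  obtain ⟨i, j, k⟩ := i
  obtain ⟨x, hx⟩ := killingForm_surjective (b.coord i)
  obtain ⟨y, hy⟩ := killingForm_surjective (b.coord j)
  obtain ⟨z, hz⟩ := killingForm_surjective (b.coord k)
  have key : ∀ T, (b.tensorProduct (b.tensorProduct b)).repr T (i, j, k)
      = mulMap₃ (b.coord i) (b.coord j) (b.coord k) T := by
    intro T
    induction T with
    | zero => simp
    | add u v hu hv => rw [map_add, map_add, Finsupp.add_apply, hu, hv]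
    | tmul a w =>
      induction w with
      | zero => simp
      | add u v hu hv => rw [TensorProduct.tmul_add, map_add, map_add, Finsupp.add_apply, hu, hv]
      | tmul c d => simp; ring
  rw [key, ← hx, ← hy, ← hz, h]
  simp

/-- The two unbracketed legs are contracted with y and z and turn into operators applied to them,
which rewrites the CYBE in terms of the operators of r and r₂₁. -/
lemma mulMap₃_comm₁ (x y z : L) (u v : L ⊗[ℂ] L) :
    mulMap₃ (killingForm ℂ L x) (killingForm ℂ L y) (killingForm ℂ L z) (comm₁ u v)
      = killingForm ℂ L x ⁅tensorOp (flip₂ u) y, tensorOp (flip₂ v) z⁆ := by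
  induction u with
  | zero => simp
  | add u u' hu hu' => simp only [map_add, LinearMap.add_apply, hu, hu', flip₂_add, add_lie]
  | tmul a b =>
    induction v with
    | zero => simp
    | add v v' hv hv' => simp only [map_add, LinearMap.add_apply, hv, hv', flip₂_add, lie_add]
    | tmul c d =>
      simp [killingForm_comm b y, killingForm_comm d z]; ring

lemma mulMap₃_comm₂ (x y z : L) (u v : L ⊗[ℂ] L) :
    mulMap₃ (killingForm ℂ L x) (killingForm ℂ L y) (killingForm ℂ L z) (comm₂ u v)
      = killingForm ℂ L y ⁅tensorOp u x, tensorOp (flip₂ v) z⁆ := by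
  induction u with
  | zero => simp
  | add u u' hu hu' => simp only [map_add, LinearMap.add_apply, hu, hu', add_lie]
  | tmul a b =>
    induction v with
    | zero => simp
    | add v v' hv hv' => simp only [map_add, LinearMap.add_apply, hv, hv', flip₂_add, lie_add]
    | tmul c d =>
      simp [killingForm_comm a x, killingForm_comm d z]; ring

lemma mulMap₃_comm₃ (x y z : L) (u v : L ⊗[ℂ] L) :
    mulMap₃ (killingForm ℂ L x) (killingForm ℂ L y) (killingForm ℂ L z) (comm₃ u v)
      = killingForm ℂ L z ⁅tensorOp u x, tensorOp v y⁆ := by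
  induction u with
  | zero => simp
  | add u u' hu hu' => simp only [map_add, LinearMap.add_apply, hu, hu', add_lie]
  | tmul a b =>
    induction v with
    | zero => simp
    | add v v' hv hv' => simp only [map_add, LinearMap.add_apply, hv, hv', lie_add]
    | tmul c d =>
      simp [killingForm_comm a x, killingForm_comm c y]; ring

lemma killingForm_tensorOp (u : L ⊗[ℂ] L) (x y : L) :
    killingForm ℂ L (tensorOp u x) y = killingForm ℂ L x (tensorOp (flip₂ u) y) := by
  induction u with
  | zero => simp
  | add u u' hu hu' => simp only [map_add, LinearMap.add_apply, hu, hu', flip₂_add]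
  | tmul a b => simp [killingForm_comm a x]; ring

/-- The modified Yang-Baxter equation implies the classical Yang-Baxter equation. -/
lemma cybTensor_eq_zero_of_modified {r : L ⊗[ℂ] L}
    (hid : ∀ x, tensorOp r x + tensorOp (flip₂ r) x = x)
    (hmod : ∀ y z, ⁅tensorOp (flip₂ r) y, tensorOp (flip₂ r) z⁆
      = tensorOp (flip₂ r) (⁅tensorOp (flip₂ r) y, z⁆ + ⁅y, tensorOp (flip₂ r) z⁆ - ⁅y, z⁆)) :
    cybTensor r r r = 0 := by
  refine eq_zero_of_mulMap₃_eq_zero _ fun x y z => ?_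
  rw [cybTensor, map_add, map_add, mulMap₃_comm₁, mulMap₃_comm₂, mulMap₃_comm₃]
  -- With R the operator of r₂₁, that of r is both its adjoint and 1 - R. Together with invariance
  -- of the form this brings every term to a pairing with x, leaving the modified equation.
  have e2 : killingForm ℂ L y ⁅tensorOp r x, tensorOp (flip₂ r) z⁆
      = - killingForm ℂ L x (tensorOp (flip₂ r) ⁅y, tensorOp (flip₂ r) z⁆) := by
    rw [← killingForm_tensorOp, ← lie_skew, map_neg, ← killingForm_lie_left, killingForm_comm]
  have e3 : killingForm ℂ L z ⁅tensorOp r x, tensorOp r y⁆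
      = killingForm ℂ L x (tensorOp (flip₂ r) ⁅tensorOp r y, z⁆) := by
    rw [← killingForm_tensorOp, killingForm_comm, killingForm_lie_left]
  have e4 : tensorOp r y = y - tensorOp (flip₂ r) y := eq_sub_of_add_eq (hid y)
  rw [e2, e3, e4, hmod]
  simp only [sub_lie, map_sub, map_add]
  ring

end Operators

/-! ### The standard `r`-matrix -/

section Triangular

variable {L : Type*} [LieRing L] [LieAlgebra ℂ L]

/-- On vectors with R-eigenvalues λ and μ the identity reads λμ[y, z] = (λ + μ - 1) R[y, z]. The
brackets of P with N, which are uncontrolled, have both coefficients 0; all others lie in P or N, or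
vanish. -/
lemma modified_of_triangular (R : L →ₗ[ℂ] L) (P T N : Submodule ℂ L)
    (hsup : ∀ x : L, ∃ p ∈ P, ∃ t ∈ T, ∃ n ∈ N, x = p + t + n)
    (hP : ∀ p ∈ P, R p = 0) (hT : ∀ t ∈ T, R t = (1 / 2 : ℂ) • t) (hN : ∀ n ∈ N, R n = n)
    (hPP : ∀ p ∈ P, ∀ q ∈ P, ⁅p, q⁆ ∈ P) (hNN : ∀ p ∈ N, ∀ q ∈ N, ⁅p, q⁆ ∈ N)
    (hTP : ∀ t ∈ T, ∀ p ∈ P, ⁅t, p⁆ ∈ P) (hTN : ∀ t ∈ T, ∀ p ∈ N, ⁅t, p⁆ ∈ N)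
    (hTT : ∀ t ∈ T, ∀ s ∈ T, ⁅t, s⁆ = 0) (y z : L) :
    ⁅R y, R z⁆ = R (⁅R y, z⁆ + ⁅y, R z⁆ - ⁅y, z⁆) := by
  obtain ⟨p, hp, t, ht, n, hn, rfl⟩ := hsup y
  obtain ⟨p', hp', t', ht', n', hn', rfl⟩ := hsup z
  have e : ∀ p ∈ P, ∀ t ∈ T, ∀ n ∈ N, R (p + t + n) = (1 / 2 : ℂ) • t + n := by
    intro p hp t ht n hn
    rw [map_add, map_add, hP p hp, hT t ht, hN n hn, zero_add]
  have hPT : ∀ p ∈ P, ∀ t ∈ T, ⁅p, t⁆ ∈ P := fun p hp t ht => by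
    rw [← lie_skew]; exact P.neg_mem (hTP t ht p hp)
  have hNT : ∀ p ∈ N, ∀ t ∈ T, ⁅p, t⁆ ∈ N := fun p hp t ht => by
    rw [← lie_skew]; exact N.neg_mem (hTN t ht p hp)
  -- Arranged as a sum of elements of P, T and N, with T-part 0, so that `e` evaluates R on it.
  have key : ⁅(1 / 2 : ℂ) • t + n, p' + t' + n'⁆ + ⁅p + t + n, (1 / 2 : ℂ) • t' + n'⁆
      - ⁅p + t + n, p' + t' + n'⁆
      = -(⁅p, p'⁆ + (1 / 2 : ℂ) • ⁅t, p'⁆ + (1 / 2 : ℂ) • ⁅p, t'⁆) + 0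
        + (⁅n, n'⁆ + (1 / 2 : ℂ) • ⁅t, n'⁆ + (1 / 2 : ℂ) • ⁅n, t'⁆) := by
    simp only [add_lie, lie_add, smul_lie, lie_smul, hTT t ht t' ht']
    module
  rw [e p hp t ht n hn, e p' hp' t' ht' n' hn', key, e _ _ 0 T.zero_mem]
  · simp only [add_lie, lie_add, smul_lie, lie_smul, hTT t ht t' ht']
    module
  · exact N.add_mem (N.add_mem (hNN n hn n' hn') (N.smul_mem _ (hTN t ht n' hn')))
      (N.smul_mem _ (hNT n hn t' ht'))
  · exact P.neg_mem (P.add_mem (P.add_mem (hPP p hp p' hp') (P.smul_mem _ (hTP t ht p' hp')))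
      (P.smul_mem _ (hPT p hp t' ht')))

end Triangular

/-! ### Triangular decomposition and the operators of r_st and its flip. -/

namespace StandardData

variable {L : Type*} [LieRing L] [LieAlgebra ℂ L] [FiniteDimensional ℂ L]
  [LieAlgebra.IsSemisimple ℂ L] (D : StandardData L)

open LieAlgebra

/-- `𝔫₋ = ∑_{α > 0} 𝔤_{-α}`. -/
def oppNilradical : Submodule ℂ L :=
  ⨆ α, ⨆ _ : D.base.IsPos α, (rootSpace D.cartan (-(α.1 : D.cartan → ℂ))).toSubmodule

variable {D}

lemma ne_zero_of_root (α : D.cartan.root) : (α.1 : D.cartan → ℂ) ≠ 0 :=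
  D.cartan.isNonZero_coe_root α

/-- The reflection in α sends α to -α, which turns positivity of the opposite root into an identity
between functionals on the Cartan subalgebra. -/
lemma isPos_neg_or {α : D.cartan.root} : D.base.IsPos α ∨
    ∃ β, D.base.IsPos β ∧ (α.1 : D.cartan → ℂ) = -(β.1 : D.cartan → ℂ) := by
  refine (RootPairing.Base.IsPos.or_neg D.base α).imp_right fun h => ⟨_, h, ?_⟩
  have e := (IsKilling.rootSystem D.cartan).root_reflectionPerm α α
  rw [RootPairing.reflection_apply_self] at e
  ext x
  have := LinearMap.congr_fun e x
  simp only [IsKilling.rootSystem_root_apply, LinearMap.neg_apply,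
    LieModule.Weight.toLinear_apply] at this
  rw [Pi.neg_apply]
  exact neg_eq_iff_eq_neg.1 this.symm

/-- A vanishing sum would make -β = α positive together with β. -/
lemma add_ne_zero {α β : D.cartan.root} (hα : D.base.IsPos α) (hβ : D.base.IsPos β) :
    (α.1 : D.cartan → ℂ) + β.1 ≠ 0 := by
  intro h
  refine (RootPairing.Base.IsPos.neg_iff_not D.base β).1 ?_ hβ
  convert hα
  refine (IsKilling.rootSystem D.cartan).root.injective ?_
  have e := (IsKilling.rootSystem D.cartan).root_reflectionPerm β β
  rw [RootPairing.reflection_apply_self] at e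
  refine e.trans ?_
  ext x
  have := congrFun h x
  simp only [Pi.add_apply, Pi.zero_apply] at this
  simp only [IsKilling.rootSystem_root_apply, LinearMap.neg_apply,
    LieModule.Weight.toLinear_apply]
  linear_combination -this

lemma exists_isPos_add {α β : D.cartan.root} (hα : D.base.IsPos α) (hβ : D.base.IsPos β)
    (h : rootSpace D.cartan ((α.1 : D.cartan → ℂ) + β.1) ≠ ⊥) :
    ∃ γ : D.cartan.root, D.base.IsPos γ ∧ (γ.1 : D.cartan → ℂ) = α.1 + β.1 := by
  let ω : LieModule.Weight ℂ D.cartan L := ⟨_, h⟩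
  have hω : ω.IsNonZero := fun h0 => add_ne_zero hα hβ h0
  let γ : D.cartan.root := ⟨ω, by simpa using hω⟩
  refine ⟨γ, RootPairing.Base.IsPos.add hα hβ ?_, rfl⟩
  ext x
  rfl

lemma rootSpace_le_nilradical {α : D.cartan.root} (hα : D.base.IsPos α) :
    (rootSpace D.cartan (α.1 : D.cartan → ℂ)).toSubmodule ≤ D.nilradical :=
  le_iSup₂_of_le α hα le_rfl

lemma rootSpace_le_oppNilradical {α : D.cartan.root} (hα : D.base.IsPos α) :
    (rootSpace D.cartan (-(α.1 : D.cartan → ℂ))).toSubmodule ≤ D.oppNilradical :=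
  le_iSup₂_of_le α hα le_rfl

lemma nilradical_induction {p : L → Prop} (h0 : p 0) (hadd : ∀ x y, p x → p y → p (x + y))
    (h : ∀ α, D.base.IsPos α → ∀ x ∈ rootSpace D.cartan (α.1 : D.cartan → ℂ), p x)
    {x : L} (hx : x ∈ D.nilradical) : p x := by
  refine Submodule.iSup_induction _ (motive := p) hx (fun α y hy => ?_) h0 hadd
  by_cases hα : D.base.IsPos α
  · rw [iSup_pos hα] at hy; exact h α hα y hy
  · rw [iSup_neg hα, Submodule.mem_bot] at hy; rwa [hy]

lemma oppNilradical_induction {p : L → Prop} (h0 : p 0) (hadd : ∀ x y, p x → p y → p (x + y))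
    (h : ∀ α, D.base.IsPos α → ∀ x ∈ rootSpace D.cartan (-(α.1 : D.cartan → ℂ)), p x)
    {x : L} (hx : x ∈ D.oppNilradical) : p x := by
  refine Submodule.iSup_induction _ (motive := p) hx (fun α y hy => ?_) h0 hadd
  by_cases hα : D.base.IsPos α
  · rw [iSup_pos hα] at hy; exact h α hα y hy
  · rw [iSup_neg hα, Submodule.mem_bot] at hy; rwa [hy]

lemma lie_mem_nilradical {x y : L} (hx : x ∈ D.nilradical) (hy : y ∈ D.nilradical) :
    ⁅x, y⁆ ∈ D.nilradical := by
  refine nilradical_induction (p := fun x => ⁅x, y⁆ ∈ D.nilradical) (by simp)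
    (fun x x' h h' => by rw [add_lie]; exact add_mem h h') (fun α hα x hx => ?_) hx
  refine nilradical_induction (p := fun y => ⁅x, y⁆ ∈ D.nilradical) (by simp)
    (fun x x' h h' => by rw [lie_add]; exact add_mem h h') (fun β hβ y hy => ?_) hy
  have hxy := lie_mem_genWeightSpace_of_mem_genWeightSpace hx hy
  by_cases h : rootSpace D.cartan ((α.1 : D.cartan → ℂ) + β.1) = ⊥
  · rw [rootSpace] at h
    rw [h, LieSubmodule.mem_bot] at hxy
    rw [hxy]; exact zero_mem _
  · obtain ⟨γ, hγ, hγe⟩ := exists_isPos_add hα hβ h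
    exact rootSpace_le_nilradical hγ (by rw [hγe]; exact hxy)

lemma lie_mem_oppNilradical {x y : L} (hx : x ∈ D.oppNilradical) (hy : y ∈ D.oppNilradical) :
    ⁅x, y⁆ ∈ D.oppNilradical := by
  refine oppNilradical_induction (p := fun x => ⁅x, y⁆ ∈ D.oppNilradical) (by simp)
    (fun x x' h h' => by rw [add_lie]; exact add_mem h h') (fun α hα x hx => ?_) hx
  refine oppNilradical_induction (p := fun y => ⁅x, y⁆ ∈ D.oppNilradical) (by simp)
    (fun x x' h h' => by rw [lie_add]; exact add_mem h h') (fun β hβ y hy => ?_) hy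
  have hxy := lie_mem_genWeightSpace_of_mem_genWeightSpace hx hy
  by_cases h : rootSpace D.cartan ((α.1 : D.cartan → ℂ) + β.1) = ⊥
  -- Weights are closed under negation, so the spaces for α + β and for -α - β vanish together.
  · have h' : rootSpace D.cartan (-(α.1 : D.cartan → ℂ) + -β.1) = ⊥ := by
      by_contra hne
      let ω : LieModule.Weight ℂ D.cartan L := ⟨_, hne⟩
      refine LieModule.Weight.genWeightSpace_ne_bot L (-ω) ?_
      rw [LieModule.Weight.coe_neg]
      convert h using 2
      change -(-(α.1 : D.cartan → ℂ) + -(β.1 : D.cartan → ℂ)) = _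
      abel
    rw [rootSpace] at h'
    rw [h', LieSubmodule.mem_bot] at hxy
    rw [hxy]; exact zero_mem _
  · obtain ⟨γ, hγ, hγe⟩ := exists_isPos_add hα hβ h
    exact rootSpace_le_oppNilradical hγ (by rw [hγe, neg_add]; exact hxy)

lemma mem_rootSpace_zero {t : L} (ht : t ∈ D.cartan) : t ∈ rootSpace D.cartan (0 : D.cartan → ℂ) := by
  rw [rootSpace_zero_eq]; exact ht

lemma lie_cartan_mem_nilradical {t x : L} (ht : t ∈ D.cartan) (hx : x ∈ D.nilradical) :
    ⁅t, x⁆ ∈ D.nilradical := by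
  refine nilradical_induction (p := fun y => ⁅t, y⁆ ∈ D.nilradical) (by simp)
    (fun x x' h h' => by rw [lie_add]; exact add_mem h h') (fun β hβ y hy => ?_) hx
  have := lie_mem_genWeightSpace_of_mem_genWeightSpace (mem_rootSpace_zero ht) hy
  rw [zero_add] at this
  exact rootSpace_le_nilradical hβ this

lemma lie_cartan_mem_oppNilradical {t x : L} (ht : t ∈ D.cartan) (hx : x ∈ D.oppNilradical) :
    ⁅t, x⁆ ∈ D.oppNilradical := by
  refine oppNilradical_induction (p := fun y => ⁅t, y⁆ ∈ D.oppNilradical) (by simp)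
    (fun x x' h h' => by rw [lie_add]; exact add_mem h h') (fun β hβ y hy => ?_) hx
  have := lie_mem_genWeightSpace_of_mem_genWeightSpace (mem_rootSpace_zero ht) hy
  rw [zero_add] at this
  exact rootSpace_le_oppNilradical hβ this

lemma lie_cartan_cartan {t s : L} (ht : t ∈ D.cartan) (hs : s ∈ D.cartan) : ⁅t, s⁆ = 0 := by
  have h : ⁅(⟨t, ht⟩ : D.cartan), (⟨s, hs⟩ : D.cartan)⁆ = 0 := trivial_lie_zero _ _ _ _
  exact congrArg Subtype.val h

lemma exists_triangular (x : L) : ∃ p ∈ D.nilradical, ∃ t ∈ D.cartan.toSubmodule,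
    ∃ n ∈ D.oppNilradical, x = p + t + n := by
  have h : D.nilradical ⊔ D.cartan.toSubmodule ⊔ D.oppNilradical = ⊤ := by
    rw [eq_top_iff]
    have h' := congrArg LieSubmodule.toSubmodule (cartan_sup_iSup_rootSpace_eq_top
      (K := ℂ) (H := D.cartan) (L := L))
    rw [LieSubmodule.top_toSubmodule] at h'
    rw [← h']
    simp only [LieSubmodule.sup_toSubmodule, LieSubmodule.iSup_toSubmodule]
    refine sup_le (le_sup_of_le_left le_sup_right) (iSup₂_le fun α hα => ?_)
    let a : D.cartan.root := ⟨α, by simpa using hα⟩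
    rcases isPos_neg_or (D := D) (α := a) with h | ⟨β, hβ, he⟩
    · exact (rootSpace_le_nilradical h).trans (le_sup_left.trans le_sup_left)
    · have he' : rootSpace D.cartan (α : D.cartan → ℂ) = rootSpace D.cartan (-(β.1 : D.cartan → ℂ)) :=
        congrArg _ he
      rw [he']
      exact (rootSpace_le_oppNilradical hβ).trans le_sup_right
  obtain ⟨y, hy, n, hn, rfl⟩ := Submodule.mem_sup.1 (h ▸ Submodule.mem_top : x ∈ _)
  obtain ⟨p, hp, t, ht, rfl⟩ := Submodule.mem_sup.1 hy
  exact ⟨p, hp, t, ht, n, hn, rfl⟩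

open Classical in
lemma tensorOp_rSt (x : L) : tensorOp D.rSt x
    = (1 / 2 : ℂ) • ∑ i, killingForm ℂ L (D.h i) x • (D.h i : L)
      + ∑ α with D.base.IsPos α, killingForm ℂ L (D.em α) x • D.ep α := by
  simp [rSt, r₀, map_sum, map_add, LinearMap.add_apply]

open Classical in
lemma tensorOp_flip₂_rSt (x : L) : tensorOp (flip₂ D.rSt) x
    = (1 / 2 : ℂ) • ∑ i, killingForm ℂ L (D.h i) x • (D.h i : L)
      + ∑ α with D.base.IsPos α, killingForm ℂ L (D.ep α) x • D.em α := by
  have h : flip₂ D.rSt = (1 / 2 : ℂ) • ∑ i, (D.h i : L) ⊗ₜ[ℂ] (D.h i : L)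
      + ∑ α with D.base.IsPos α, D.ep α ⊗ₜ[ℂ] D.em α := by
    simp [rSt, r₀, flip₂, map_sum, map_add]
  rw [h]
  simp [map_sum, map_add, LinearMap.add_apply]

lemma killingForm_eq_zero {a b : D.cartan → ℂ} {x y : L} (hx : x ∈ rootSpace D.cartan a)
    (hy : y ∈ rootSpace D.cartan b) (hab : a + b ≠ 0) : killingForm ℂ L x y = 0 :=
  LieAlgebra.killingForm_apply_eq_zero_of_mem_rootSpace_of_add_ne_zero ℂ L D.cartan hx hy hab

lemma h_mem (i : Fin D.rank) : (D.h i : L) ∈ rootSpace D.cartan (0 : D.cartan → ℂ) :=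
  mem_rootSpace_zero (D.h i).2

/-- By orthonormality the Killing pairings with the h_i are the coordinates of t. -/
lemma sum_killing_h {t : L} (ht : t ∈ D.cartan) :
    ∑ i, killingForm ℂ L (D.h i) t • (D.h i : L) = t := by
  have h := D.h.sum_repr ⟨t, ht⟩
  have h' : t = ∑ j, D.h.repr ⟨t, ht⟩ j • (D.h j : L) := by
    have := congrArg D.cartan.subtype h
    rw [map_sum] at this
    exact this.symm
  have h2 : ∀ i, killingForm ℂ L (D.h i) t = D.h.repr ⟨t, ht⟩ i := by
    intro i
    conv_lhs => rw [h']
    simp [map_sum, D.killing_h]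
  simp only [h2]
  exact h'.symm

lemma sub_ne_zero_of_ne {α β : D.cartan.root} (h : α ≠ β) :
    (α.1 : D.cartan → ℂ) + -β.1 ≠ 0 := by
  intro e
  refine h (Subtype.ext (LieModule.Weight.ext fun x => ?_))
  have := congrFun e x
  simp only [Pi.add_apply, Pi.zero_apply, Pi.neg_apply] at this
  linear_combination this

lemma neg_ne_zero_of_root (α : D.cartan.root) : -(α.1 : D.cartan → ℂ) ≠ 0 :=
  neg_ne_zero.2 (ne_zero_of_root α)

/-- A root space is spanned by any of its nonzero elements. -/
lemma exists_smul_of_mem {a : D.cartan → ℂ} {α : LieModule.Weight ℂ D.cartan L} (hα : α.IsNonZero)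
    (ha : (α : D.cartan → ℂ) = a) {x e : L} (he : e ∈ rootSpace D.cartan a) (he0 : e ≠ 0)
    (hx : x ∈ rootSpace D.cartan a) : ∃ c : ℂ, x = c • e := by
  subst ha
  have h1 := IsKilling.finrank_rootSpace_eq_one α hα
  obtain ⟨c, hc⟩ := (finrank_eq_one_iff_of_nonzero' (⟨e, he⟩ : rootSpace D.cartan α)
    (fun h => he0 (congrArg Subtype.val h))).1 h1 ⟨x, hx⟩
  exact ⟨c, (congrArg Subtype.val hc).symm⟩

open Classical in
-- Weight spaces are Killing-orthogonal unless their weights add up to 0. A positive root cannot be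
-- cancelled by another positive root or by the weight 0.
lemma tensorOp_flip₂_nilradical {x : L} (hx : x ∈ D.nilradical) :
    tensorOp (flip₂ D.rSt) x = 0 := by
  refine nilradical_induction (p := fun x => tensorOp (flip₂ D.rSt) x = 0) (map_zero _)
    (fun x y hx hy => by rw [map_add, hx, hy, add_zero]) (fun β hβ y hy => ?_) hx
  rw [tensorOp_flip₂_rSt, Finset.sum_eq_zero, Finset.sum_eq_zero, smul_zero, add_zero]
  · intro α hα
    rw [killingForm_eq_zero (D.ep_mem α (Finset.mem_filter.1 hα).2) hy
      (add_ne_zero (Finset.mem_filter.1 hα).2 hβ), zero_smul]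
  · intro i _
    rw [killingForm_eq_zero (h_mem i) hy (by rw [zero_add]; exact ne_zero_of_root β), zero_smul]

open Classical in
lemma tensorOp_oppNilradical {x : L} (hx : x ∈ D.oppNilradical) :
    tensorOp D.rSt x = 0 := by
  refine oppNilradical_induction (p := fun x => tensorOp D.rSt x = 0) (map_zero _)
    (fun x y hx hy => by rw [map_add, hx, hy, add_zero]) (fun β hβ y hy => ?_) hx
  rw [tensorOp_rSt, Finset.sum_eq_zero, Finset.sum_eq_zero, smul_zero, add_zero]
  · intro α hα
    rw [killingForm_eq_zero (D.em_mem α (Finset.mem_filter.1 hα).2) hy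
      (by rw [← neg_add]; exact neg_ne_zero.2 (add_ne_zero (Finset.mem_filter.1 hα).2 hβ)),
      zero_smul]
  · intro i _
    rw [killingForm_eq_zero (h_mem i) hy (by rw [zero_add]; exact neg_ne_zero_of_root β),
      zero_smul]

open Classical in
-- Root spaces are lines, so y = c e_β. Only the term α = β survives, with coefficient ⟨e_{-β}, e_β⟩
-- = 1; this normalisation also shows that e_β is nonzero.
lemma tensorOp_nilradical {x : L} (hx : x ∈ D.nilradical) : tensorOp D.rSt x = x := by
  refine nilradical_induction (p := fun x => tensorOp D.rSt x = x) (map_zero _)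
    (fun x y hx hy => by rw [map_add, hx, hy]) (fun β hβ y hy => ?_) hx
  obtain ⟨c, rfl⟩ := exists_smul_of_mem (D.cartan.isNonZero_coe_root β) rfl (D.ep_mem β hβ)
    (fun h => by simpa [h] using D.killing_ep_em β hβ) hy
  rw [map_smul, tensorOp_rSt, Finset.sum_eq_zero, Finset.sum_eq_single β, smul_zero, zero_add,
    killingForm_comm, D.killing_ep_em β hβ, one_smul]
  · intro α hα hαβ
    rw [killingForm_comm, killingForm_eq_zero (D.ep_mem β hβ)
      (D.em_mem α (Finset.mem_filter.1 hα).2) (sub_ne_zero_of_ne (Ne.symm hαβ)), zero_smul]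
  · intro h
    exact absurd (Finset.mem_filter.2 ⟨Finset.mem_univ _, hβ⟩) h
  · intro i _
    rw [killingForm_eq_zero (h_mem i) (D.ep_mem β hβ)
      (by rw [zero_add]; exact ne_zero_of_root β), zero_smul]

open Classical in
lemma tensorOp_flip₂_oppNilradical {x : L} (hx : x ∈ D.oppNilradical) :
    tensorOp (flip₂ D.rSt) x = x := by
  refine oppNilradical_induction (p := fun x => tensorOp (flip₂ D.rSt) x = x) (map_zero _)
    (fun x y hx hy => by rw [map_add, hx, hy]) (fun β hβ y hy => ?_) hx
  obtain ⟨c, rfl⟩ := exists_smul_of_mem (α := -β.1)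
    (LieModule.Weight.isNonZero_neg.2 (D.cartan.isNonZero_coe_root β)) LieModule.Weight.coe_neg
    (D.em_mem β hβ) (fun h => by simpa [h] using D.killing_ep_em β hβ) hy
  rw [map_smul, tensorOp_flip₂_rSt, Finset.sum_eq_zero, Finset.sum_eq_single β, smul_zero,
    zero_add, D.killing_ep_em β hβ, one_smul]
  · intro α hα hαβ
    rw [killingForm_eq_zero (D.ep_mem α (Finset.mem_filter.1 hα).2) (D.em_mem β hβ)
      (sub_ne_zero_of_ne hαβ), zero_smul]
  · intro h
    exact absurd (Finset.mem_filter.2 ⟨Finset.mem_univ _, hβ⟩) h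
  · intro i _
    rw [killingForm_eq_zero (h_mem i) (D.em_mem β hβ)
      (by rw [zero_add]; exact neg_ne_zero_of_root β), zero_smul]

open Classical in
lemma tensorOp_cartan {x : L} (hx : x ∈ D.cartan) : tensorOp D.rSt x = (1 / 2 : ℂ) • x := by
  rw [tensorOp_rSt, sum_killing_h hx, Finset.sum_eq_zero, add_zero]
  intro α hα
  rw [killingForm_eq_zero (D.em_mem α (Finset.mem_filter.1 hα).2) (mem_rootSpace_zero hx)
    (by rw [add_zero]; exact neg_ne_zero_of_root α), zero_smul]

open Classical in
lemma tensorOp_flip₂_cartan {x : L} (hx : x ∈ D.cartan) :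
    tensorOp (flip₂ D.rSt) x = (1 / 2 : ℂ) • x := by
  rw [tensorOp_flip₂_rSt, sum_killing_h hx, Finset.sum_eq_zero, add_zero]
  intro α hα
  rw [killingForm_eq_zero (D.ep_mem α (Finset.mem_filter.1 hα).2) (mem_rootSpace_zero hx)
    (by rw [add_zero]; exact ne_zero_of_root α), zero_smul]

variable (D)

/-- The operators of r and r₂₁ act by 1 and 0 on 𝔫, by 1/2 and 1/2 on 𝔱, and by 0 and 1 on 𝔫₋. -/
lemma tensorOp_casimir : tensorOp (D.rSt + flip₂ D.rSt) = LinearMap.id := by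
  ext x
  obtain ⟨p, hp, t, ht, n, hn, rfl⟩ := exists_triangular (D := D) x
  simp only [map_add, LinearMap.add_apply, tensorOp_nilradical hp, tensorOp_flip₂_nilradical hp,
    tensorOp_cartan ht, tensorOp_flip₂_cartan ht, tensorOp_oppNilradical hn,
    tensorOp_flip₂_oppNilradical hn, LinearMap.id_apply]
  module

lemma cybTensor_rSt : cybTensor D.rSt D.rSt D.rSt = 0 := by
  refine cybTensor_eq_zero_of_modified (fun x => ?_) (modified_of_triangular _ D.nilradical
    D.cartan.toSubmodule D.oppNilradical exists_triangular
    (fun _ => tensorOp_flip₂_nilradical) (fun _ => tensorOp_flip₂_cartan)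
    (fun _ => tensorOp_flip₂_oppNilradical) (fun _ hp _ hq => lie_mem_nilradical hp hq)
    (fun _ hp _ hq => lie_mem_oppNilradical hp hq)
    (fun _ ht _ hp => lie_cartan_mem_nilradical ht hp)
    (fun _ ht _ hp => lie_cartan_mem_oppNilradical ht hp)
    (fun _ ht _ hs => lie_cartan_cartan ht hs))
  rw [← LinearMap.add_apply, ← map_add, tensorOp_casimir, LinearMap.id_apply]

lemma lie_casimir (x : L) : ⁅x, D.rSt + flip₂ D.rSt⁆ = 0 :=
  lie_eq_zero_of_tensorOp_eq_id D.tensorOp_casimir x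

/-- Invariance under all automorphisms, not merely under ad, gives Ad(g)-invariance at every point g
without any integration argument. -/
lemma map_casimir (e : L ≃ₗ⁅ℂ⁆ L) :
    TensorProduct.map (e : L →ₗ[ℂ] L) (e : L →ₗ[ℂ] L) (D.rSt + flip₂ D.rSt)
      = D.rSt + flip₂ D.rSt :=
  map_eq_self_of_tensorOp_eq_id D.tensorOp_casimir e

lemma isQuasitriangular_rSt : IsQuasitriangular D.rSt :=
  isQuasitriangular_of_cybTensor D.cybTensor_rSt D.lie_casimir

end StandardData

/-! ### Points, invariant vector fields and the adjoint action -/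

section Points

variable {A : Type*} [CommRing A]

/-- The points of an affine variety separate its regular functions. -/
lemma eq_zero_of_forall_algHom [Algebra ℂ A] [Algebra.FiniteType ℂ A] [IsReduced A] {f : A}
    (h : ∀ g : A →ₐ[ℂ] ℂ, g f = 0) : f = 0 := by
  have hJ : IsJacobsonRing A := isJacobsonRing_of_finiteType (A := ℂ)
  have hf : f ∈ (⊥ : Ideal A).jacobson := by
    rw [Ideal.jacobson, Submodule.mem_sInf]
    rintro M ⟨-, hM⟩
    let _ : Field (A ⧸ M) := Ideal.Quotient.field M
    -- Residue fields are finite over ℂ, hence equal to ℂ, so each maximal ideal is the kernel of a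
    -- point.
    have hfin : Module.Finite ℂ (A ⧸ M) := finite_of_finite_type_of_isJacobsonRing ℂ (A ⧸ M)
    let e := AlgEquiv.ofBijective (Algebra.ofId ℂ (A ⧸ M))
      (IsAlgClosed.algebraMap_bijective_of_isIntegral (k := ℂ) (K := A ⧸ M))
    have := h (e.symm.toAlgHom.comp (Ideal.Quotient.mkₐ ℂ M))
    have h0 : e.symm (Ideal.Quotient.mk M f) = 0 := this
    rw [EmbeddingLike.map_eq_zero_iff] at h0
    exact Ideal.Quotient.eq_zero_iff_mem.1 h0
  rw [hJ.out (Ideal.isRadical_bot_iff.2 inferInstance)] at hf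
  simpa using hf

variable [HopfAlgebra ℂ A]

lemma counit_eq_one_apply (f : A) : (1 : Pt A).ofConv f = Coalgebra.counit (R := ℂ) f := by
  simp

lemma comul_rightTrans (g : Pt A) (f : A) :
    Coalgebra.comul (R := ℂ) (rightTrans g f)
      = (rightTrans g).toLinearMap.lTensor A (Coalgebra.comul f) := by
  have key : ∀ u : A ⊗[ℂ] A, Coalgebra.comul (R := ℂ) (TensorProduct.rid ℂ A
      (g.ofConv.toLinearMap.lTensor A u))
      = (TensorProduct.rid ℂ A ∘ₗ g.ofConv.toLinearMap.lTensor A).lTensor A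
          (TensorProduct.assoc ℂ A A A ((Coalgebra.comul (R := ℂ) (A := A)).rTensor A u)) := by
    intro u
    induction u with
    | zero => simp
    | add u v hu hv => simp only [map_add, hu, hv]
    | tmul a b =>
      simp only [LinearMap.lTensor_tmul, TensorProduct.rid_tmul, map_smul, LinearMap.rTensor_tmul]
      generalize (Coalgebra.comul a : A ⊗[ℂ] A) = w
      induction w with
      | zero => simp
      | add u v hu hv => simp only [map_add, smul_add, hu, hv, TensorProduct.add_tmul]
      | tmul c d => simp
  have h := key (Coalgebra.comul f)
  rw [Coalgebra.coassoc_apply, ← LinearMap.lTensor_comp_apply] at h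
  exact h

lemma map_leftTrans_field (x : lieAlg A) (p : Pt A) (f : A) :
    leftTrans p (x.1 f) = x.1 (leftTrans p f) := by
  have h := LinearMap.congr_fun x.2 f
  simp only [LinearMap.comp_apply] at h
  simp only [leftTrans, AlgHom.comp_apply, Bialgebra.comulAlgHom_apply]
  rw [show (Coalgebra.comul (x.1 f) : A ⊗[ℂ] A) = _ from h]
  generalize (Coalgebra.comul f : A ⊗[ℂ] A) = u
  induction u with
  | zero => simp
  | add u v hu hv => simp only [map_add, hu, hv]
  | tmul a b => simp

lemma apply_rightField (x : lieAlg A) (p : Pt A) (f : A) :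
    p.ofConv (rightField A x f) = tangent x (rightTrans p f) := by
  change p.ofConv (rightMap x f) = _
  simp only [rightMap, rightTrans, AlgHom.comp_apply, Bialgebra.comulAlgHom_apply,
    LinearMap.comp_apply]
  generalize (Coalgebra.comul f : A ⊗[ℂ] A) = u
  induction u with
  | zero => simp
  | add u v hu hv => simp only [map_add, hu, hv]
  | tmul a b => simp [mul_comm]

lemma apply_leftField (x : lieAlg A) (p : Pt A) (f : A) :
    p.ofConv (leftField A x f) = tangent x (leftTrans p f) := by
  change p.ofConv (x.1 f) = _
  rw [tangent_apply, ← map_leftTrans_field, ← counit_eq_one_apply, apply_leftTrans, mul_one]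

/-- The field x^L acts through the second leg of the comultiplication and y^R through the first. -/
lemma leftField_rightField (x y : lieAlg A) (f : A) :
    leftField A x (rightField A y f) = rightField A y (leftField A x f) := by
  change x.1 (rightMap y f) = rightMap y (x.1 f)
  have h := LinearMap.congr_fun x.2 f
  simp only [LinearMap.comp_apply] at h
  simp only [rightMap, LinearMap.comp_apply]
  rw [show (Coalgebra.comul (x.1 f) : A ⊗[ℂ] A) = _ from h]
  generalize (Coalgebra.comul f : A ⊗[ℂ] A) = u
  induction u with
  | zero => simp
  | add u v hu hv => simp only [map_add, hu, hv]
  | tmul a b => simp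

lemma leftField_lie (x y : lieAlg A) : leftField A ⁅x, y⁆ = ⁅leftField A x, leftField A y⁆ := rfl

lemma lie_leftField_rightField (x y : lieAlg A) : ⁅leftField A x, rightField A y⁆ = 0 := by
  ext f
  rw [Derivation.commutator_apply, leftField_rightField, sub_self]; rfl

variable [Algebra.FiniteType ℂ A] [IsDomain A]

/-- A domain is reduced, so by the Nullstellensatz identities in ℂ[G] can be checked at points. -/
lemma eq_of_forall_pt {f h : A} (H : ∀ p : Pt A, p.ofConv f = p.ofConv h) : f = h := by
  rw [← sub_eq_zero]
  refine eq_zero_of_forall_algHom fun g => ?_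
  have := H (WithConv.toConv g)
  rw [map_sub, sub_eq_zero]
  exact this

lemma rightTrans_rightTrans (p q : Pt A) (f : A) :
    rightTrans p (rightTrans q f) = rightTrans (p * q) f :=
  eq_of_forall_pt fun g => by simp only [apply_rightTrans, mul_assoc]

@[simp] lemma rightTrans_one (f : A) : rightTrans (1 : Pt A) f = f :=
  eq_of_forall_pt fun g => by simp only [apply_rightTrans, mul_one]

lemma leftTrans_rightTrans (p q : Pt A) (f : A) :
    leftTrans p (rightTrans q f) = rightTrans q (leftTrans p f) :=
  eq_of_forall_pt fun g => by simp only [apply_leftTrans, apply_rightTrans, mul_assoc]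

lemma map_rightTrans_field (x : lieAlg A) (p : Pt A) (f : A) :
    rightTrans p (rightField A x f) = rightField A x (rightTrans p f) :=
  eq_of_forall_pt fun g => by
    rw [apply_rightTrans, apply_rightField, apply_rightField, rightTrans_rightTrans]

lemma counit_rightField (x : lieAlg A) (f : A) :
    Coalgebra.counit (R := ℂ) (rightField A x f) = tangent x f := by
  rw [← counit_eq_one_apply, apply_rightField, rightTrans_one]

/-- Right invariance reduces (x^R y^R f)(p) to the identity, where left and right fields agree. As
x^L and y^R commute, the value is that of y^L x^L on f(· p): the order is reversed. -/
lemma rightField_lie (x y : lieAlg A) :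
    rightField A ⁅x, y⁆ = -⁅rightField A x, rightField A y⁆ := by
  have h : ∀ (x y : lieAlg A) (p : Pt A) (f : A), p.ofConv (rightField A x (rightField A y f))
      = Coalgebra.counit (R := ℂ) (y.1 (x.1 (rightTrans p f))) := by
    intro x y p f
    rw [apply_rightField, map_rightTrans_field, tangent_apply,
      show x.1 (rightField A y (rightTrans p f)) = _ from leftField_rightField x y _,
      counit_rightField]
    rfl
  ext f
  refine eq_of_forall_pt fun p => ?_
  rw [Derivation.coe_neg, Pi.neg_apply, Derivation.commutator_apply, map_neg, map_sub, h, h,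
    apply_rightField, tangent_apply, LieSubalgebra.coe_bracket, Derivation.commutator_apply,
    map_sub]
  ring

/-- The conjugate of a left invariant vector field by a right translation. -/
def conjField (g : Pt A) (x : lieAlg A) : lieAlg A :=
  ⟨Derivation.mk' ((rightTrans g⁻¹).toLinearMap ∘ₗ (x.1 : A →ₗ[ℂ] A) ∘ₗ (rightTrans g).toLinearMap)
    (fun a b => by
      simp [rightTrans_rightTrans]), by
    ext f
    have h := LinearMap.congr_fun x.2 (rightTrans g f)
    simp only [LinearMap.comp_apply] at h
    change Coalgebra.comul (R := ℂ) (rightTrans g⁻¹ (x.1 (rightTrans g f)))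
      = LinearMap.lTensor A _ (Coalgebra.comul f)
    rw [comul_rightTrans]
    refine (congrArg _ h).trans ?_
    rw [comul_rightTrans, ← LinearMap.lTensor_comp_apply, ← LinearMap.lTensor_comp_apply]
    rfl⟩

lemma conjField_apply (g : Pt A) (x : lieAlg A) (f : A) :
    (conjField g x).1 f = rightTrans g⁻¹ (x.1 (rightTrans g f)) := rfl

lemma conjField_inv (g : Pt A) (x : lieAlg A) : conjField g⁻¹ (conjField g x) = x := by
  ext f
  simp [conjField_apply, rightTrans_rightTrans]

/-- The adjoint action of `g⁻¹` on the Lie algebra of `G`. -/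
def adInv (g : Pt A) : lieAlg A ≃ₗ⁅ℂ⁆ lieAlg A where
  toFun := conjField g
  invFun := conjField g⁻¹
  map_add' x y := by ext f; simp [conjField_apply]
  map_smul' c x := by ext f; simp [conjField_apply]
  map_lie' {x y} := by
    ext f
    simp [conjField_apply, rightTrans_rightTrans, Derivation.commutator_apply]
  left_inv := conjField_inv g
  right_inv x := by simpa using conjField_inv g⁻¹ x

/-- Both sides are the derivative at t = 0 of f(exp(tx) g) = f(g exp(t Ad(g⁻¹)x)). -/
lemma apply_leftField_adInv (g : Pt A) (x : lieAlg A) (f : A) :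
    g.ofConv (leftField A (adInv g x) f) = g.ofConv (rightField A x f) := by
  change g.ofConv (rightTrans g⁻¹ (x.1 (rightTrans g f))) = _
  rw [apply_rightTrans, mul_inv_cancel, counit_eq_one_apply, apply_rightField]
  rfl

lemma act₂_apply_adInv (g : Pt A) (t : lieAlg A ⊗[ℂ] lieAlg A) (f h : A) :
    g.ofConv (act₂ (leftField A) (TensorProduct.map (adInv g : lieAlg A →ₗ[ℂ] lieAlg A)
        (adInv g : lieAlg A →ₗ[ℂ] lieAlg A) t) f h)
      = g.ofConv (act₂ (rightField A) t f h) := by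
  induction t with
  | zero => simp
  | add u v hu hv => simp only [map_add, LinearMap.add_apply, hu, hv]
  | tmul x y =>
    simp only [TensorProduct.map_tmul, act₂_tmul, map_mul]
    congr 1
    · exact apply_leftField_adInv g x f
    · exact apply_leftField_adInv g y h

lemma skewPart_eq {V : Type*} [AddCommGroup V] [Module ℂ V] (t : V ⊗[ℂ] V) :
    skewPart t = t - (1 / 2 : ℂ) • (t + flip₂ t) := by
  rw [skewPart]; module

variable [LieAlgebra.IsSemisimple ℂ (lieAlg A)] (D : StandardData (lieAlg A))

namespace StandardData

/-- At g the right invariant extension of Ω is the left invariant extension of Ad(g⁻¹)Ω, and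
Ad(g⁻¹)Ω = Ω. -/
lemma act₂_casimir : act₂ (leftField A) (D.rSt + flip₂ D.rSt)
    = act₂ (rightField A) (D.rSt + flip₂ D.rSt) := by
  refine LinearMap.ext fun f => LinearMap.ext fun h => eq_of_forall_pt fun g => ?_
  rw [← act₂_apply_adInv, D.map_casimir]

/-- The symmetric part Ω/2 cancels between left and right. The gain is that r satisfies the CYBE,
which is not available for Λ. -/
lemma groupBracket_eq : groupBracket D.rSt
    = act₂ (leftField A) D.rSt - act₂ (rightField A) D.rSt := by
  rw [groupBracket, skewPart_eq, map_sub, map_sub, map_smul, map_smul, act₂_casimir]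
  abel

lemma isPoissonBracket_groupBracket : IsPoissonBracket (groupBracket (A := A) D.rSt) := by
  have hself : ∀ f : A, groupBracket D.rSt f f = 0 := fun f => by
    rw [groupBracket, LinearMap.sub_apply, LinearMap.sub_apply, act₂_skewPart_self,
      act₂_skewPart_self, sub_zero]
  rw [groupBracket_eq] at hself ⊢
  exact isPoissonBracket_of_cybTensor _ _ leftField_lie rightField_lie lie_leftField_rightField
    D.cybTensor_rSt hself

end StandardData

lemma leftTrans_act₂ (p : Pt A) (t : lieAlg A ⊗[ℂ] lieAlg A) (f h : A) :
    leftTrans p (act₂ (leftField A) t f h)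
      = act₂ (leftField A) t (leftTrans p f) (leftTrans p h) := by
  induction t with
  | zero => simp
  | add u v hu hv => simp only [map_add, LinearMap.add_apply, hu, hv]
  | tmul x y =>
    simp only [act₂_tmul, map_mul]
    congr 1
    · exact map_leftTrans_field x p f
    · exact map_leftTrans_field y p h

lemma rightTrans_act₂ (p : Pt A) (t : lieAlg A ⊗[ℂ] lieAlg A) (f h : A) :
    rightTrans p (act₂ (rightField A) t f h)
      = act₂ (rightField A) t (rightTrans p f) (rightTrans p h) := by
  induction t with
  | zero => simp
  | add u v hu hv => simp only [map_add, LinearMap.add_apply, hu, hv]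
  | tmul x y => simp only [act₂_tmul, map_mul, map_rightTrans_field]

/-- `d/dt f(p exp(t x) g)`, computed in two ways. -/
lemma apply_leftField_rightTrans (p g : Pt A) (x : lieAlg A) (f : A) :
    p.ofConv (leftField A x (rightTrans g f)) = g.ofConv (rightField A x (leftTrans p f)) := by
  rw [apply_leftField, apply_rightField, leftTrans_rightTrans]

lemma apply_act₂_rightTrans (p g : Pt A) (t : lieAlg A ⊗[ℂ] lieAlg A) (f h : A) :
    p.ofConv (act₂ (leftField A) t (rightTrans g f) (rightTrans g h))
      = g.ofConv (act₂ (rightField A) t (leftTrans p f) (leftTrans p h)) := by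
  induction t with
  | zero => simp
  | add u v hu hv => simp only [map_add, LinearMap.add_apply, hu, hv]
  | tmul x y => simp only [act₂_tmul, map_mul, apply_leftField_rightTrans]

/-- The left invariant term at p and the right invariant term at g both differentiate between the
factors of the product pg, so they cancel; the other two terms form the bracket at pg. -/
lemma StandardData.isPoissonLieGroup : IsPoissonLieGroup (groupBracket (A := A) D.rSt) := by
  refine ⟨D.isPoissonBracket_groupBracket, fun p g f h => ?_⟩
  simp only [groupBracket, LinearMap.sub_apply, map_sub]
  rw [apply_act₂_rightTrans, ← leftTrans_act₂, ← rightTrans_act₂, apply_leftTrans,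
    apply_rightTrans]
  ring

end Points

/-! ### The exponential map, and functions invariant under a unipotent subgroup -/

/-- Uniqueness of power series coefficients, applied to a constant function of t. -/
lemma coeff_eq_zero_of_hasSum_const {c : ℕ → ℂ} {a : ℂ}
    (h : ∀ t : ℂ, HasSum (fun k => t ^ k * c k) a) {k : ℕ} (hk : k ≠ 0) : c k = 0 := by
  have h1 : HasFPowerSeriesAt (fun _ : ℂ => a) (FormalMultilinearSeries.ofScalars ℂ c) 0 := by
    rw [hasFPowerSeriesAt_iff]
    exact Filter.Eventually.of_forall fun t => by simpa using h t
  have h2 := h1.eq_formalMultilinearSeries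
    (hasFPowerSeriesAt_const (𝕜 := ℂ) (E := ℂ) (c := a) (e := (0 : ℂ)))
  have h3 := congrArg (fun p => p.coeff k) h2
  obtain ⟨n, rfl⟩ := Nat.exists_eq_succ_of_ne_zero hk
  simp only [FormalMultilinearSeries.coeff_ofScalars] at h3
  rw [h3]
  rfl

/-- The values of the powers of an endomorphism of a finite dimensional space grow at most
geometrically. -/
lemma exists_norm_pow_le {W : Type*} [AddCommGroup W] [Module ℂ W] [FiniteDimensional ℂ W]
    (T : W →ₗ[ℂ] W) (φ : W →ₗ[ℂ] ℂ) (w : W) :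
    ∃ C R : ℝ, ∀ k : ℕ, ‖φ ((T ^ k) w)‖ ≤ C * R ^ k := by
  let e := (Module.finBasis ℂ W).equivFun
  let T' := LinearMap.toContinuousLinearMap (e.toLinearMap ∘ₗ T ∘ₗ e.symm.toLinearMap)
  let φ' := LinearMap.toContinuousLinearMap (φ ∘ₗ e.symm.toLinearMap)
  have h : ∀ k : ℕ, (T ^ k) w = e.symm ((T' ^ k) (e w)) := by
    intro k
    induction k with
    | zero => simp
    | succ k ih => simp [pow_succ', ih, T']
  refine ⟨‖φ'‖ * ‖e w‖, ‖T'‖, fun k => ?_⟩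
  rw [h]
  calc ‖φ' ((T' ^ k) (e w))‖ ≤ ‖φ'‖ * (‖T'‖ ^ k * ‖e w‖) := by
        refine (φ'.le_opNorm _).trans ?_
        gcongr
        induction k with
        | zero => simp
        | succ k ih =>
          rw [pow_succ', mul_apply_eq_comp]
          refine (T'.le_opNorm _).trans ?_
          rw [pow_succ', mul_assoc]
          gcongr
    _ = _ := by ring

section Leibniz

variable {B : Type*} [CommRing B] [Algebra ℂ B]

lemma derivation_pow_mul (D : Derivation ℂ B B) (n : ℕ) (a b : B) :
    ((D : B →ₗ[ℂ] B) ^ n) (a * b) = ∑ ij ∈ Finset.HasAntidiagonal.antidiagonal n,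
      n.choose ij.1 • (((D : B →ₗ[ℂ] B) ^ ij.1) a * ((D : B →ₗ[ℂ] B) ^ ij.2) b) := by
  induction n with
  | zero => simp
  | succ n ih =>
    rw [Finset.sum_antidiagonal_choose_succ_nsmul
      (fun i j => ((D : B →ₗ[ℂ] B) ^ i) a * ((D : B →ₗ[ℂ] B) ^ j) b) n]
    simp only [pow_succ', Module.End.mul_apply, ih, map_sum, map_nsmul, Derivation.coeFn_coe,
      Derivation.leibniz, smul_eq_mul, smul_add, Finset.sum_add_distrib, add_right_inj]
    refine Finset.sum_congr rfl fun ⟨i, j⟩ hij => ?_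
    rw [n.choose_symm_of_eq_add (Finset.HasAntidiagonal.mem_antidiagonal.1 hij).symm, mul_comm]

end Leibniz

section Exp

variable {A : Type*} [CommRing A] [HopfAlgebra ℂ A]

/-- The Taylor coefficients `f ↦ ((x^L)^k f)(e) / k!`. -/
def expCoeff (x : lieAlg A) (k : ℕ) : A →ₗ[ℂ] ℂ :=
  ((k.factorial : ℂ))⁻¹ • (Coalgebra.counit ∘ₗ ((x.1 : A →ₗ[ℂ] A) ^ k))

lemma expCoeff_apply (x : lieAlg A) (k : ℕ) (f : A) : expCoeff x k f
    = ((k.factorial : ℂ))⁻¹ * Coalgebra.counit (((x.1 : A →ₗ[ℂ] A) ^ k) f) := rfl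

lemma expCoeff_smul (t : ℂ) (x : lieAlg A) (k : ℕ) (f : A) :
    expCoeff (t • x) k f = t ^ k * expCoeff x k f := by
  have : (((t • x : lieAlg A).1 : A →ₗ[ℂ] A)) = t • (x.1 : A →ₗ[ℂ] A) := rfl
  rw [expCoeff_apply, expCoeff_apply, this, smul_pow]
  simp
  ring

/-- With the Cauchy product of series, this makes the exponential multiplicative, hence a point of
G. -/
lemma expCoeff_mul (x : lieAlg A) (n : ℕ) (f g : A) : expCoeff x n (f * g)
    = ∑ ij ∈ Finset.HasAntidiagonal.antidiagonal n, expCoeff x ij.1 f * expCoeff x ij.2 g := by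
  rw [expCoeff_apply, derivation_pow_mul, map_sum, Finset.mul_sum]
  refine Finset.sum_congr rfl fun ⟨i, j⟩ hij => ?_
  have hij' := Finset.HasAntidiagonal.mem_antidiagonal.1 hij
  simp only at hij'
  subst hij'
  simp only [expCoeff_apply]
  rw [← Nat.cast_smul_eq_nsmul ℂ, map_smul, smul_eq_mul, Bialgebra.counit_mul,
    Nat.choose_symm_add, Nat.add_choose, Nat.cast_div (Nat.factorial_mul_factorial_dvd_factorial_add i j)
    (by exact_mod_cast mul_ne_zero i.factorial_ne_zero j.factorial_ne_zero)]
  have h1 : ((i + j).factorial : ℂ) ≠ 0 := by exact_mod_cast (i + j).factorial_ne_zero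
  have h2 : (i.factorial : ℂ) ≠ 0 := by exact_mod_cast i.factorial_ne_zero
  have h3 : (j.factorial : ℂ) ≠ 0 := by exact_mod_cast j.factorial_ne_zero
  push_cast
  field_simp

lemma comul_pow (x : lieAlg A) (k : ℕ) : Coalgebra.comul ∘ₗ ((x.1 : A →ₗ[ℂ] A) ^ k)
    = (((x.1 : A →ₗ[ℂ] A) ^ k)).lTensor A ∘ₗ Coalgebra.comul := by
  induction k with
  | zero => ext; simp [Module.End.one_eq_id]
  | succ k ih =>
    rw [pow_succ, Module.End.mul_eq_comp, ← LinearMap.comp_assoc, ih, LinearMap.comp_assoc, x.2,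
      LinearMap.lTensor_comp, LinearMap.comp_assoc]

lemma pow_apply_eq (x : lieAlg A) (k : ℕ) (f : A) : ((x.1 : A →ₗ[ℂ] A) ^ k) f
    = TensorProduct.rid ℂ A ((Coalgebra.counit ∘ₗ ((x.1 : A →ₗ[ℂ] A) ^ k)).lTensor A
        (Coalgebra.comul f)) := by
  have h := LinearMap.congr_fun (comul_pow x k) f
  have h' := congrArg (fun t => TensorProduct.rid ℂ A
    ((Coalgebra.counit (R := ℂ) (A := A)).lTensor A t)) h
  simp only [LinearMap.comp_apply, Coalgebra.lTensor_counit_comul] at h'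
  rw [LinearMap.lTensor_comp, LinearMap.comp_apply]
  simpa using h'

/-- Local finiteness: applying (x^L)^k only changes the scalars obtained from the second leg of Δf,
so all the results lie in the span of the finitely many first legs. -/
lemma finiteDimensional_span_pow (x : lieAlg A) (f : A) :
    FiniteDimensional ℂ (Submodule.span ℂ (Set.range fun k : ℕ => ((x.1 : A →ₗ[ℂ] A) ^ k) f)) := by
  obtain ⟨S, hS⟩ := TensorProduct.exists_finset (Coalgebra.comul (R := ℂ) f)
  have hfin : FiniteDimensional ℂ (Submodule.span ℂ (Prod.fst '' (S : Set (A × A)))) :=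
    FiniteDimensional.span_of_finite ℂ (S.finite_toSet.image _)
  refine Submodule.finiteDimensional_of_le (S₂ := Submodule.span ℂ (Prod.fst '' (S : Set (A × A))))
    (Submodule.span_le.2 ?_)
  rintro _ ⟨k, rfl⟩
  simp only [SetLike.mem_coe]
  rw [pow_apply_eq, hS, map_sum, map_sum]
  refine Submodule.sum_mem _ fun i hi => ?_
  rw [LinearMap.lTensor_tmul, TensorProduct.rid_tmul]
  exact Submodule.smul_mem _ _ (Submodule.subset_span ⟨i, hi, rfl⟩)

/-- On the finite dimensional span of the iterates the numerators grow at most geometrically, and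
the factorial dominates. -/
lemma summable_norm_expCoeff (x : lieAlg A) (f : A) : Summable fun k => ‖expCoeff x k f‖ := by
  let W := Submodule.span ℂ (Set.range fun k : ℕ => ((x.1 : A →ₗ[ℂ] A) ^ k) f)
  have hfin : FiniteDimensional ℂ W := finiteDimensional_span_pow x f
  have hW : ∀ w ∈ W, (x.1 : A →ₗ[ℂ] A) w ∈ W := by
    intro w hw
    induction hw using Submodule.span_induction with
    | mem w hw =>
      obtain ⟨k, rfl⟩ := hw
      refine Submodule.subset_span ⟨k + 1, ?_⟩
      simp [pow_succ']
    | zero => rw [map_zero]; exact W.zero_mem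
    | add u v _ _ hu hv => rw [map_add]; exact W.add_mem hu hv
    | smul c u _ hu => rw [map_smul]; exact W.smul_mem c hu
  have hf : f ∈ W := Submodule.subset_span ⟨0, by simp⟩
  obtain ⟨C, R, h⟩ := exists_norm_pow_le ((x.1 : A →ₗ[ℂ] A).restrict hW)
    (Coalgebra.counit ∘ₗ W.subtype) ⟨f, hf⟩
  refine Summable.of_nonneg_of_le (fun _ => norm_nonneg _) (fun k => ?_)
    ((Real.summable_pow_div_factorial R).mul_left C)
  have hk := h k
  rw [Module.End.pow_restrict] at hk
  have : ‖Coalgebra.counit (R := ℂ) (((x.1 : A →ₗ[ℂ] A) ^ k) f)‖ ≤ C * R ^ k := hk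
  rw [expCoeff_apply, norm_mul, norm_inv, Complex.norm_natCast, mul_comm, ← div_eq_mul_inv,
    ← mul_div_assoc]
  gcongr

/-- Every element of the Lie algebra has an exponential. -/
lemma exists_isExp (x : lieAlg A) : ∃ g : Pt A, IsExp x g := by
  have hs : ∀ f, Summable fun k => expCoeff x k f := fun f => (summable_norm_expCoeff x f).of_norm
  let E : A →ₗ[ℂ] ℂ :=
    { toFun := fun f => ∑' k, expCoeff x k f
      map_add' := fun f g => by simp only [map_add]; exact (hs f).tsum_add (hs g)
      map_smul' := fun c f => by simp only [map_smul, smul_eq_mul, RingHom.id_apply]; exact tsum_mul_left }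
  refine ⟨WithConv.toConv (AlgHom.ofLinearMap E ?_ fun f g => ?_), fun f => (hs f).hasSum⟩
  · change ∑' k, expCoeff x k 1 = 1
    rw [tsum_eq_single 0]
    · simp [expCoeff_apply]
    · intro k hk
      obtain ⟨n, rfl⟩ := Nat.exists_eq_succ_of_ne_zero hk
      simp [expCoeff_apply, pow_succ]
  · change ∑' k, expCoeff x k (f * g) = (∑' k, expCoeff x k f) * ∑' k, expCoeff x k g
    simp only [expCoeff_mul]
    exact (tsum_mul_tsum_eq_tsum_sum_antidiagonal_of_summable_norm
      (summable_norm_expCoeff x f) (summable_norm_expCoeff x g)).symm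

lemma exists_pt_hasSum (x : lieAlg A) (t : ℂ) : ∃ g : Pt A, IsExp (t • x) g ∧
    ∀ f, HasSum (fun k => t ^ k * expCoeff x k f) (g.ofConv f) := by
  obtain ⟨g, hg⟩ := exists_isExp (t • x)
  refine ⟨g, hg, fun f => ?_⟩
  simp only [← expCoeff_smul]
  exact hg f

lemma expCoeff_one (x : lieAlg A) (f : A) : expCoeff x 1 f = tangent x f := by
  simp [expCoeff_apply, tangent_apply]

variable [Algebra.FiniteType ℂ A] [IsDomain A]

/-- If f is invariant, t ↦ f(exp(tx)p) is constant and its linear coefficient is (x^R f)(p).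
Conversely, x^R f = 0 kills all Taylor coefficients of positive order. Existence of exponentials is
essential for the first direction. -/
lemma mem_quotientRing_integralSubgroup {𝔫 : Submodule ℂ (lieAlg A)} {f : A} :
    f ∈ quotientRing (integralSubgroup 𝔫) ↔ ∀ x ∈ 𝔫, rightField A x f = 0 := by
  constructor
  · intro hf x hx
    refine eq_of_forall_pt fun p => ?_
    rw [map_zero, apply_rightField, ← expCoeff_one]
    refine coeff_eq_zero_of_hasSum_const (c := fun k => expCoeff x k (rightTrans p f))
      (a := p.ofConv f) (fun t => ?_) one_ne_zero
    obtain ⟨g, hg, hsum⟩ := exists_pt_hasSum x t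
    have h := hf g (Subgroup.subset_closure ⟨t • x, 𝔫.smul_mem t hx, hg⟩) p
    rw [← h, ← apply_rightTrans]
    exact hsum _
  · intro hf n hn
    induction hn using Subgroup.closure_induction with
    | mem n hn =>
      obtain ⟨x, hx, hexp⟩ := hn
      intro g
      rw [← apply_rightTrans]
      have h0 : rightField A x (rightTrans g f) = 0 := by
        rw [← map_rightTrans_field, hf x hx, map_zero]
      -- Since x^L and x^R commute, x^R kills every iterate; as the two fields agree at the
      -- identity, the coefficients of order k > 0 vanish.
      have hk : ∀ k : ℕ, rightField A x (((x.1 : A →ₗ[ℂ] A) ^ k) (rightTrans g f)) = 0 := by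
        intro k
        induction k with
        | zero => simpa using h0
        | succ k ih =>
          rw [pow_succ', Module.End.mul_apply]
          refine (leftField_rightField x x _).symm.trans ?_
          rw [ih, map_zero]
      refine (hexp (rightTrans g f)).unique ?_
      have h1 : g.ofConv f = ((Nat.factorial 0 : ℕ) : ℂ)⁻¹
          * Coalgebra.counit (R := ℂ) (((x.1 : A →ₗ[ℂ] A) ^ 0) (rightTrans g f)) := by
        rw [← counit_eq_one_apply]
        simp [-AlgHom.convOne_apply, apply_rightTrans]
      rw [h1]
      refine hasSum_single 0 fun k hk0 => ?_
      obtain ⟨n, rfl⟩ := Nat.exists_eq_succ_of_ne_zero hk0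
      rw [Nat.succ_eq_add_one, pow_succ', Module.End.mul_apply]
      have := counit_rightField x (((x.1 : A →ₗ[ℂ] A) ^ n) (rightTrans g f))
      rw [hk, map_zero, tangent_apply] at this
      rw [Derivation.coeFn_coe, ← this, mul_zero]
    | one => intro g; rw [one_mul]
    | mul a b _ _ ha hb => intro g; rw [mul_assoc, ha, hb]
    | inv a _ ha => intro g; rw [← ha, mul_inv_cancel_left]

end Exp

/-! ### Derivations and brackets on tensor powers -/

section TensorPower

variable {B : Type*} [CommRing B] [Algebra ℂ B]
variable {V : Type*} [AddCommGroup V] [Module ℂ V]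
variable {m : ℕ}

lemma linearMap_ext_tprod {M : Type*} [AddCommGroup M] [Module ℂ M] {φ ψ : Pow B m →ₗ[ℂ] M}
    (h : ∀ f : Fin m → B, φ (PiTensorProduct.tprod ℂ f) = ψ (PiTensorProduct.tprod ℂ f)) : φ = ψ :=
  PiTensorProduct.ext (MultilinearMap.ext h)

lemma bilinearMap_ext_tprod {M : Type*} [AddCommGroup M] [Module ℂ M]
    {φ ψ : Pow B m →ₗ[ℂ] Pow B m →ₗ[ℂ] M}
    (h : ∀ f g : Fin m → B, φ (PiTensorProduct.tprod ℂ f) (PiTensorProduct.tprod ℂ g)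
      = ψ (PiTensorProduct.tprod ℂ f) (PiTensorProduct.tprod ℂ g)) : φ = ψ :=
  linearMap_ext_tprod fun f => linearMap_ext_tprod fun g => h f g

lemma derivation_ext_tprod {D D' : Derivation ℂ (Pow B m) (Pow B m)}
    (h : ∀ f : Fin m → B, D (PiTensorProduct.tprod ℂ f) = D' (PiTensorProduct.tprod ℂ f)) :
    D = D' := by
  have : (D : Pow B m →ₗ[ℂ] Pow B m) = D' := linearMap_ext_tprod h
  ext F
  exact LinearMap.congr_fun this F

@[simp] lemma slot_zero (j : Fin m) : slot m j (0 : Derivation ℂ B B) = 0 :=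
  derivation_ext_tprod fun f => by
    rw [slot_tprod, Derivation.coe_zero, Pi.zero_apply, Derivation.coe_zero, Pi.zero_apply]
    exact MultilinearMap.map_update_zero _ _ _

@[simp] lemma slot_neg (j : Fin m) (D : Derivation ℂ B B) : slot m j (-D) = -slot m j D :=
  derivation_ext_tprod fun f => by
    rw [slot_tprod, Derivation.coe_neg, Derivation.coe_neg, Pi.neg_apply, Pi.neg_apply, slot_tprod,
      MultilinearMap.map_update_neg]

lemma lie_slot (j k : Fin m) (D D' : Derivation ℂ B B) :
    ⁅slot m j D, slot m k D'⁆ = if j = k then slot m j ⁅D, D'⁆ else 0 := by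
  refine derivation_ext_tprod fun f => ?_
  rw [Derivation.commutator_apply, slot_tprod, slot_tprod, slot_tprod, slot_tprod]
  by_cases h : j = k
  · subst h
    simp only [if_true, Function.update_self, Function.update_idem, slot_tprod,
      Derivation.commutator_apply]
    rw [MultilinearMap.map_update_sub]
  · rw [if_neg h, Function.update_of_ne h, Function.update_of_ne (Ne.symm h),
      Function.update_comm h, sub_self]
    rfl

lemma powAction_apply (ρ : V →ₗ[ℂ] Derivation ℂ B B) (x : Fin m → V) :
    powAction m ρ x = ∑ j, slot m j (ρ (x j)) := rfl

lemma powAction_single (ρ : V →ₗ[ℂ] Derivation ℂ B B) (k : Fin m) (x : V) :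
    powAction m ρ (Pi.single k x) = slot m k (ρ x) := by
  rw [powAction_apply, Finset.sum_eq_single k]
  · rw [Pi.single_eq_same]
  · intro j _ hj
    rw [Pi.single_eq_of_ne hj, map_zero, slot_zero]
  · intro h; exact absurd (Finset.mem_univ k) h

lemma derivation_sum_apply {ι : Type*} (s : Finset ι) (D : ι → Derivation ℂ B B) (f : B) :
    (∑ i ∈ s, D i) f = ∑ i ∈ s, D i f := by
  induction s using Finset.cons_induction with
  | empty => simp
  | cons i s hi ih => simp only [Finset.sum_cons, Derivation.coe_add, Pi.add_apply, ih]

lemma lie_powAction (ρ ρ' : V →ₗ[ℂ] Derivation ℂ B B) (x y : Fin m → V) :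
    ⁅powAction m ρ x, powAction m ρ' y⁆ = ∑ j, slot m j ⁅ρ (x j), ρ' (y j)⁆ := by
  ext F
  have h : ∀ j k : Fin m, slot m j (ρ (x j)) (slot m k (ρ' (y k)) F)
      - slot m k (ρ' (y k)) (slot m j (ρ (x j)) F)
      = if j = k then slot m j ⁅ρ (x j), ρ' (y j)⁆ F else 0 := by
    intro j k
    rw [← Derivation.commutator_apply, lie_slot]
    split_ifs with h
    · rw [h]
    · rfl
  simp only [Derivation.commutator_apply, powAction_apply, derivation_sum_apply, map_sum]
  rw [Finset.sum_comm (f := fun j k => slot m k (ρ' (y k)) (slot m j (ρ (x j)) F))]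
  simp only [← Finset.sum_sub_distrib, h, Finset.sum_ite_eq', Finset.mem_univ,
    if_true]

/-- `x ↦ (ρ(x)_k F)`. -/
def slotEval (ρ : V →ₗ[ℂ] Derivation ℂ B B) (k : Fin m) (F : Pow B m) : V →ₗ[ℂ] Pow B m :=
  evalAt (powAction m ρ) F ∘ₗ LinearMap.single ℂ (fun _ => V) k

lemma slotEval_apply (ρ : V →ₗ[ℂ] Derivation ℂ B B) (k : Fin m) (F : Pow B m) (x : V) :
    slotEval ρ k F x = slot m k (ρ x) F := by
  simp only [slotEval, LinearMap.comp_apply, evalAt_apply, LinearMap.single_apply, powAction_single]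

lemma act₂_comps (ρ : V →ₗ[ℂ] Derivation ℂ B B) (k l : Fin m) (t : V ⊗[ℂ] V) (F H : Pow B m) :
    act₂ (powAction m ρ) (comps m k l t) F H = mulMap (slotEval ρ k F) (slotEval ρ l H) t := by
  induction t with
  | zero => simp
  | add u v hu hv => simp only [map_add, LinearMap.add_apply, hu, hv]
  | tmul x y => rfl

lemma act₂_comps_same_tprod (ρ : V →ₗ[ℂ] Derivation ℂ B B) (j : Fin m) (t : V ⊗[ℂ] V)
    (f g : Fin m → B) :
    act₂ (powAction m ρ) (comps m j j t) (PiTensorProduct.tprod ℂ f) (PiTensorProduct.tprod ℂ g)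
      = PiTensorProduct.tprod ℂ (Function.update (f * g) j (act₂ ρ t (f j) (g j))) := by
  rw [act₂_comps]
  induction t with
  | zero => simp [MultilinearMap.map_update_zero]
  | add u v hu hv => simp only [map_add, LinearMap.add_apply, hu, hv, MultilinearMap.map_update_add]
  | tmul x y =>
    rw [mulMap_tmul, slotEval_apply, slotEval_apply, slot_tprod, slot_tprod,
      PiTensorProduct.tprod_mul_tprod, act₂_tmul]
    congr 1
    ext i
    by_cases h : i = j
    · subst h; simp
    · simp [h]

lemma powBracket_tprod (br : B →ₗ[ℂ] B →ₗ[ℂ] B) (f g : Fin m → B) :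
    powBracket m br (PiTensorProduct.tprod ℂ f) (PiTensorProduct.tprod ℂ g)
      = ∑ j, PiTensorProduct.tprod ℂ (Function.update (f * g) j (br (f j) (g j))) := by
  rw [powBracket, LinearMap.sum_apply, LinearMap.sum_apply]
  refine Finset.sum_congr rfl fun j _ => ?_
  rw [PiTensorProduct.map₂_tprod_tprod]
  congr 1
  ext i
  by_cases h : i = j
  · subst h; simp
  · simp [h]

lemma powBracket_act₂ (ρ : V →ₗ[ℂ] Derivation ℂ B B) (t : V ⊗[ℂ] V) :
    powBracket m (act₂ ρ t) = ∑ j, act₂ (powAction m ρ) (comps m j j t) :=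
  bilinearMap_ext_tprod fun f g => by
    rw [powBracket_tprod]
    simp only [LinearMap.sum_apply, act₂_comps_same_tprod]

lemma powBracket_sub (br br' : B →ₗ[ℂ] B →ₗ[ℂ] B) :
    powBracket m (br - br') = powBracket m br - powBracket m br' :=
  bilinearMap_ext_tprod fun f g => by
    simp only [powBracket_tprod, LinearMap.sub_apply, MultilinearMap.map_update_sub,
      Finset.sum_sub_distrib]

/-- A tensor placed within one factor acts only through its one-factor operation, so Ω^L = Ω^R
passes to every factor of G^m. -/
lemma act₂_comps_same_congr {ρ ρ' : V →ₗ[ℂ] Derivation ℂ B B} {t : V ⊗[ℂ] V}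
    (h : act₂ ρ t = act₂ ρ' t) (j : Fin m) :
    act₂ (powAction m ρ) (comps m j j t) = act₂ (powAction m ρ') (comps m j j t) :=
  bilinearMap_ext_tprod fun f g => by rw [act₂_comps_same_tprod, act₂_comps_same_tprod, h]

variable {L : Type*} [LieRing L] [LieAlgebra ℂ L]

lemma flip₂_comps (k l : Fin m) (t : V ⊗[ℂ] V) :
    flip₂ (comps m k l t) = comps m l k (flip₂ t) := by
  induction t with
  | zero => simp
  | add u v hu hv => simp only [map_add, flip₂_add, hu, hv]
  | tmul x y => rfl

lemma flip₂_sum {ι : Type*} (s : Finset ι) (t : ι → V ⊗[ℂ] V) :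
    flip₂ (∑ i ∈ s, t i) = ∑ i ∈ s, flip₂ (t i) := map_sum (TensorProduct.comm ℂ V V) _ _

lemma flip₂_neg (t : V ⊗[ℂ] V) : flip₂ (-t) = -flip₂ t := map_neg (TensorProduct.comm ℂ V V) _

/-- For k ≠ l the (k, l) component is minus the flip of the (l, k) one, so only the diagonal
components have a symmetric part. -/
lemma polyuble_add_flip₂ (r : L ⊗[ℂ] L) :
    polyuble m r + flip₂ (polyuble m r) = ∑ j, comps m j j (r + flip₂ r) := by
  rw [polyuble_eq_sum]
  simp only [flip₂_sum, flip₂_comps]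
  rw [Finset.sum_comm (f := fun k l : Fin m => comps m l k (flip₂ (polyComp r k l)))]
  simp only [← Finset.sum_add_distrib, ← map_add]
  refine Finset.sum_congr rfl fun k _ => ?_
  rw [Finset.sum_eq_single k]
  · simp [polyComp]
  · intro l _ hl
    unfold polyComp
    rcases lt_or_gt_of_ne hl with h | h
    · rw [if_neg h.not_gt, if_pos h, flip₂_neg, flip₂_flip₂, add_neg_cancel, map_zero]
    · rw [if_pos h, if_neg h.not_gt, neg_add_cancel, map_zero]
  · intro h; exact absurd (Finset.mem_univ k) h

end TensorPower

/-! ### The polyuble bracket is Poisson. -/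

section Polyuble

variable {A : Type*} [CommRing A] [HopfAlgebra ℂ A] [Algebra.FiniteType ℂ A] [IsDomain A]
  [LieAlgebra.IsSemisimple ℂ (lieAlg A)] (D : StandardData (lieAlg A)) (m : ℕ)

namespace StandardData

lemma polyubleBracket_eq : polyubleBracket m D.rSt
    = act₂ (powAction m (leftField A)) (polyuble m D.rSt)
      - act₂ (powAction m (rightField A)) (polyuble m D.rSt) := by
  have h : act₂ (powAction m (leftField A)) (∑ j, comps m j j (D.rSt + flip₂ D.rSt))
      = act₂ (powAction m (rightField A)) (∑ j, comps m j j (D.rSt + flip₂ D.rSt)) := by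
    rw [map_sum, map_sum]
    exact Finset.sum_congr rfl fun j _ => act₂_comps_same_congr D.act₂_casimir j
  rw [polyubleBracket, skewPart_eq, polyuble_add_flip₂, map_sub, map_sub, map_smul, map_smul, h]
  abel

/-- The argument for G itself, run with the Lie algebra 𝔤^m and its solution r^{(m)} of the CYBE. -/
lemma isPoissonBracket_polyubleBracket : IsPoissonBracket (polyubleBracket (A := A) m D.rSt) := by
  have hself : ∀ F : Pow A m, polyubleBracket m D.rSt F F = 0 := fun F => by
    rw [polyubleBracket, LinearMap.sub_apply, LinearMap.sub_apply, act₂_skewPart_self,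
      act₂_skewPart_self, sub_zero]
  rw [polyubleBracket_eq] at hself ⊢
  refine isPoissonBracket_of_cybTensor (L := Fin m → lieAlg A) _ _ (fun x y => ?_) (fun x y => ?_)
    (fun x y => ?_) (cybTensor_polyuble D.cybTensor_rSt D.lie_casimir m) hself
  · rw [lie_powAction]; rfl
  · rw [lie_powAction, powAction_apply, ← Finset.sum_neg_distrib]
    refine Finset.sum_congr rfl fun j _ => ?_
    rw [pi_lie_apply, rightField_lie, slot_neg]
  · rw [lie_powAction]
    exact Finset.sum_eq_zero fun j _ => by rw [lie_leftField_rightField, slot_zero]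

end StandardData

end Polyuble

/-! ### Functions on products, and invariance under products of subgroups -/

section Separation

variable {B : Type*} [CommRing B] [Algebra ℂ B] {m : ℕ}

lemma prodEval_tprod {C : Type*} [CommRing C] [Algebra ℂ C] (φ : Fin m → B →ₗ[ℂ] C)
    (f : Fin m → B) : prodEval φ (PiTensorProduct.tprod ℂ f) = ∏ i, φ i (f i) := by
  simp [prodEval]

lemma prodEval_update_tprod {C : Type*} [CommRing C] [Algebra ℂ C] (φ : Fin m → B →ₗ[ℂ] C)
    (j : Fin m) (ψ : B →ₗ[ℂ] C) (f : Fin m → B) :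
    prodEval (Function.update φ j ψ) (PiTensorProduct.tprod ℂ f)
      = ψ (f j) * ∏ i ∈ Finset.univ.erase j, φ i (f i) := by
  rw [prodEval_tprod, ← Finset.mul_prod_erase _ _ (Finset.mem_univ j), Function.update_self]
  congr 1
  exact Finset.prod_congr rfl fun i hi => by rw [Function.update_of_ne (Finset.ne_of_mem_erase hi)]

/-- `ψ ↦ prodEval φ F` with the `j`-th functional replaced by `ψ`. -/
def prodEvalSlot (φ : Fin m → B →ₗ[ℂ] ℂ) (j : Fin m) (F : Pow B m) : (B →ₗ[ℂ] ℂ) →ₗ[ℂ] ℂ where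
  toFun ψ := prodEval (Function.update φ j ψ) F
  map_add' ψ ψ' := by
    have : prodEval (Function.update φ j (ψ + ψ'))
        = prodEval (Function.update φ j ψ) + prodEval (Function.update φ j ψ') :=
      linearMap_ext_tprod fun f => by simp [prodEval_update_tprod, add_mul]
    rw [this, LinearMap.add_apply]
  map_smul' c ψ := by
    have : prodEval (Function.update φ j (c • ψ)) = c • prodEval (Function.update φ j ψ) :=
      linearMap_ext_tprod fun f => by simp [prodEval_update_tprod, mul_assoc]
    rw [this]; rfl

lemma prodEval_eq_zero_of_mem_span {E : Set (B →ₗ[ℂ] ℂ)} {F : Pow B m}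
    (h : ∀ φ : Fin m → B →ₗ[ℂ] ℂ, (∀ i, φ i ∈ E) → prodEval φ F = 0)
    (φ : Fin m → B →ₗ[ℂ] ℂ) (hφ : ∀ i, φ i ∈ Submodule.span ℂ E) : prodEval φ F = 0 := by
  -- Here `s` holds the slots where the functional lies merely in the span; multilinearity removes
  -- them one at a time.
  have key : ∀ (s : Finset (Fin m)) (φ : Fin m → B →ₗ[ℂ] ℂ),
      (∀ i ∈ s, φ i ∈ Submodule.span ℂ E) → (∀ i ∉ s, φ i ∈ E) → prodEval φ F = 0 := by
    intro s
    induction s using Finset.induction_on with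
    | empty => exact fun φ _ h2 => h φ fun i => h2 i (Finset.notMem_empty i)
    | insert j s hj ih =>
      intro φ h1 h2
      have hle : Submodule.span ℂ E ≤ LinearMap.ker (prodEvalSlot φ j F) := by
        refine Submodule.span_le.2 fun ψ hψ => ?_
        refine ih (Function.update φ j ψ) (fun i hi => ?_) (fun i hi => ?_)
        · rw [Function.update_of_ne (ne_of_mem_of_not_mem hi hj)]
          exact h1 i (Finset.mem_insert_of_mem hi)
        · by_cases hij : i = j
          · subst hij; rwa [Function.update_self]
          · rw [Function.update_of_ne hij]
            exact h2 i (by simp [hij, hi])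
      have := hle (h1 j (Finset.mem_insert_self j s))
      rw [LinearMap.mem_ker] at this
      change prodEval (Function.update φ j (φ j)) F = 0 at this
      rwa [Function.update_eq_self] at this
  exact key Finset.univ φ (fun i _ => hφ i) (fun i hi => absurd (Finset.mem_univ i) hi)

/-- A separating subspace of functionals restricts onto the dual of every finite dimensional
subspace. -/
lemma exists_mem_eq_on {U : Submodule ℂ (B →ₗ[ℂ] ℂ)} (hU : ∀ b, (∀ φ ∈ U, φ b = 0) → b = 0)
    (W : Submodule ℂ B) [FiniteDimensional ℂ W] (ξ : W →ₗ[ℂ] ℂ) : ∃ φ ∈ U, ∀ w : W, φ w = ξ w := by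
  let R : (B →ₗ[ℂ] ℂ) →ₗ[ℂ] Module.Dual ℂ W := W.subtype.dualMap
  -- Over a finite dimensional space, functionals with no common zero other than 0 span the dual.
  have htop : U.map R = ⊤ := by
    have h0 : (U.map R).dualCoannihilator = ⊥ := by
      rw [eq_bot_iff]
      intro w hw
      rw [Submodule.mem_dualCoannihilator] at hw
      refine Subtype.ext (hU w fun φ hφ => hw _ ⟨φ, hφ, rfl⟩)
    rw [← Subspace.dualCoannihilator_dualAnnihilator_eq (W := U.map R), h0,
      Submodule.dualAnnihilator_bot]
  obtain ⟨φ, hφ, h⟩ := (htop ▸ Submodule.mem_top : ξ ∈ U.map R)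
  exact ⟨φ, hφ, fun w => LinearMap.congr_fun h w⟩

/-- Finitely many basis vectors occur in F. On their span each coordinate functional agrees with a
combination from E, and a product of such combinations reads off a coefficient of F. -/
lemma eq_zero_of_prodEval_eq_zero {E : Set (B →ₗ[ℂ] ℂ)} (hE : ∀ b, (∀ φ ∈ E, φ b = 0) → b = 0)
    {F : Pow B m} (h : ∀ φ : Fin m → B →ₗ[ℂ] ℂ, (∀ i, φ i ∈ E) → prodEval φ F = 0) : F = 0 := by
  classical
  let b := Module.Basis.ofVectorSpace ℂ B
  let bb := Basis.piTensorProduct (fun _ : Fin m => b)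
  refine bb.ext_elem fun k => ?_
  rw [map_zero, Finsupp.zero_apply]
  let J := insert k (bb.repr F).support
  let I := J.biUnion fun q => Finset.univ.image q
  let W : Submodule ℂ B := Submodule.span ℂ (b '' (I : Set _))
  have hW : FiniteDimensional ℂ W := FiniteDimensional.span_of_finite ℂ (I.finite_toSet.image _)
  have hmem : ∀ q ∈ J, ∀ i, b (q i) ∈ W := fun q hq i =>
    Submodule.subset_span ⟨q i, Finset.mem_coe.2 (Finset.mem_biUnion.2 ⟨q, hq, by simp⟩), rfl⟩
  have hφ : ∀ i, ∃ φ ∈ Submodule.span ℂ E, ∀ w : W, φ w = (b.coord (k i) ∘ₗ W.subtype) w :=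
    fun i => exists_mem_eq_on (fun x hx => hE x fun φ hφ => hx φ (Submodule.subset_span hφ)) W _
  choose φ hφE hφW using hφ
  have h0 := prodEval_eq_zero_of_mem_span h φ hφE
  rw [← bb.linearCombination_repr F, Finsupp.linearCombination_apply, Finsupp.sum, map_sum] at h0
  have hterm : ∀ q ∈ J, prodEval φ (bb q) = if q = k then 1 else 0 := by
    intro q hq
    rw [Basis.piTensorProduct_apply, prodEval_tprod]
    have : ∀ i, φ i (b (q i)) = if q i = k i then 1 else 0 := by
      intro i
      have := hφW i ⟨b (q i), hmem q hq i⟩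
      simp only [LinearMap.comp_apply, Submodule.subtype_apply, Module.Basis.coord_apply,
        Module.Basis.repr_self, Finsupp.single_apply] at this
      exact this
    simp only [this]
    by_cases hqk : q = k
    · subst hqk; simp
    · rw [if_neg hqk]
      obtain ⟨i, hi⟩ := Function.ne_iff.1 hqk
      exact Finset.prod_eq_zero (Finset.mem_univ i) (if_neg hi)
  rw [Finset.sum_congr rfl (g := fun q => if q = k then bb.repr F k else 0)] at h0
  · rw [Finset.sum_ite_eq'] at h0
    by_contra hne
    rw [if_pos (Finsupp.mem_support_iff.2 hne)] at h0
    exact hne h0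
  · intro q hq
    rw [map_smul, hterm q (Finset.mem_insert_of_mem hq)]
    split_ifs with hqk
    · simp [hqk]
    · simp

end Separation

/-! ### Tensor powers of a subalgebra inside those of the ambient algebra. -/

section Range

variable {B : Type*} [CommRing B] [Algebra ℂ B] {m : ℕ}

lemma powIncl_tprod (S : Subalgebra ℂ B) (f : Fin m → S) :
    powIncl m S (PiTensorProduct.tprod ℂ f) = PiTensorProduct.tprod ℂ fun i => (f i : B) := by
  change PiTensorProduct.map (fun _ => S.val.toLinearMap) (PiTensorProduct.tprod ℂ f) = _
  rw [PiTensorProduct.map_tprod]; rfl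

/-- Over a field the inclusion of S has a linear left inverse, whose tensor power inverts `powIncl`.
-/
lemma powIncl_injective (S : Subalgebra ℂ B) : Function.Injective (powIncl m S) := by
  obtain ⟨P, hP⟩ := LinearMap.exists_leftInverse_of_injective S.val.toLinearMap
    (LinearMap.ker_eq_bot.2 Subtype.val_injective)
  refine Function.LeftInverse.injective (g := PiTensorProduct.map fun _ => P) fun F => ?_
  have : (PiTensorProduct.map fun _ => P) ∘ₗ (powIncl m S).toLinearMap = LinearMap.id :=
    linearMap_ext_tprod fun f => by
      rw [LinearMap.comp_apply, AlgHom.toLinearMap_apply, powIncl_tprod, PiTensorProduct.map_tprod]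
      exact congrArg (PiTensorProduct.tprod ℂ) (funext fun i => LinearMap.congr_fun hP (f i))
  exact LinearMap.congr_fun this F

lemma slotMap_comp (j : Fin m) (D D' : B →ₗ[ℂ] B) :
    slotMap m j (D ∘ₗ D') = slotMap m j D ∘ₗ slotMap m j D' :=
  linearMap_ext_tprod fun f => by simp [slotMap_tprod]

lemma slotMap_sum {ι : Type*} (s : Finset ι) (j : Fin m) (D : ι → B →ₗ[ℂ] B) :
    slotMap m j (∑ i ∈ s, D i) = ∑ i ∈ s, slotMap m j (D i) :=
  map_sum (AddMonoidHom.mk' (slotMap m j) (slotMap_add m j)) _ _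

/-- If `S` is the common kernel of finitely many operators, then `S^{⊗ m}` is the common kernel of
these operators acting in all the slots. -/
lemma mem_range_powIncl_of_slotMap_eq_zero (S : Subalgebra ℂ B) {ι : Type*} [Fintype ι]
    (X : ι → B →ₗ[ℂ] B) (hS : ∀ f, (∀ i, X i f = 0) → f ∈ S) {F : Pow B m}
    (hF : ∀ j i, slotMap m j (X i) F = 0) : F ∈ (powIncl m S).range := by
  classical
  obtain ⟨P, hP⟩ := LinearMap.exists_leftInverse_of_injective S.val.toLinearMap
    (LinearMap.ker_eq_bot.2 Subtype.val_injective)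
  -- A linear projection of B onto S; it need not be multiplicative.
  let π : B →ₗ[ℂ] B := S.val.toLinearMap ∘ₗ P
  let X' : B →ₗ[ℂ] (ι → B) := LinearMap.pi X
  obtain ⟨s, hs⟩ := LinearMap.exists_rightInverse_of_surjective X'.rangeRestrict
    X'.range_rangeRestrict
  obtain ⟨Q, hQ⟩ := LinearMap.exists_extend (((LinearMap.id : B →ₗ[ℂ] B) - π) ∘ₗ s)
  -- The map 1 - π vanishes on S, hence on the common kernel of the X i, so it factors through X'.
  -- Consequently 1 - π in any slot annihilates F.
  have hfac : (LinearMap.id : B →ₗ[ℂ] B) - π = ∑ i, (Q ∘ₗ LinearMap.single ℂ (fun _ => B) i) ∘ₗ X i := by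
    ext f
    have h1 : ((LinearMap.id : B →ₗ[ℂ] B) - π) f = ((LinearMap.id : B →ₗ[ℂ] B) - π) (s (X'.rangeRestrict f)) := by
      rw [← sub_eq_zero, ← map_sub]
      have hmem : f - s (X'.rangeRestrict f) ∈ S := by
        refine hS _ fun i => ?_
        have h2 : X'.rangeRestrict (f - s (X'.rangeRestrict f)) = 0 := by
          rw [map_sub, sub_eq_zero]
          exact (LinearMap.congr_fun hs _).symm
        exact congrFun (congrArg Subtype.val h2) i
      have h3 : P (f - s (X'.rangeRestrict f)) = ⟨_, hmem⟩ := LinearMap.congr_fun hP ⟨_, hmem⟩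
      change _ - (P (f - s (X'.rangeRestrict f)) : B) = 0
      rw [h3]
      exact sub_self _
    rw [h1]
    have h4 := LinearMap.congr_fun hQ (X'.rangeRestrict f)
    have h5 : X' f = ∑ i, Pi.single i (X i f) := (Finset.univ_sum_single (X' f)).symm
    have h6 : Q (X' f) = ((LinearMap.id : B →ₗ[ℂ] B) - π) (s (X'.rangeRestrict f)) := h4
    rw [← h6, h5, map_sum, LinearMap.sum_apply]
    rfl
  have hslot : ∀ j, slotMap m j π F = F := by
    intro j
    have h1 : slotMap m j (LinearMap.id - π) F = 0 := by
      rw [hfac, slotMap_sum, LinearMap.sum_apply]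
      refine Finset.sum_eq_zero fun i _ => ?_
      rw [slotMap_comp, LinearMap.comp_apply, hF, map_zero]
    have h2 : slotMap m j (LinearMap.id - π) + slotMap m j π = LinearMap.id := by
      rw [← slotMap_add, sub_add_cancel]
      exact linearMap_ext_tprod fun f => by simp [slotMap_tprod]
    have h3 := LinearMap.congr_fun h2 F
    rwa [LinearMap.add_apply, h1, zero_add] at h3
  -- Accumulating the slots one by one shows that π in all slots fixes F, and this map factors
  -- through S^{⊗ m}.
  have hset : ∀ s : Finset (Fin m),
      PiTensorProduct.map (fun i => if i ∈ s then π else LinearMap.id) F = F := by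
    intro s
    induction s using Finset.induction_on with
    | empty => simp
    | insert j s hj ih =>
      have : PiTensorProduct.map (fun i => if i ∈ insert j s then π else LinearMap.id)
          = slotMap m j π ∘ₗ PiTensorProduct.map (fun i => if i ∈ s then π else LinearMap.id) :=
        linearMap_ext_tprod fun f => by
          rw [LinearMap.comp_apply, PiTensorProduct.map_tprod, PiTensorProduct.map_tprod,
            slotMap_tprod]
          congr 1
          ext i
          by_cases h : i = j
          · subst h; simp [hj]
          · simp [h]
      rw [this, LinearMap.comp_apply, ih, hslot]
  have hall := hset Finset.univ
  simp only [Finset.mem_univ, if_true] at hall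
  refine ⟨PiTensorProduct.map (fun _ => P) F, ?_⟩
  refine Eq.trans ?_ hall
  have : (powIncl m S).toLinearMap ∘ₗ (PiTensorProduct.map fun _ => P)
      = PiTensorProduct.map fun _ => π :=
    linearMap_ext_tprod fun f => by
      rw [LinearMap.comp_apply, AlgHom.toLinearMap_apply, PiTensorProduct.map_tprod, powIncl_tprod,
        PiTensorProduct.map_tprod]
      rfl
  exact LinearMap.congr_fun this F

end Range

/-! ### Functions on G^m invariant under N^m. -/

section Invariance

variable {A : Type*} [CommRing A] [HopfAlgebra ℂ A] {m : ℕ}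

lemma hasSum_prodEval_update (φ : Fin m → A →ₗ[ℂ] ℂ) (j : Fin m) (c : ℕ → A →ₗ[ℂ] ℂ) (t : ℂ)
    (ψ : A →ₗ[ℂ] ℂ) (h : ∀ f, HasSum (fun k => t ^ k * c k f) (ψ f)) (F : Pow A m) :
    HasSum (fun k => t ^ k * prodEval (Function.update φ j (c k)) F)
      (prodEval (Function.update φ j ψ) F) := by
  induction F using PiTensorProduct.induction_on with
  | smul_tprod a f =>
    simp only [map_smul, smul_eq_mul, prodEval_update_tprod]
    have := ((h (f j)).mul_right (∏ i ∈ Finset.univ.erase j, φ i (f i))).mul_left a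
    simpa only [mul_left_comm a, mul_assoc] using this
  | add F H hF hH =>
    simp only [map_add, mul_add]
    exact hF.add hH

lemma prodEval_slot (φ : Fin m → A →ₗ[ℂ] ℂ) (j : Fin m) (D : Derivation ℂ A A) (F : Pow A m) :
    prodEval φ (slot m j D F)
      = prodEval (Function.update φ j (φ j ∘ₗ (D : A →ₗ[ℂ] A))) F := by
  have : prodEval φ ∘ₗ (slot m j D : Pow A m →ₗ[ℂ] Pow A m)
      = prodEval (Function.update φ j (φ j ∘ₗ (D : A →ₗ[ℂ] A))) :=
    linearMap_ext_tprod fun f => by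
      rw [LinearMap.comp_apply, Derivation.coeFn_coe, slot_tprod, prodEval_update_tprod,
        prodEval_tprod, ← Finset.mul_prod_erase _ _ (Finset.mem_univ j), Function.update_self]
      congr 1
      exact Finset.prod_congr rfl fun i hi => by
        rw [Function.update_of_ne (Finset.ne_of_mem_erase hi)]
  exact LinearMap.congr_fun this F

variable [Algebra.FiniteType ℂ A] [IsDomain A]

lemma eq_of_forall_prodEval {F H : Pow A m}
    (h : ∀ p : Fin m → Pt A, prodEval (fun i => (p i).ofConv.toLinearMap) F
      = prodEval (fun i => (p i).ofConv.toLinearMap) H) : F = H := by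
  rw [← sub_eq_zero]
  refine eq_zero_of_prodEval_eq_zero (E := Set.range fun p : Pt A => p.ofConv.toLinearMap)
    (fun b hb => ?_) (fun φ hφ => ?_)
  · refine eq_of_forall_pt fun p => ?_
    rw [map_zero]
    exact hb _ ⟨p, rfl⟩
  · choose p hp using hφ
    have : φ = fun i => (p i).ofConv.toLinearMap := funext fun i => (hp i).symm
    rw [this, map_sub, h, sub_self]

/-- The one-variable argument in the j-th slot: only p_j moves along exp(tx), the other entries of n
being 1, and the linear coefficient in t is the derivative in that slot. -/
lemma slot_rightField_eq_zero {𝔫 : Submodule ℂ (lieAlg A)} {F : Pow A m}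
    (hF : ∀ n p : Fin m → Pt A, (∀ i, n i ∈ integralSubgroup 𝔫) →
      prodEval (fun i => (n i * p i).ofConv.toLinearMap) F
        = prodEval (fun i => (p i).ofConv.toLinearMap) F)
    {x : lieAlg A} (hx : x ∈ 𝔫) (j : Fin m) : slot m j (rightField A x) F = 0 := by
  refine eq_of_forall_prodEval fun p => ?_
  rw [map_zero, prodEval_slot]
  set φ : Fin m → A →ₗ[ℂ] ℂ := fun i => (p i).ofConv.toLinearMap with hφ
  have h1 : φ j ∘ₗ (rightField A x : A →ₗ[ℂ] A)
      = expCoeff x 1 ∘ₗ (rightTrans (p j)).toLinearMap := by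
    ext f
    simp only [LinearMap.comp_apply, expCoeff_one, AlgHom.toLinearMap_apply, Derivation.coeFn_coe,
      hφ, apply_rightField]
  rw [h1]
  refine coeff_eq_zero_of_hasSum_const (a := prodEval φ F)
    (c := fun k => prodEval (Function.update φ j (expCoeff x k ∘ₗ (rightTrans (p j)).toLinearMap)) F)
    (fun t => ?_) one_ne_zero
  obtain ⟨g, hg, hsum⟩ := exists_pt_hasSum x t
  have h := hF (Function.update 1 j g) p (fun i => by
    by_cases hi : i = j
    · subst hi
      rw [Function.update_self]
      exact Subgroup.subset_closure ⟨t • x, 𝔫.smul_mem t hx, hg⟩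
    · rw [Function.update_of_ne hi]; exact Subgroup.one_mem _)
  have h2 : (fun i => ((Function.update 1 j g : Fin m → Pt A) i * p i).ofConv.toLinearMap)
      = Function.update φ j (g.ofConv.toLinearMap ∘ₗ (rightTrans (p j)).toLinearMap) := by
    funext i
    by_cases hi : i = j
    · subst hi
      rw [Function.update_self, Function.update_self]
      ext f
      simp [apply_rightTrans]
    · rw [Function.update_of_ne hi, Function.update_of_ne hi, Pi.one_apply, one_mul]
  rw [← h, h2]
  exact hasSum_prodEval_update φ j _ t _ (fun f => hsum _) F

lemma mem_range_powIncl_iff (𝔫 : Submodule ℂ (lieAlg A)) (F : Pow A m) :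
    F ∈ (powIncl m (quotientRing (integralSubgroup 𝔫))).range ↔
      ∀ n p : Fin m → Pt A, (∀ i, n i ∈ integralSubgroup 𝔫) →
        prodEval (fun i => (n i * p i).ofConv.toLinearMap) F
          = prodEval (fun i => (p i).ofConv.toLinearMap) F := by
  constructor
  · rintro ⟨G, rfl⟩ n p hn
    have : prodEval (fun i => (n i * p i).ofConv.toLinearMap)
          ∘ₗ (powIncl m (quotientRing (integralSubgroup 𝔫))).toLinearMap
        = prodEval (fun i => (p i).ofConv.toLinearMap)
          ∘ₗ (powIncl m (quotientRing (integralSubgroup 𝔫))).toLinearMap :=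
      linearMap_ext_tprod fun f => by
        simp only [LinearMap.comp_apply, AlgHom.toLinearMap_apply, powIncl_tprod, prodEval_tprod]
        exact Finset.prod_congr rfl fun i _ => (f i).2 (n i) (hn i) (p i)
    exact LinearMap.congr_fun this G
  · intro hF
    -- A basis of 𝔫 supplies the finitely many operators whose common kernel is ℂ[N\G].
    let b := Module.finBasis ℂ 𝔫
    refine mem_range_powIncl_of_slotMap_eq_zero _
      (fun i => (rightField A (b i) : A →ₗ[ℂ] A)) (fun f hf => ?_)
      (fun j i => slot_rightField_eq_zero hF (b i).2 j)
    rw [mem_quotientRing_integralSubgroup]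
    intro x hx
    have h : evalAt (rightField A) f ∘ₗ 𝔫.subtype = 0 := b.ext fun i => hf i
    exact LinearMap.congr_fun h ⟨x, hx⟩

end Invariance

/-! ### The mixed product bracket as a restriction of the polyuble bracket -/

section Restriction

variable {B : Type*} [CommRing B] [Algebra ℂ B]
variable {V : Type*} [AddCommGroup V] [Module ℂ V]
variable {W : Type*} [AddCommGroup W] [Module ℂ W]
variable {m : ℕ}

lemma IsPoissonBracket.of_injective {C : Type*} [CommRing C] [Algebra ℂ C]
    {br : B →ₗ[ℂ] B →ₗ[ℂ] B} {br' : C →ₗ[ℂ] C →ₗ[ℂ] C} (i : B →ₐ[ℂ] C) (hi : Function.Injective i)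
    (h : ∀ f g, i (br f g) = br' (i f) (i g)) (H : IsPoissonBracket br') : IsPoissonBracket br where
  self_eq_zero f := hi (by rw [h, H.self_eq_zero, map_zero])
  jacobi f g k := hi (by simp only [map_add, h, H.jacobi, map_zero])
  leibniz_left f g k := hi (by simp only [map_add, map_mul, h, H.leibniz_left])
  leibniz_right f g k := hi (by simp only [map_add, map_mul, h, H.leibniz_right])

lemma act₂_map (ρ : V →ₗ[ℂ] Derivation ℂ B B) (φ : W →ₗ[ℂ] V) (t : W ⊗[ℂ] W) :
    act₂ ρ (TensorProduct.map φ φ t) = act₂ (ρ ∘ₗ φ) t := by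
  induction t with
  | zero => simp
  | add t t' h h' => simp only [map_add, h, h']
  | tmul x y => rfl

/-- Quadratic in ρ: this is why the sign in -x^R disappears. -/
lemma act₂_neg (ρ : V →ₗ[ℂ] Derivation ℂ B B) (t : V ⊗[ℂ] V) : act₂ (-ρ) t = act₂ ρ t := by
  induction t with
  | zero => simp
  | add t t' h h' => simp only [map_add, h, h']
  | tmul x y => ext f g; simp

lemma map_act₂ {C : Type*} [CommRing C] [Algebra ℂ C] (i : B →ₐ[ℂ] C)
    {ρ : V →ₗ[ℂ] Derivation ℂ B B} {σ : V →ₗ[ℂ] Derivation ℂ C C}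
    (h : ∀ x f, i (ρ x f) = σ x (i f)) (t : V ⊗[ℂ] V) (f g : B) :
    i (act₂ ρ t f g) = act₂ σ t (i f) (i g) := by
  induction t with
  | zero => simp
  | add t t' ht ht' => simp only [map_add, LinearMap.add_apply, ht, ht']
  | tmul x y => rw [act₂_tmul, act₂_tmul, map_mul, h, h]

lemma powIncl_slot (S : Subalgebra ℂ B) (j : Fin m) {D' : Derivation ℂ S S} {D : Derivation ℂ B B}
    (h : ∀ f, (D' f : B) = D f) (F : Pow S m) :
    powIncl m S (slot m j D' F) = slot m j D (powIncl m S F) := by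
  have : (powIncl m S).toLinearMap ∘ₗ (slot m j D' : Pow S m →ₗ[ℂ] Pow S m)
      = (slot m j D : Pow B m →ₗ[ℂ] Pow B m) ∘ₗ (powIncl m S).toLinearMap :=
    linearMap_ext_tprod fun f => by
      simp only [LinearMap.comp_apply, AlgHom.toLinearMap_apply, Derivation.coeFn_coe, slot_tprod,
        powIncl_tprod]
      refine congrArg _ (funext fun i => ?_)
      by_cases hij : i = j
      · subst hij; simp [h]
      · simp [hij]
  exact LinearMap.congr_fun this F

lemma powIncl_powAction (S : Subalgebra ℂ B) {ρ' : V →ₗ[ℂ] Derivation ℂ S S}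
    {ρ : V →ₗ[ℂ] Derivation ℂ B B} (h : ∀ x f, (ρ' x f : B) = ρ x f) (x : Fin m → V)
    (F : Pow S m) : powIncl m S (powAction m ρ' x F) = powAction m ρ x (powIncl m S F) := by
  rw [powAction_apply, powAction_apply, derivation_sum_apply, derivation_sum_apply, map_sum]
  exact Finset.sum_congr rfl fun j _ => powIncl_slot S j (h (x j)) F

lemma powIncl_powBracket (S : Subalgebra ℂ B) {br' : S →ₗ[ℂ] S →ₗ[ℂ] S}
    {br : B →ₗ[ℂ] B →ₗ[ℂ] B} (h : ∀ f g, (br' f g : B) = br f g) (F H : Pow S m) :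
    powIncl m S (powBracket m br' F H) = powBracket m br (powIncl m S F) (powIncl m S H) := by
  have : (powBracket m br').compr₂ (powIncl m S).toLinearMap
      = (powBracket m br).compl₁₂ (powIncl m S).toLinearMap (powIncl m S).toLinearMap :=
    bilinearMap_ext_tprod fun f g => by
      simp only [LinearMap.compr₂_apply, LinearMap.compl₁₂_apply, AlgHom.toLinearMap_apply,
        powIncl_tprod, powBracket_tprod, map_sum]
      refine Finset.sum_congr rfl fun j _ => congrArg _ (funext fun i => ?_)
      by_cases hij : i = j
      · subst hij; simp [h]
      · simp [hij]
  exact LinearMap.congr_fun₂ this F H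

lemma mix_sub (r s : V ⊗[ℂ] V) : mix m (r - s) = mix m r - mix m s := by
  simp only [mix, ← Finset.sum_sub_distrib]
  refine Finset.sum_congr rfl fun k _ => Finset.sum_congr rfl fun l _ => ?_
  have : flip₂ (r - s) = flip₂ r - flip₂ s := map_sub (TensorProduct.comm ℂ V V) _ _
  split_ifs
  · rw [this, map_sub, map_sub]; abel
  · rw [sub_zero]

lemma mix_add (r s : V ⊗[ℂ] V) : mix m (r + s) = mix m r + mix m s := by
  have h := mix_sub (m := m) (r + s) s
  rw [add_sub_cancel_right] at h
  rw [h, sub_add_cancel]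

lemma comps_map (φ : W →ₗ[ℂ] V) (k l : Fin m) (t : W ⊗[ℂ] W) :
    comps m k l (TensorProduct.map φ φ t)
      = TensorProduct.map (LinearMap.compLeft φ (Fin m)) (LinearMap.compLeft φ (Fin m))
          (comps m k l t) := by
  induction t with
  | zero => simp
  | add t t' h h' => simp only [map_add, h, h']
  | tmul x y =>
    simp only [comps, TensorProduct.map_tmul, LinearMap.single_apply]
    congr 1 <;>
    · funext i
      rw [LinearMap.compLeft_apply, Function.comp_apply, Pi.apply_single (fun _ => φ) fun _ => map_zero φ]

lemma flip₂_map (φ : W →ₗ[ℂ] V) (t : W ⊗[ℂ] W) :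
    flip₂ (TensorProduct.map φ φ t) = TensorProduct.map φ φ (flip₂ t) := by
  induction t with
  | zero => simp
  | add t t' h h' => simp only [map_add, flip₂_add, h, h']
  | tmul x y => rfl

lemma mix_map (φ : W →ₗ[ℂ] V) (t : W ⊗[ℂ] W) :
    mix m (TensorProduct.map φ φ t)
      = TensorProduct.map (LinearMap.compLeft φ (Fin m)) (LinearMap.compLeft φ (Fin m))
          (mix m t) := by
  simp only [mix, map_sum]
  refine Finset.sum_congr rfl fun k _ => Finset.sum_congr rfl fun l _ => ?_
  rw [flip₂_map, comps_map, comps_map]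
  split_ifs
  · rw [map_sub]
  · rw [map_zero]

lemma powAction_comp (ρ : V →ₗ[ℂ] Derivation ℂ B B) (φ : W →ₗ[ℂ] V) :
    powAction m ρ ∘ₗ LinearMap.compLeft φ (Fin m) = powAction m (ρ ∘ₗ φ) := rfl

lemma powAction_neg (ρ : V →ₗ[ℂ] Derivation ℂ B B) : powAction m (-ρ) = -powAction m ρ := by
  refine LinearMap.ext fun x => ?_
  simp only [powAction_apply, LinearMap.neg_apply, slot_neg, Finset.sum_neg_distrib]

lemma act₂_powAction_mix_map (ρ : V →ₗ[ℂ] Derivation ℂ B B) (φ : W →ₗ[ℂ] V) (t : W ⊗[ℂ] W) :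
    act₂ (powAction m ρ) (mix m (TensorProduct.map φ φ t))
      = act₂ (powAction m (ρ ∘ₗ φ)) (mix m t) := by
  rw [mix_map, act₂_map, powAction_comp]

/-- The two halves of each wedge differ by a flip, that is, by exchanging the arguments; hence both
orders of F and H in the hypothesis. -/
lemma act₂_mix (ρ : V →ₗ[ℂ] Derivation ℂ B B) (t : V ⊗[ℂ] V) {F H : Pow B m}
    (h : ∀ k l, act₂ (powAction m ρ) (comps m k l t) H F = 0
      ∧ act₂ (powAction m ρ) (comps m k l t) F H = 0) :
    act₂ (powAction m ρ) (mix m t) F H = 0 := by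
  simp only [mix, map_sum, LinearMap.sum_apply]
  refine Finset.sum_eq_zero fun k _ => Finset.sum_eq_zero fun l _ => ?_
  split_ifs
  · rw [map_sub, LinearMap.sub_apply, LinearMap.sub_apply, ← flip₂_comps, act₂_flip₂, (h l k).1, (h l k).2,
      sub_zero]
  · simp

/-- By the Leibniz rule on both legs, [x, t] measures the failure of σ(x) to be a derivation of the
operation of t. -/
lemma act₂_lie {L : Type*} [LieRing L] [LieAlgebra ℂ L] {σ : L →ₗ[ℂ] Derivation ℂ B B}
    (hσ : ∀ x y, σ ⁅x, y⁆ = ⁅σ x, σ y⁆) (x : L) (t : L ⊗[ℂ] L) (f g : B) :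
    act₂ σ ⁅x, t⁆ f g = σ x (act₂ σ t f g) - (act₂ σ t (σ x f) g + act₂ σ t f (σ x g)) := by
  induction t with
  | zero => simp
  | add t t' h h' => simp only [lie_add, map_add, LinearMap.add_apply, h, h']; abel
  | tmul a b =>
    rw [TensorProduct.LieModule.lie_tmul_right]
    simp only [map_add, LinearMap.add_apply, act₂_tmul, hσ, Derivation.commutator_apply,
      Derivation.leibniz, smul_eq_mul]
    ring

lemma derivation_act₂_of_lie_eq_zero {σ : V →ₗ[ℂ] Derivation ℂ B B} {X : Derivation ℂ B B}
    (h : ∀ y, ⁅X, σ y⁆ = 0) (t : V ⊗[ℂ] V) (f g : B) :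
    X (act₂ σ t f g) = act₂ σ t (X f) g + act₂ σ t f (X g) := by
  have h' : ∀ y f, X (σ y f) = σ y (X f) := fun y f => by
    rw [← sub_eq_zero, ← Derivation.commutator_apply, h, Derivation.zero_apply]
  induction t with
  | zero => simp
  | add t t' h h' => simp only [map_add, LinearMap.add_apply, h, h']; abel
  | tmul a b =>
    simp only [act₂_tmul, Derivation.leibniz, smul_eq_mul, h']
    ring

lemma derivation_prod {ι : Type*} [DecidableEq ι] (X : Derivation ℂ B B) (s : Finset ι)
    (f : ι → B) : X (∏ i ∈ s, f i) = ∑ j ∈ s, X (f j) * ∏ i ∈ s.erase j, f i := by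
  induction s using Finset.induction_on with
  | empty => simp
  | insert a s ha ih =>
    rw [Finset.prod_insert ha, Derivation.leibniz, Finset.sum_insert ha, Finset.erase_insert ha, ih,
      smul_eq_mul, smul_eq_mul, Finset.mul_sum, add_comm, mul_comm]
    refine congrArg _ (Finset.sum_congr rfl fun j hj => ?_)
    have hja : a ≠ j := fun e => ha (e ▸ hj)
    rw [Finset.erase_insert_of_ne hja, Finset.prod_insert fun h => ha (Finset.mem_of_mem_erase h)]
    ring

end Restriction

/-! ### The effect of diagonal actions on r^{(m)}. -/

section Invariant

variable {L : Type*} [LieRing L] [LieAlgebra ℂ L] {m : ℕ}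

lemma map_diagonal (t : L ⊗[ℂ] L) :
    TensorProduct.map (diagonal m) (diagonal m) t = ∑ k, ∑ l, comps m k l t := by
  induction t with
  | zero => simp
  | add t t' h h' => simp only [map_add, h, h', Finset.sum_add_distrib]
  | tmul x y =>
    have : ∀ z : L, diagonal m z = ∑ k, Pi.single k z := fun z =>
      (Finset.univ_sum_single (diagonal m z)).symm
    rw [TensorProduct.map_tmul, this, this]
    simp only [TensorProduct.sum_tmul, TensorProduct.tmul_sum]
    exact Finset.sum_comm

/-- `r^{(m)}` is the diagonal image of `r` up to components of `r + r₂₁`. -/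
lemma polyuble_eq_map_diagonal_sub (r : L ⊗[ℂ] L) :
    polyuble m r = TensorProduct.map (diagonal m) (diagonal m) r
      - ∑ k, ∑ l, if k < l then comps m k l (r + flip₂ r) else 0 := by
  rw [polyuble_eq_sum, map_diagonal, ← Finset.sum_sub_distrib]
  refine Finset.sum_congr rfl fun k _ => ?_
  rw [← Finset.sum_sub_distrib]
  refine Finset.sum_congr rfl fun l _ => ?_
  rw [polyComp]
  split_ifs
  · rw [← map_sub]; congr 1; abel
  · rw [sub_zero]

lemma lie_diagonal_comps (x : L) (k l : Fin m) (t : L ⊗[ℂ] L) :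
    ⁅diagonal m x, comps m k l t⁆ = comps m k l ⁅x, t⁆ := by
  have h : ∀ (a : Fin m) (y : L), ⁅diagonal m x, (Pi.single a y : Fin m → L)⁆ = Pi.single a ⁅x, y⁆ := by
    intro a y
    funext i
    rw [pi_lie_apply]
    by_cases hi : i = a
    · subst hi; simp [diagonal]
    · simp [hi]
  induction t with
  | zero => simp
  | add t t' h h' => simp only [map_add, lie_add, h, h']
  | tmul y z =>
    rw [TensorProduct.LieModule.lie_tmul_right, map_add]
    simp only [comps, TensorProduct.map_tmul, LinearMap.single_apply,
      TensorProduct.LieModule.lie_tmul_right, h]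

/-- The off-diagonal corrections are components of the invariant tensor Ω, so only Δ(r) moves. -/
lemma lie_diagonal_polyuble {r : L ⊗[ℂ] L} (hΩ : ∀ x : L, ⁅x, r + flip₂ r⁆ = 0) (x : L) :
    ⁅diagonal m x, polyuble m r⁆ = TensorProduct.map (diagonal m) (diagonal m) ⁅x, r⁆ := by
  rw [polyuble_eq_map_diagonal_sub, lie_sub, map_diagonal, map_diagonal]
  simp only [lie_sum, lie_diagonal_comps]
  refine sub_eq_self.2 (Finset.sum_eq_zero fun k _ => Finset.sum_eq_zero fun l _ => ?_)
  split_ifs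
  · rw [lie_diagonal_comps, hΩ, map_zero]
  · rw [lie_zero]

/-- The finite counterpart, applied below with φ = Ad(g⁻¹): the corrections in Ω are fixed, and Δ(r)
is replaced by Δ(φ(r)). -/
lemma map_compLeft_polyuble {r : L ⊗[ℂ] L} {φ : L →ₗ[ℂ] L}
    (hΩ : TensorProduct.map φ φ (r + flip₂ r) = r + flip₂ r) :
    TensorProduct.map (LinearMap.compLeft φ (Fin m)) (LinearMap.compLeft φ (Fin m)) (polyuble m r)
      = polyuble m r - TensorProduct.map (diagonal m) (diagonal m) r
        + TensorProduct.map (diagonal m) (diagonal m) (TensorProduct.map φ φ r) := by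
  rw [polyuble_eq_map_diagonal_sub, map_sub, map_diagonal, map_diagonal]
  simp only [map_sum, ← comps_map]
  have : ∀ k l : Fin m, TensorProduct.map (LinearMap.compLeft φ (Fin m))
      (LinearMap.compLeft φ (Fin m)) (if k < l then comps m k l (r + flip₂ r) else 0)
      = if k < l then comps m k l (r + flip₂ r) else 0 := by
    intro k l
    split_ifs
    · rw [← comps_map, hΩ]
    · rw [map_zero]
  simp only [this]
  abel

end Invariant

/-! ### Descent to N\G and the mixed bracket. -/

section Quotient

variable {A : Type*} [CommRing A] [HopfAlgebra ℂ A] [Algebra.FiniteType ℂ A] [IsDomain A]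
  [LieAlgebra.IsSemisimple ℂ (lieAlg A)] (D : StandardData (lieAlg A)) {m : ℕ}

namespace StandardData

variable {D}

lemma mem_quotientRing {f : A} :
    f ∈ quotientRing D.N ↔ ∀ x ∈ D.nilradical, rightField A x f = 0 :=
  mem_quotientRing_integralSubgroup

lemma leftField_mem {f : A} (hf : f ∈ quotientRing D.N) (x : lieAlg A) :
    leftField A x f ∈ quotientRing D.N := by
  rw [mem_quotientRing] at hf ⊢
  intro y hy
  rw [← leftField_rightField, hf y hy, map_zero]

/-- The torus normalises 𝔫: x^R t^R f reduces to [t, x]^R f with [t, x] in 𝔫. -/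
lemma rightField_mem {f : A} (hf : f ∈ quotientRing D.N) {t : lieAlg A} (ht : t ∈ D.cartan) :
    rightField A t f ∈ quotientRing D.N := by
  rw [mem_quotientRing] at hf ⊢
  intro x hx
  have h := congrArg (fun X : Derivation ℂ A A => X f) (rightField_lie (A := A) t x)
  simp only [Derivation.neg_apply, Derivation.commutator_apply] at h
  rw [hf _ (lie_cartan_mem_nilradical ht hx), hf x hx, map_zero, zero_sub, neg_neg] at h
  exact h.symm

lemma ep_mem_nilradical {α : D.cartan.root} (hα : D.base.IsPos α) : D.ep α ∈ D.nilradical :=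
  rootSpace_le_nilradical hα (D.ep_mem α hα)

variable (D)

lemma rho_apply (z : lieAlg A × D.cartan) (f : A) :
    D.rho z f = leftField A z.1 f - rightField A (z.2 : lieAlg A) f := rfl

lemma rho_mem (z : lieAlg A × D.cartan) {f : A} (hf : f ∈ quotientRing D.N) :
    D.rho z f ∈ quotientRing D.N :=
  (quotientRing D.N).sub_mem (leftField_mem hf z.1) (rightField_mem hf z.2.2)

lemma rho_comp_inl : D.rho ∘ₗ LinearMap.inl ℂ (lieAlg A) D.cartan = leftField A := by
  ext x f; simp [rho_apply]

lemma rho_comp_inr : D.rho ∘ₗ LinearMap.inr ℂ (lieAlg A) D.cartan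
    = -(rightField A ∘ₗ D.cartan.toSubmodule.subtype) := by
  ext x f
  simp only [LinearMap.comp_apply, LinearMap.inr_apply, rho_apply, map_zero, Derivation.zero_apply,
    zero_sub, LinearMap.neg_apply, Derivation.neg_apply]
  rfl

open Classical in
lemma skewPart_rSt : skewPart D.rSt
    = skewPart (∑ α with D.base.IsPos α, D.em α ⊗ₜ[ℂ] D.ep α) := by
  have h : flip₂ D.r₀ = D.r₀ := by
    have : flip₂ D.r₀ = (1 / 2 : ℂ) • flip₂ (∑ i, D.h i ⊗ₜ[ℂ] D.h i) :=
      map_smul (TensorProduct.comm ℂ _ _) _ _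
    rw [this, flip₂_sum]; rfl
  rw [rSt, skewPart, flip₂_add, flip₂_map, h, add_sub_add_left_eq_sub, skewPart]

/-- The symmetric r₀ drops out of Λ, so every remaining term applies some e_α^R, α > 0, to f or to
g. -/
lemma act₂_rightField_skewPart {f g : A} (hf : f ∈ quotientRing D.N) (hg : g ∈ quotientRing D.N) :
    act₂ (rightField A) (skewPart D.rSt) f g = 0 := by
  classical
  rw [mem_quotientRing] at hf hg
  rw [skewPart_rSt, skewPart, map_smul, map_sub, LinearMap.smul_apply, LinearMap.smul_apply,
    LinearMap.sub_apply, LinearMap.sub_apply, act₂_flip₂]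
  simp only [map_sum, LinearMap.sum_apply, act₂_tmul]
  rw [Finset.sum_eq_zero, Finset.sum_eq_zero, sub_zero, smul_zero]
  · intro α hα
    rw [hf _ (ep_mem_nilradical (Finset.mem_filter.1 hα).2), mul_zero]
  · intro α hα
    rw [hg _ (ep_mem_nilradical (Finset.mem_filter.1 hα).2), mul_zero]

/-- With Λ^R gone, only left invariant fields remain, and these preserve ℂ[N\G]. -/
lemma groupBracket_mem {f g : A} (hf : f ∈ quotientRing D.N) (hg : g ∈ quotientRing D.N) :
    groupBracket D.rSt f g ∈ quotientRing D.N := by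
  rw [groupBracket, LinearMap.sub_apply, LinearMap.sub_apply, act₂_rightField_skewPart D hf hg,
    sub_zero, act₂_eq_mulMap]
  generalize skewPart D.rSt = t
  induction t with
  | zero => simp
  | add t t' h h' => rw [map_add]; exact (quotientRing D.N).add_mem h h'
  | tmul x y =>
    exact (quotientRing D.N).mul_mem (leftField_mem hf x) (leftField_mem hg y)

open Classical in
-- The root terms die because each contains some e_α. Unlike within a single factor, r₀ survives
-- between distinct factors; this is what the torus part of ρ accounts for.
lemma act₂_rightField_mix (F H : Pow (quotientRing D.N) m) :
    act₂ (powAction m (rightField A)) (mix m D.rSt) (powIncl m (quotientRing D.N) F) (powIncl m (quotientRing D.N) H)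
      = act₂ (powAction m (rightField A ∘ₗ D.cartan.toSubmodule.subtype)) (mix m D.r₀)
          (powIncl m (quotientRing D.N) F) (powIncl m (quotientRing D.N) H) := by
  have h0 : ∀ (F : Pow (quotientRing D.N) m) (k : Fin m) (α : D.cartan.root), D.base.IsPos α →
      slot m k (rightField A (D.ep α)) (powIncl m (quotientRing D.N) F) = 0 := by
    intro F k α hα
    rw [← powIncl_slot (quotientRing D.N) k (D' := 0), slot_zero, Derivation.zero_apply, map_zero]
    intro f
    exact (mem_quotientRing.1 f.2 _ (ep_mem_nilradical hα)).symm
  have h1 : ∀ (F H : Pow (quotientRing D.N) m) (k l : Fin m),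
      act₂ (powAction m (rightField A))
        (comps m k l (∑ α with D.base.IsPos α, D.em α ⊗ₜ[ℂ] D.ep α)) (powIncl m (quotientRing D.N) F)
        (powIncl m (quotientRing D.N) H) = 0 := by
    intro F H k l
    rw [act₂_comps, map_sum]
    refine Finset.sum_eq_zero fun α hα => ?_
    rw [mulMap_tmul, slotEval_apply, slotEval_apply, h0 H l α (Finset.mem_filter.1 hα).2, mul_zero]
  rw [rSt, mix_add, map_add, LinearMap.add_apply, LinearMap.add_apply,
    act₂_mix _ _ fun k l => ⟨h1 H F k l, h1 F H k l⟩, add_zero, ← act₂_powAction_mix_map]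

/-- The sign of -x^R disappears because it enters twice; the minus in front of the right invariant
part comes from the summand -(0, r₀) of r̃_st. -/
lemma act₂_rho_mix : act₂ (powAction m D.rho) (mix m D.rTilde)
    = act₂ (powAction m (leftField A)) (mix m D.rSt)
      - act₂ (powAction m (rightField A ∘ₗ D.cartan.toSubmodule.subtype)) (mix m D.r₀) := by
  rw [rTilde, mix_sub, map_sub]
  refine congrArg₂ _ ?_ ?_
  · exact (act₂_powAction_mix_map _ _ _).trans (by rw [rho_comp_inl])
  · exact (act₂_powAction_mix_map _ _ _).trans (by rw [rho_comp_inr, powAction_neg, act₂_neg])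

lemma powBracket_groupBracket : powBracket m (groupBracket D.rSt)
    = ∑ j, act₂ (powAction m (leftField A)) (comps m j j D.rSt)
      - ∑ j, act₂ (powAction m (rightField A)) (comps m j j D.rSt) := by
  rw [groupBracket_eq]
  refine (powBracket_sub _ _).trans ?_
  exact congrArg₂ _ (powBracket_act₂ _ _) (powBracket_act₂ _ _)

lemma polyubleBracket_eq_sub_mix : polyubleBracket m D.rSt
    = powBracket m (groupBracket D.rSt) - (act₂ (powAction m (leftField A)) (mix m D.rSt)
      - act₂ (powAction m (rightField A)) (mix m D.rSt)) := by
  have h (ρ : (Fin m → lieAlg A) →ₗ[ℂ] Derivation ℂ (Pow A m) (Pow A m)) :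
      act₂ ρ (polyuble m D.rSt) = ∑ j, act₂ ρ (comps m j j D.rSt) - act₂ ρ (mix m D.rSt) := by
    rw [polyuble, map_sub, map_sum]
  rw [polyubleBracket_eq, powBracket_groupBracket, h, h]
  exact sub_sub_sub_comm (α := Pow A m →ₗ[ℂ] Pow A m →ₗ[ℂ] Pow A m) _ _ _ _

variable (hbr : ∀ f ∈ quotientRing D.N, ∀ g ∈ quotientRing D.N,
    groupBracket D.rSt f g ∈ quotientRing D.N)
  (hρ : ∀ z, ∀ f ∈ quotientRing D.N, D.rho z f ∈ quotientRing D.N)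

/-- On N^m-invariant functions the right invariant part of Mix(r_st) shrinks to that of Mix(r₀), so
left minus right becomes ρ(Mix(r̃_st)). -/
lemma polyubleBracket_powIncl (F H : Pow (quotientRing D.N) m) :
    polyubleBracket m D.rSt (powIncl m (quotientRing D.N) F) (powIncl m (quotientRing D.N) H)
      = powIncl m (quotientRing D.N) (D.mixedBracket m hbr hρ F H) := by
  have h1 := powIncl_powBracket (quotientRing D.N)
    (br' := restrictBracket _ (groupBracket D.rSt) hbr) (fun _ _ => rfl) F H
  have h2 := map_act₂ (powIncl m (quotientRing D.N))
    (powIncl_powAction (quotientRing D.N) (ρ' := restrictAction _ D.rho hρ) (ρ := D.rho)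
      fun _ _ => rfl) (mix m D.rTilde) F H
  rw [act₂_rho_mix, LinearMap.sub_apply, LinearMap.sub_apply, ← D.act₂_rightField_mix F H] at h2
  rw [mixedBracket, LinearMap.sub_apply, LinearMap.sub_apply, map_sub, h1, h2,
    polyubleBracket_eq_sub_mix]
  rfl

lemma isPoissonBracket_mixedBracket : IsPoissonBracket (D.mixedBracket m hbr hρ) :=
  IsPoissonBracket.of_injective (powIncl m (quotientRing D.N)) (powIncl_injective _)
    (fun F H => (D.polyubleBracket_powIncl hbr hρ F H).symm) (D.isPoissonBracket_polyubleBracket m)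

lemma powIncl_diagonalField (x : lieAlg A) (F : Pow (quotientRing D.N) m) :
    powIncl m (quotientRing D.N) (D.diagonalField m hρ x F)
      = powAction m (leftField A) (diagonal m x) (powIncl m (quotientRing D.N) F) := by
  have h := powIncl_powAction (quotientRing D.N) (ρ' := restrictAction _ D.rho hρ) (ρ := D.rho)
      (fun _ _ => rfl) (diagonal m (LinearMap.inl ℂ (lieAlg A) D.cartan x)) F
  refine h.trans ?_
  rw [← rho_comp_inl D]
  rfl

lemma powAction_leftField_lie (x y : Fin m → lieAlg A) : powAction m (leftField A) ⁅x, y⁆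
    = ⁅powAction m (leftField A) x, powAction m (leftField A) y⁆ := by
  rw [lie_powAction]
  rfl

/-- Injectivity moves the identities to ℂ[G^m]. There φ([x, r]) is the left invariant operation of
[Δx, r^{(m)}], which gives the left half of compatibility; the right half contributes nothing, since
right invariant fields commute with φ(x). -/
lemma isPoissonAction_diagonalField :
    IsPoissonAction D.rSt (D.diagonalField m hρ) (D.mixedBracket m hbr hρ) where
  quasitriangular := D.isQuasitriangular_rSt
  poisson := D.isPoissonBracket_mixedBracket hbr hρ
  map_lie x y := by
    ext F
    refine powIncl_injective (quotientRing D.N) ?_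
    rw [Derivation.commutator_apply, map_sub]
    simp only [powIncl_diagonalField]
    rw [← Derivation.commutator_apply, ← powAction_leftField_lie]
    rfl
  compat x F H := by
    refine powIncl_injective (quotientRing D.N) ?_
    rw [map_act₂ (powIncl m (quotientRing D.N)) (ρ := D.diagonalField m hρ)
      (σ := powAction m (leftField A) ∘ₗ diagonal m) (D.powIncl_diagonalField hρ), ← act₂_map,
      ← lie_diagonal_polyuble D.lie_casimir, act₂_lie powAction_leftField_lie]
    simp only [map_sub, map_add, powIncl_diagonalField, ← polyubleBracket_powIncl,
      polyubleBracket_eq, LinearMap.sub_apply]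
    rw [derivation_act₂_of_lie_eq_zero (σ := powAction m (rightField A))]
    · abel
    · intro y
      rw [lie_powAction]
      exact Finset.sum_eq_zero fun j _ => by rw [lie_leftField_rightField, slot_zero]

end StandardData

/-! ### The diagonal action -/

lemma quotientEval_eq (N : Subgroup (Pt A)) (p : Fin m → Pt A) (F : Pow (quotientRing N) m) :
    quotientEval N p F = prodEval (fun i => (p i).ofConv.toLinearMap) (powIncl m (quotientRing N) F) := by
  have : quotientEval N p = prodEval (fun i => (p i).ofConv.toLinearMap)
      ∘ₗ (powIncl m (quotientRing N)).toLinearMap :=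
    linearMap_ext_tprod fun f => by
      rw [quotientEval, LinearMap.comp_apply, AlgHom.toLinearMap_apply, powIncl_tprod,
        prodEval_tprod, prodEval_tprod]
      rfl
  exact LinearMap.congr_fun this F

lemma quotientOrbit_eq (N : Subgroup (Pt A)) (p : Fin m → Pt A) (F : Pow (quotientRing N) m) :
    quotientOrbit N p F = prodEval (fun i => (leftTrans (p i)).toLinearMap) (powIncl m (quotientRing N) F) := by
  have : quotientOrbit N p = prodEval (fun i => (leftTrans (p i)).toLinearMap)
      ∘ₗ (powIncl m (quotientRing N)).toLinearMap :=
    linearMap_ext_tprod fun f => by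
      rw [quotientOrbit, LinearMap.comp_apply, AlgHom.toLinearMap_apply, powIncl_tprod,
        prodEval_tprod, prodEval_tprod]
      rfl
  exact LinearMap.congr_fun this F

/-- `F ↦ F(· g)` on `ℂ[G^m]`. -/
def diagTrans (m : ℕ) (g : Pt A) : Pow A m →ₗ[ℂ] Pow A m :=
  PiTensorProduct.map fun _ => (rightTrans g).toLinearMap

lemma diagTrans_tprod (g : Pt A) (f : Fin m → A) :
    diagTrans m g (PiTensorProduct.tprod ℂ f) = PiTensorProduct.tprod ℂ fun i => rightTrans g (f i) :=
  PiTensorProduct.map_tprod _ _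

lemma powIncl_quotientDiagTrans (N : Subgroup (Pt A)) (g : Pt A) (F : Pow (quotientRing N) m) :
    powIncl m (quotientRing N) (quotientDiagTrans N m g F) = diagTrans m g (powIncl m (quotientRing N) F) := by
  have : (powIncl m (quotientRing N)).toLinearMap ∘ₗ quotientDiagTrans N m g
      = diagTrans m g ∘ₗ (powIncl m (quotientRing N)).toLinearMap :=
    linearMap_ext_tprod fun f => by
      rw [quotientDiagTrans, LinearMap.comp_apply, LinearMap.comp_apply, AlgHom.toLinearMap_apply,
        AlgHom.toLinearMap_apply, PiTensorProduct.map_tprod, powIncl_tprod, powIncl_tprod,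
        diagTrans_tprod]
      rfl
  exact LinearMap.congr_fun this F

/-- Evaluation of functions on `G^m` at a point. -/
def powEval (p : Fin m → Pt A) : Pow A m →ₐ[ℂ] ℂ :=
  AlgHom.ofLinearMap (prodEval fun i => (p i).ofConv.toLinearMap)
    (by rw [PiTensorProduct.one_def, prodEval_tprod]; simp)
    (by
      have : (LinearMap.mul ℂ (Pow A m)).compr₂ (prodEval fun i => (p i).ofConv.toLinearMap)
          = (LinearMap.mul ℂ ℂ).compl₁₂ (prodEval fun i => (p i).ofConv.toLinearMap)
            (prodEval fun i => (p i).ofConv.toLinearMap) :=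
        bilinearMap_ext_tprod fun f g => by
          simp only [LinearMap.compr₂_apply, LinearMap.compl₁₂_apply, LinearMap.mul_apply',
            PiTensorProduct.tprod_mul_tprod, prodEval_tprod, ← Finset.prod_mul_distrib]
          simp
      exact fun F H => LinearMap.congr_fun₂ this F H)

lemma powEval_tprod (p : Fin m → Pt A) (f : Fin m → A) :
    powEval p (PiTensorProduct.tprod ℂ f) = ∏ i, (p i).ofConv (f i) := prodEval_tprod _ _

lemma powEval_slot_diagTrans {X Y : Derivation ℂ A A} (p : Fin m → Pt A) (g : Pt A) (k : Fin m)
    (h : ∀ f, (p k * g).ofConv (X f) = (p k).ofConv (Y (rightTrans g f))) (F : Pow A m) :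
    powEval (fun i => p i * g) (slot m k X F) = powEval p (slot m k Y (diagTrans m g F)) := by
  have : (powEval fun i => p i * g).toLinearMap ∘ₗ (slot m k X : Pow A m →ₗ[ℂ] Pow A m)
      = (powEval p).toLinearMap ∘ₗ (slot m k Y : Pow A m →ₗ[ℂ] Pow A m) ∘ₗ diagTrans m g :=
    linearMap_ext_tprod fun f => by
      simp only [LinearMap.comp_apply, AlgHom.toLinearMap_apply, Derivation.coeFn_coe,
        diagTrans_tprod, slot_tprod, powEval_tprod]
      refine Finset.prod_congr rfl fun i _ => ?_
      by_cases hi : i = k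
      · subst hi; rw [Function.update_self, Function.update_self, h]
      · rw [Function.update_of_ne hi, Function.update_of_ne hi, apply_rightTrans]
  exact LinearMap.congr_fun this F

lemma powEval_powAction_diagTrans {ρ σ : lieAlg A →ₗ[ℂ] Derivation ℂ A A} (p : Fin m → Pt A)
    (g : Pt A)
    (h : ∀ k x f, (p k * g).ofConv (ρ x f) = (p k).ofConv (σ x (rightTrans g f)))
    (x : Fin m → lieAlg A) (F : Pow A m) :
    powEval (fun i => p i * g) (powAction m ρ x F) = powEval p (powAction m σ x (diagTrans m g F)) := by
  simp only [powAction_apply, derivation_sum_apply, map_sum]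
  exact Finset.sum_congr rfl fun k _ => powEval_slot_diagTrans p g k (h k (x k)) F

lemma algHom_act₂_congr {B C E V : Type*} [CommRing B] [Algebra ℂ B] [CommRing C] [Algebra ℂ C]
    [CommRing E] [Algebra ℂ E] [AddCommGroup V] [Module ℂ V] (u : B →ₐ[ℂ] E) (v : C →ₐ[ℂ] E)
    {ρ : V →ₗ[ℂ] Derivation ℂ B B} {σ : V →ₗ[ℂ] Derivation ℂ C C} {f h : B} {f' h' : C}
    (hf : ∀ x, u (ρ x f) = v (σ x f')) (hh : ∀ x, u (ρ x h) = v (σ x h')) (t : V ⊗[ℂ] V) :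
    u (act₂ ρ t f h) = v (act₂ σ t f' h') := by
  induction t with
  | zero => simp
  | add t t' ht ht' => simp only [map_add, LinearMap.add_apply, ht, ht']
  | tmul x y => rw [act₂_tmul, act₂_tmul, map_mul, map_mul, hf, hh]

lemma leftField_prodEval (p : Fin m → Pt A) (x : lieAlg A) (F : Pow A m) :
    leftField A x (prodEval (fun i => (leftTrans (p i)).toLinearMap) F)
      = prodEval (fun i => (leftTrans (p i)).toLinearMap)
          (powAction m (leftField A) (diagonal m x) F) := by
  have : (leftField A x : A →ₗ[ℂ] A) ∘ₗ prodEval (fun i => (leftTrans (p i)).toLinearMap)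
      = prodEval (fun i => (leftTrans (p i)).toLinearMap)
        ∘ₗ (powAction m (leftField A) (diagonal m x) : Pow A m →ₗ[ℂ] Pow A m) :=
    linearMap_ext_tprod fun f => by
      simp only [LinearMap.comp_apply, Derivation.coeFn_coe, prodEval_tprod, derivation_prod,
        powAction_apply, derivation_sum_apply, slot_tprod, map_sum]
      refine Finset.sum_congr rfl fun k _ => ?_
      rw [← Finset.mul_prod_erase _ _ (Finset.mem_univ k), Function.update_self]
      congr 1
      · exact (map_leftTrans_field x (p k) (f k)).symm
      · exact Finset.prod_congr rfl fun i hi => by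
          rw [Function.update_of_ne (Finset.ne_of_mem_erase hi)]
  exact LinearMap.congr_fun this F

lemma apply_prodEval_leftTrans (p : Fin m → Pt A) (g : Pt A) (F : Pow A m) :
    g.ofConv (prodEval (fun i => (leftTrans (p i)).toLinearMap) F)
      = powEval (fun i => p i * g) F := by
  have : g.ofConv.toLinearMap ∘ₗ prodEval (fun i => (leftTrans (p i)).toLinearMap)
      = (powEval fun i => p i * g).toLinearMap :=
    linearMap_ext_tprod fun f => by
      simp only [LinearMap.comp_apply, AlgHom.toLinearMap_apply, prodEval_tprod, powEval_tprod,
        map_prod, apply_leftTrans]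
  exact LinearMap.congr_fun this F

/-- The diagonal right action of `G` on `G^m` with the polyuble structure is Poisson. -/
lemma StandardData.powEval_polyubleBracket (p : Fin m → Pt A) (g : Pt A) (F H : Pow A m) :
    powEval (fun i => p i * g) (polyubleBracket m D.rSt F H)
      = powEval p (polyubleBracket m D.rSt (diagTrans m g F) (diagTrans m g H))
        + g.ofConv (groupBracket D.rSt (prodEval (fun i => (leftTrans (p i)).toLinearMap) F)
            (prodEval (fun i => (leftTrans (p i)).toLinearMap) H)) := by
  let φ : lieAlg A →ₗ[ℂ] lieAlg A := (adInv g : lieAlg A →ₗ[ℂ] lieAlg A)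
  -- Right invariant fields commute with right translation, whereas left invariant ones are twisted
  -- by Ad(g⁻¹), as `hL` records.
  have hR : ∀ (x : Fin m → lieAlg A) (F : Pow A m),
      powEval (fun i => p i * g) (powAction m (rightField A) x F)
        = powEval p (powAction m (rightField A) x (diagTrans m g F)) :=
    powEval_powAction_diagTrans p g fun k x f => by
      rw [← map_rightTrans_field, apply_rightTrans]
  have hL : ∀ (x : Fin m → lieAlg A) (F : Pow A m),
      powEval (fun i => p i * g) (powAction m (leftField A ∘ₗ φ) x F)
        = powEval p (powAction m (leftField A) x (diagTrans m g F)) :=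
    powEval_powAction_diagTrans p g fun k x f => by
      have : rightTrans g (leftField A (φ x) f) = leftField A x (rightTrans g f) := by
        change rightTrans g ((conjField g x).1 f) = _
        rw [conjField_apply, rightTrans_rightTrans, mul_inv_cancel, rightTrans_one]
        rfl
      rw [← this, apply_rightTrans]; rfl
  -- Along the orbit map g ↦ p·g, the field x^L on G corresponds to the diagonal field on G^m.
  have hO : ∀ (x : lieAlg A) (F : Pow A m),
      g.ofConv (leftField A x (prodEval (fun i => (leftTrans (p i)).toLinearMap) F))
        = powEval (fun i => p i * g) ((powAction m (leftField A) ∘ₗ diagonal m) x F) := fun x F => by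
    rw [leftField_prodEval, apply_prodEval_leftTrans]
    rfl
  -- The twist changes r^{(m)} by Δ(φ(r)) - Δ(r). Pulled back along the orbit this is r^R - r^L at
  -- g, minus the group bracket, which the last term of the claim compensates.
  have key := map_compLeft_polyuble (m := m) (r := D.rSt) (φ := φ) (D.map_casimir (adInv g))
  rw [D.polyubleBracket_eq, D.groupBracket_eq]
  simp only [LinearMap.sub_apply, map_sub]
  rw [algHom_act₂_congr _ _ (fun x => hR x F) (fun x => hR x H),
    ← algHom_act₂_congr _ _ (fun x => hL x F) (fun x => hL x H), ← powAction_comp, ← act₂_map, key,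
    ← act₂_apply_adInv, algHom_act₂_congr _ _ (fun x => hO x F) (fun x => hO x H),
    algHom_act₂_congr _ _ (fun x => hO x F) (fun x => hO x H), ← act₂_map, ← act₂_map]
  simp only [map_add, map_sub, LinearMap.add_apply, LinearMap.sub_apply]
  abel

lemma StandardData.isDiagonalPoissonAction
    (hbr : ∀ f ∈ quotientRing D.N, ∀ g ∈ quotientRing D.N,
      groupBracket D.rSt f g ∈ quotientRing D.N)
    (hρ : ∀ z, ∀ f ∈ quotientRing D.N, D.rho z f ∈ quotientRing D.N) :
    IsDiagonalPoissonAction D.N m (groupBracket D.rSt) (D.mixedBracket m hbr hρ) where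
  group := D.isPoissonLieGroup
  poisson := D.isPoissonBracket_mixedBracket hbr hρ
  action p g F H := by
    simp only [quotientEval_eq, quotientOrbit_eq, ← D.polyubleBracket_powIncl hbr hρ,
      powIncl_quotientDiagTrans]
    exact D.powEval_polyubleBracket p g _ _

end Quotient

end PolyPoisson

end

theorem mainTheorem2 {A : Type*} [CommRing A] [HopfAlgebra ℂ A] [Algebra.FiniteType ℂ A]
    [IsDomain A] [LieAlgebra.IsSemisimple ℂ (PolyPoisson.lieAlg A)]
    (D : PolyPoisson.StandardData (PolyPoisson.lieAlg A)) (m : ℕ) (hm : 1 ≤ m) :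
    ∃ (hbr : ∀ f ∈ PolyPoisson.quotientRing D.N, ∀ g ∈ PolyPoisson.quotientRing D.N,
        PolyPoisson.groupBracket D.rSt f g ∈ PolyPoisson.quotientRing D.N)
      (hρ : ∀ z, ∀ f ∈ PolyPoisson.quotientRing D.N, D.rho z f ∈ PolyPoisson.quotientRing D.N),
      (PolyPoisson.IsDiagonalPoissonAction D.N m (PolyPoisson.groupBracket D.rSt)
          (D.mixedBracket m hbr hρ)
        ∧ PolyPoisson.IsPoissonAction D.rSt (D.diagonalField m hρ) (D.mixedBracket m hbr hρ))
      ∧ PolyPoisson.IsPoissonBracket (PolyPoisson.polyubleBracket m D.rSt)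
      ∧ Function.Injective (PolyPoisson.powIncl m (PolyPoisson.quotientRing D.N))
      ∧ (∀ F : PolyPoisson.Pow A m,
          F ∈ (PolyPoisson.powIncl m (PolyPoisson.quotientRing D.N)).range ↔
            ∀ n p : Fin m → PolyPoisson.Pt A, (∀ i, n i ∈ D.N) →
              PolyPoisson.prodEval (fun i => (n i * p i).ofConv.toLinearMap) F
                = PolyPoisson.prodEval (fun i => (p i).ofConv.toLinearMap) F)
      ∧ ∀ F H : PolyPoisson.Pow (PolyPoisson.quotientRing D.N) m,
          PolyPoisson.polyubleBracket m D.rSt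
              (PolyPoisson.powIncl m (PolyPoisson.quotientRing D.N) F)
              (PolyPoisson.powIncl m (PolyPoisson.quotientRing D.N) H)
            = PolyPoisson.powIncl m (PolyPoisson.quotientRing D.N)
                (D.mixedBracket m hbr hρ F H) :=
  ⟨fun _ hf _ hg => D.groupBracket_mem hf hg, fun z _ hf => D.rho_mem z hf,
    ⟨D.isDiagonalPoissonAction _ _, D.isPoissonAction_diagonalField _ _⟩,
    D.isPoissonBracket_polyubleBracket m, PolyPoisson.powIncl_injective _,
    PolyPoisson.mem_range_powIncl_iff D.nilradical, D.polyubleBracket_powIncl _ _⟩
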